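/- Digraphs are finite and simple (no loops, no parallel arcs). A digraph is \emph{semi-complete} if any two distinct vertices $u,v$ are joined by at least one of the arcs $(u,v)$, $(v,u)$. For a vertex ordering $\pi$ of a digraph $D$ on $n$ vertices and $0\le i\le n$, the $i$-th cut of $\pi$ is the set of arcs whose tail is not among the first $i$ vertices of $\pi$ and whose head is; the width of $\pi$ is the maximum size of its cuts, and the cutwidth $\mathsf{ctw}(D)$ is the minimum width of a vertex ordering of $D$. Polynomial time means a number of steps of a (unit-cost, multiplication-free) random access machine that is polynomial in the bit length of the input; an oracle call counts as one step. Digraphs are given by their adjacency matrices and integers in binary. (1) There is a polynomial-time algorithm that, given a semi-complete digraph $D$ on $n$ vertices and an integer $c$, either correctly reports that $\mathsf{ctw}(D)>c$, or outputs a list of at most $n$ induced subdigraphs $D_1,\dots,D_\ell$ of $D$ (given by their vertex sets), each with at most $24c^2+40c+1$ vertices, such that $\mathsf{ctw}(D)\le c$ if and only if $\mathsf{ctw}(D_i)\le c$ for each $i\in\{1,\dots,\ell\}$. Let \textsc{Cutwidth} be the problem of deciding, for a semi-complete digraph $D$ and an integer $c\ge 0$ (the parameter), whether $\mathsf{ctw}(D)\le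 c$. Then, consequently: (2) \textsc{Cutwidth} has a quadratic AND-Turing kernel: there are a polynomial $q$ of degree at most $2$ and a polynomial-time algorithm without oracle calls that maps every instance $(D,c)$, where $D$ has $n$ vertices, to a list of at most $n$ instances $(D_i,c_i)$ of \textsc{Cutwidth}, each with at most $q(c)$ vertices and with $c_i\le q(c)$, such that $\mathsf{ctw}(D)\le c$ if and only if $\mathsf{ctw}(D_i)\le c_i$ for all $i$. (3) \textsc{Cutwidth} has a quadratic Turing kernel with at most $n$ oracle calls: there are a polynomial $q$ of degree at most $2$ and a polynomial-time oracle algorithm that, on every instance $(D,c)$, where $D$ has $n$ vertices, decides correctly whether $\mathsf{ctw}(D)\le c$, given any oracle that answers correctly on the instances of \textsc{Cutwidth} with at most $q(c)$ vertices and parameter at most $q(c)$; it makes at most $n$ oracle calls, all of them on such instances. -/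

import Mathlib

/-! ## Semi-complete digraphs and cutwidth -/

namespace CutKernel

/-- A simple digraph (no loops; parallel arcs do not exist in `Digraph`) in which any two distinct
vertices are joined by an arc in at least one direction. -/
def SemiComplete {V : Type*} (D : Digraph V) : Prop :=
  (∀ v, ¬ D.Adj v v) ∧ ∀ u v, u ≠ v → D.Adj u v ∨ D.Adj v u

/-- The subdigraph of `D` induced by the vertex set `X`. -/
def induced {V : Type*} (D : Digraph V) (X : Finset V) : Digraph X where
  Adj u v := D.Adj u v

/-- A vertex ordering of a digraph on `V`; positions are numbered from `0`. -/
abbrev VertexOrdering (V : Type*) [Fintype V] : Type _ := V ≃ Fin (Fintype.card V)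

/-- The size of the `i`-th cut of the ordering `π`: the number of arcs whose tail is outside the
prefix of length `i` and whose head is inside it. -/
noncomputable def cutSize {V : Type*} [Fintype V] (D : Digraph V) (π : VertexOrdering V)
    (i : ℕ) : ℕ :=
  {a : V × V | D.Adj a.1 a.2 ∧ i ≤ (π a.1 : ℕ) ∧ (π a.2 : ℕ) < i}.ncard

/-- The width of an ordering: the largest entry of its cut vector. -/
noncomputable def width {V : Type*} [Fintype V] (D : Digraph V) (π : VertexOrdering V) : ℕ :=
  (Finset.range (Fintype.card V + 1)).sup (cutSize D π)

/-- The cutwidth of a digraph: the minimum width of a vertex ordering (a minimum over a nonempty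
set of natural numbers). -/
noncomputable def ctw {V : Type*} [Fintype V] (D : Digraph V) : ℕ :=
  sInf (Set.range (width D))

/-! ## Random access machine programs with oracle calls

Unit-cost random access machines with addition, truncated subtraction and comparison (but no
multiplication), given as structured programs. Numbers at most double in one arithmetic operation,
so polynomial time in this model is the usual polynomial time. -/

/-- Expressions: constants, registers, array cells `a[i]`, addition, truncated subtraction,
and the tests `e < f`, `e = f` with value `1` (true) or `0` (false). -/
inductive Expr : Type
  | const (k : ℕ)
  | reg (x : ℕ)
  | cell (a : ℕ) (i : Expr)
  | add (e f : Expr)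
  | sub (e f : Expr)
  | lt (e f : Expr)
  | eq (e f : Expr)

/-- Programs. `setReg` and `setCell` assign to a register and to an array cell, `write` appends a
number to the output, `push` appends a number to the query tape, `ask x` calls the oracle on the
content of the query tape, stores the answer in register `x` and erases the query tape. -/
inductive Prog : Type
  | skip
  | setReg (x : ℕ) (e : Expr)
  | setCell (a : ℕ) (i e : Expr)
  | write (e : Expr)
  | push (e : Expr)
  | ask (x : ℕ)
  | seq (p q : Prog)
  | cond (e : Expr) (p q : Prog)
  | loop (e : Expr) (p : Prog)

/-- A configuration: registers, arrays, the output written so far, the current query tape, and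
the record (in order) of all oracle queries made so far, which programs cannot read. -/
structure State : Type where
  reg : ℕ → ℕ
  cell : ℕ → ℕ → ℕ
  out : List ℕ
  tape : List ℕ
  asked : List (List ℕ)

/-- The value of an expression. -/
def Expr.eval (s : State) : Expr → ℕ
  | .const k => k
  | .reg x => s.reg x
  | .cell a i => s.cell a (i.eval s)
  | .add e f => e.eval s + f.eval s
  | .sub e f => e.eval s - f.eval s
  | .lt e f => if e.eval s < f.eval s then 1 else 0
  | .eq e f => if e.eval s = f.eval s then 1 else 0

/-- The number of steps for evaluating an expression: one per constant, access and operation. -/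
def Expr.cost : Expr → ℕ
  | .const _ => 1
  | .reg _ => 1
  | .cell _ i => i.cost + 1
  | .add e f => e.cost + f.cost + 1
  | .sub e f => e.cost + f.cost + 1
  | .lt e f => e.cost + f.cost + 1
  | .eq e f => e.cost + f.cost + 1

/-- An oracle answers `true` or `false` to every query. -/
abbrev Oracle : Type := List ℕ → Bool

/-- `Exec O P s t s'`: with oracle `O`, the program `P` started in `s` halts in `s'` after exactly
`t` steps. An oracle call counts as one step. -/
inductive Exec (O : Oracle) : Prog → State → ℕ → State → Prop
  | skip (s : State) : Exec O .skip s 1 s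
  | setReg (s : State) (x : ℕ) (e : Expr) :
      Exec O (.setReg x e) s (e.cost + 1)
        { s with reg := Function.update s.reg x (e.eval s) }
  | setCell (s : State) (a : ℕ) (i e : Expr) :
      Exec O (.setCell a i e) s (i.cost + e.cost + 1)
        { s with
          cell := Function.update s.cell a
            (Function.update (s.cell a) (i.eval s) (e.eval s)) }
  | write (s : State) (e : Expr) :
      Exec O (.write e) s (e.cost + 1) { s with out := s.out ++ [e.eval s] }
  | push (s : State) (e : Expr) :
      Exec O (.push e) s (e.cost + 1) { s with tape := s.tape ++ [e.eval s] }
  | ask (s : State) (x : ℕ) :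
      Exec O (.ask x) s 1
        { s with
          reg := Function.update s.reg x (if O s.tape then 1 else 0)
          tape := []
          asked := s.asked ++ [s.tape] }
  | seq {p q : Prog} {s₁ s₂ s₃ : State} {t₁ t₂ : ℕ} :
      Exec O p s₁ t₁ s₂ → Exec O q s₂ t₂ s₃ → Exec O (.seq p q) s₁ (t₁ + t₂) s₃
  | condTrue {e : Expr} {p q : Prog} {s s' : State} {t : ℕ} :
      e.eval s ≠ 0 → Exec O p s t s' → Exec O (.cond e p q) s (e.cost + 1 + t) s'
  | condFalse {e : Expr} {p q : Prog} {s s' : State} {t : ℕ} :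
      e.eval s = 0 → Exec O q s t s' → Exec O (.cond e p q) s (e.cost + 1 + t) s'
  | loopDone {e : Expr} {p : Prog} {s : State} :
      e.eval s = 0 → Exec O (.loop e p) s (e.cost + 1) s
  | loopStep {e : Expr} {p : Prog} {s₁ s₂ s₃ : State} {t₁ t₂ : ℕ} :
      e.eval s₁ ≠ 0 → Exec O p s₁ t₁ s₂ → Exec O (.loop e p) s₂ t₂ s₃ →
        Exec O (.loop e p) s₁ (e.cost + 1 + t₁ + t₂) s₃

/-- The initial configuration on input `x`: array `0` holds `x`, register `0` holds the number of
entries of `x`, everything else is zero or empty. -/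
def initState (x : List ℕ) : State where
  reg := Function.update (fun _ => 0) 0 x.length
  cell := Function.update (fun _ _ => 0) 0 (fun i => x.getD i 0)
  out := []
  tape := []
  asked := []

/-- With oracle `O`, the program `P` on input `x` halts after `t` steps with output `y`, and `qs`
is the list of the oracle queries it made. -/
def Runs (O : Oracle) (P : Prog) (x : List ℕ) (t : ℕ) (qs : List (List ℕ)) (y : List ℕ) : Prop :=
  ∃ s, Exec O P (initState x) t s ∧ s.out = y ∧ s.asked = qs

/-- The length of an input in bits, with one extra symbol per entry as a separator. -/
def bitLength (x : List ℕ) : ℕ := (x.map fun a => Nat.size a + 1).sum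

/-- The program `P` on input `x` halts within `b` steps with output `y`, without oracle calls. -/
def Outputs (P : Prog) (x : List ℕ) (b : ℕ) (y : List ℕ) : Prop :=
  ∀ O : Oracle, ∃ t ≤ b, Runs O P x t [] y

/-! ## Encodings -/

open Classical in
/-- The adjacency matrix of a digraph on `{0, …, n-1}`, row by row, as a list of bits. -/
noncomputable def adjBits {n : ℕ} (D : Digraph (Fin n)) : List ℕ :=
  List.ofFn fun k : Fin (n * n) => if D.Adj k.divNat k.modNat then 1 else 0

/-- The input that represents a digraph on `{0, …, n-1}` and an integer: the number of vertices,
the sign and the absolute value of the integer, and the adjacency matrix. -/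
noncomputable def encodeInput {n : ℕ} (D : Digraph (Fin n)) (c : ℤ) : List ℕ :=
  n :: (if c < 0 then 1 else 0) :: c.natAbs :: adjBits D

/-- A vertex set as its characteristic vector. -/
def encodeSet {n : ℕ} (X : Finset (Fin n)) : List ℕ :=
  List.ofFn fun v : Fin n => if v ∈ X then 1 else 0

/-- The two kinds of output: `none` (the report that the cutwidth exceeds the target) is written
`0`; a list of induced subdigraphs, each given by its vertex set, is written `1`, followed by the
length of the list and by the sets. -/
def encodeOutput {n : ℕ} : Option (List (Finset (Fin n))) → List ℕ
  | none => [0]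
  | some L => 1 :: L.length :: L.flatMap encodeSet

/-! ## Parameterized problems and Turing kernels -/

/-- A parameterized problem: instances, with an unambiguous encoding, a size measure, a parameter,
and the set of yes-instances. -/
structure ParamProblem where
  Inst : Type
  encode : Inst → List ℕ
  encode_injective : Function.Injective encode
  size : Inst → ℕ
  param : Inst → ℕ
  Yes : Inst → Prop

/-- The instances whose size and parameter are at most `b`. -/
def ParamProblem.Small (Q : ParamProblem) (b : ℕ) (J : Q.Inst) : Prop :=
  Q.size J ≤ b ∧ Q.param J ≤ b

/-- A list of instances: its length, then every instance preceded by the length of its code. -/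
def ParamProblem.encodeList (Q : ParamProblem) (L : List Q.Inst) : List ℕ :=
  L.length :: L.flatMap fun J => (Q.encode J).length :: Q.encode J

open Classical in
/-- `Q` has a Turing kernel of size `q` with at most `calls I` oracle calls on instance `I`: a
polynomial-time program that resolves every instance `I` when given any oracle that is correct on
the instances of size and parameter at most `q (param I)`, and that queries only such instances. -/
def HasTuringKernel (Q : ParamProblem) (q : ℕ → ℕ) (calls : Q.Inst → ℕ) : Prop :=
  ∃ (P : Prog) (p : Polynomial ℕ), ∀ (I : Q.Inst) (O : Oracle),
    (∀ J, Q.Small (q (Q.param I)) J → (O (Q.encode J) = true ↔ Q.Yes J)) →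
    ∃ t ≤ p.eval (bitLength (Q.encode I)), ∃ qs,
      Runs O P (Q.encode I) t qs [if Q.Yes I then 1 else 0] ∧
      qs.length ≤ calls I ∧
      ∀ x ∈ qs, ∃ J, Q.Small (q (Q.param I)) J ∧ x = Q.encode J

/-- `Q` has an AND-Turing kernel of size `q` with at most `calls I` output instances on instance
`I`: a polynomial-time program without oracle calls that outputs a list of instances of size and
parameter at most `q (param I)` such that `I` is a yes-instance if and only if all the listed
instances are. -/
def HasAndTuringKernel (Q : ParamProblem) (q : ℕ → ℕ) (calls : Q.Inst → ℕ) : Prop :=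
  ∃ (P : Prog) (p : Polynomial ℕ), ∀ I : Q.Inst, ∃ L : List Q.Inst,
    Outputs P (Q.encode I) (p.eval (bitLength (Q.encode I))) (Q.encodeList L) ∧
    L.length ≤ calls I ∧
    (∀ J ∈ L, Q.Small (q (Q.param I)) J) ∧
    (Q.Yes I ↔ ∀ J ∈ L, Q.Yes J)

/-- An instance of Cutwidth on semi-complete digraphs: a semi-complete digraph on
`{0, …, n-1}` and a target width. -/
structure CutwidthInst : Type where
  n : ℕ
  D : Digraph (Fin n)
  semiComplete : SemiComplete D
  c : ℕ

theorem adjBits_injective {n : ℕ} {D D' : Digraph (Fin n)} (h : adjBits D = adjBits D') :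
    D = D' := by
  classical
  have h1 := List.ofFn_injective h
  ext u v
  have h2 := congrFun h1 (finProdFinEquiv (u, v))
  have h3 : finProdFinEquiv.symm (finProdFinEquiv (u, v)) = (u, v) :=
    finProdFinEquiv.symm_apply_apply _
  have h4 : (finProdFinEquiv (u, v)).divNat = u := congrArg Prod.fst h3
  have h5 : (finProdFinEquiv (u, v)).modNat = v := congrArg Prod.snd h3
  simp only [h4, h5] at h2
  by_cases ha : D.Adj u v <;> by_cases hb : D'.Adj u v <;> simp_all

/-- The Cutwidth problem on semi-complete digraphs, parameterized by the target width; the size of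
an instance is its number of vertices. -/
noncomputable def cutwidthProblem : ParamProblem where
  Inst := CutwidthInst
  encode I := encodeInput I.D I.c
  encode_injective := by
    rintro ⟨n, D, h, c⟩ ⟨n', D', h', c'⟩ he
    simp only [encodeInput, List.cons.injEq, Int.natAbs_natCast] at he
    obtain ⟨rfl, -, rfl, he⟩ := he
    obtain rfl := adjBits_injective he
    rfl
  size I := I.n
  param I := I.c
  Yes I := ctw I.D ≤ I.c

end CutKernel

/-! The vertices are first sorted by the difference of in-degree and out-degree. By
`IsLayout.cutWeight_le_of_sorted` the width of this ordering is at most twice the cutwidth, so a cut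
larger than 2c certifies that the cutwidth exceeds c. Otherwise the ordering `pos` has width at most
2c and is made lean: in every window of radius 6c around a position, no vertex set that separates
the two ends of the window has a smaller cut than all prefixes that end in the window. If a window
violates this, moving a minimum cut of the window to the front increases no cut, by submodularity,
and decreases the sum of all cuts (`IsOrdering.totalCut_moveToFront_lt`), so the process stops after
at most n³ improvements.

In a semi-complete digraph the position of a vertex in a layout of width a differs from its
in-degree by at most a (`IsLayout.rank_le`, `IsLayout.indegree_le`). Hence two vertices that appear
in opposite orders in layouts of widths a and b are less than 2(a + b) apart in both
(`IsLayout.rank_lt_of_inversion`); for widths 2c and c this distance is 6c. If k is a local minimum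
of the cut vector of a lean ordering, then the prefix {pos < k} is a minimum cut among all sets in
the window of radius 6c around k. Any layout of width at most c can be uncrossed with this prefix
and so be changed, without loss of width, into one that starts with {pos < k} (`IsLayout.split`).

Since cuts are at most 2c, descending along the cut vector shows that consecutive local minima are
at distance at most 24c² + 1. Each pair of consecutive local minima gives a bag: the segment between
them, extended by 6c positions on both sides, together with the outer ends of the arcs over the ends
of this window, of which there are at most 4c. This makes at most 24c² + 16c + 1 vertices. A bag
sees all arcs of every cut inside its window (`cutWeight_bag`). Layouts of width c of all bags,
split at both minima, can therefore be concatenated segment by segment into a layout of width c of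
the whole digraph (`exists_isLayout_of_bags`); the converse is clear, because layouts restrict to
subsets.

For the running time, the algorithm is written in a language in which every loop is capped by the
input length N ≥ n² + 3. `BProg.halts_comp` compiles such programs correctly to random access
machines within a polynomial number of steps, so that only their denotation remains to be analysed.
Minimum cuts of windows are found by augmenting paths (`minCut_spec`). `kernel_spec` describes the
part common to the three programs of the theorem, which differ only in what they do with each bag:
write its vertex set, write the induced instance, or ask the oracle about it. -/

namespace CutKernel

/-! ## Bounded programs

A small language of programs whose loops are all bounded by the input length `N`, with a
denotational semantics, and its compilation to random access machine programs that run in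
polynomial time. -/

/-- Expressions with conditionals and bounded sums: `sum x b e` is the sum of `e` over the values
`0, …, min b N - 1` of the register `x`. -/
inductive BExpr : Type
  | const (k : ℕ)
  | reg (x : ℕ)
  | cell (a : ℕ) (i : BExpr)
  | add (e f : BExpr)
  | sub (e f : BExpr)
  | lt (e f : BExpr)
  | eq (e f : BExpr)
  | ite (e f g : BExpr)
  | sum (x : ℕ) (b e : BExpr)

/-- The value of a bounded expression for given arrays and registers. -/
def BExpr.eval (N : ℕ) (c : ℕ → ℕ → ℕ) : BExpr → (ℕ → ℕ) → ℕ
  | .const k, _ => k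
  | .reg x, r => r x
  | .cell a i, r => c a (i.eval N c r)
  | .add e f, r => e.eval N c r + f.eval N c r
  | .sub e f, r => e.eval N c r - f.eval N c r
  | .lt e f, r => if e.eval N c r < f.eval N c r then 1 else 0
  | .eq e f, r => if e.eval N c r = f.eval N c r then 1 else 0
  | .ite e f g, r => if e.eval N c r ≠ 0 then f.eval N c r else g.eval N c r
  | .sum x b e, r =>
      ∑ i ∈ Finset.range (min (b.eval N c r) N), e.eval N c (Function.update r x i)

/-- Bounded programs. `store a x b e` assigns to all cells `a[x]`, `x < min b N`, the value of `e`
simultaneously; `rep b p` runs `p` as often as `min b N` says. -/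
inductive BProg : Type
  | skip
  | setReg (x : ℕ) (e : BExpr)
  | setCell (a : ℕ) (i e : BExpr)
  | store (a x : ℕ) (b e : BExpr)
  | write (e : BExpr)
  | push (e : BExpr)
  | ask (x : ℕ)
  | seq (p q : BProg)
  | cond (e : BExpr) (p q : BProg)
  | rep (b : BExpr) (p : BProg)

/-- The value of a bounded expression in a state. -/
def BExpr.val (N : ℕ) (e : BExpr) (s : State) : ℕ := e.eval N s.cell s.reg

/-- The effect of a bounded program. -/
def BProg.run (N : ℕ) (O : Oracle) : BProg → State → State
  | .skip, s => s
  | .setReg x e, s => { s with reg := Function.update s.reg x (e.val N s) }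
  | .setCell a i e, s =>
      { s with
        cell := Function.update s.cell a
          (Function.update (s.cell a) (i.val N s) (e.val N s)) }
  | .store a x b e, s =>
      { s with
        cell := Function.update s.cell a fun i =>
          if i < min (b.val N s) N then e.eval N s.cell (Function.update s.reg x i)
          else s.cell a i }
  | .write e, s => { s with out := s.out ++ [e.val N s] }
  | .push e, s => { s with tape := s.tape ++ [e.val N s] }
  | .ask x, s =>
      { s with
        reg := Function.update s.reg x (if O s.tape then 1 else 0)
        tape := []
        asked := s.asked ++ [s.tape] }
  | .seq p q, s => q.run N O (p.run N O s)
  | .cond e p q, s => if e.val N s ≠ 0 then p.run N O s else q.run N O s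
  | .rep b p, s => (p.run N O)^[min (b.val N s) N] s

/-! ### Compilation -/

/-- The temporary cell number `d`. -/
def tmp (d : ℕ) : Expr := .cell 1 (.const d)

/-- Assignment to the temporary cell number `d`. -/
def setTmp (d : ℕ) (e : Expr) : Prog := .setCell 1 (.const d) e

/-- The cell that holds the bound on all loops. -/
def bound : Expr := .cell 3 (.const 0)

/-- Caps the temporary cell number `d` at the loop bound. -/
def capTmp (d : ℕ) : Prog := setTmp d (.sub (tmp d) (.sub (tmp d) bound))

/-- Runs `p` as often as the temporary cell number `d` says. -/
def countdown (d : ℕ) (p : Prog) : Prog :=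
  .loop (tmp d) (.seq (setTmp d (.sub (tmp d) (.const 1))) p)

/-- Compilation of expressions: the value is left in the temporary cell number `d`. -/
def BExpr.comp : BExpr → ℕ → Prog
  | .const k, d => setTmp d (.const k)
  | .reg x, d => setTmp d (.reg x)
  -- Array `a` of a bounded program is kept in machine array `2 * a`. The odd arrays are free for
  -- bookkeeping: `1` for temporaries, `3` for the loop bound, `5` as a buffer.
  | .cell a i, d => .seq (i.comp d) (setTmp d (.cell (2 * a) (tmp d)))
  | .add e f, d => .seq (e.comp d) (.seq (f.comp (d + 1)) (setTmp d (.add (tmp d) (tmp (d + 1)))))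
  | .sub e f, d => .seq (e.comp d) (.seq (f.comp (d + 1)) (setTmp d (.sub (tmp d) (tmp (d + 1)))))
  | .lt e f, d => .seq (e.comp d) (.seq (f.comp (d + 1)) (setTmp d (.lt (tmp d) (tmp (d + 1)))))
  | .eq e f, d => .seq (e.comp d) (.seq (f.comp (d + 1)) (setTmp d (.eq (tmp d) (tmp (d + 1)))))
  | .ite e f g, d => .seq (e.comp d) (.cond (tmp d) (f.comp d) (g.comp d))
  | .sum x b e, d =>
      .seq (b.comp (d + 1)) <| .seq (capTmp (d + 1)) <| .seq (setTmp d (.const 0)) <|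
      .seq (setTmp (d + 2) (.reg x)) <| .seq (.setReg x (.const 0)) <|
      .seq (countdown (d + 1) (.seq (e.comp (d + 3)) <|
        .seq (setTmp d (.add (tmp d) (tmp (d + 3)))) (.setReg x (.add (.reg x) (.const 1))))) <|
      .setReg x (tmp (d + 2))

/-- Compilation of programs; the temporary cells below `d` are not touched. -/
def BProg.comp : BProg → ℕ → Prog
  | .skip, _ => .skip
  | .setReg x e, d => .seq (e.comp d) (.setReg x (tmp d))
  | .setCell a i e, d =>
      .seq (i.comp d) (.seq (e.comp (d + 1)) (.setCell (2 * a) (tmp d) (tmp (d + 1))))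
  | .store a x b e, d =>
      .seq (b.comp d) <| .seq (capTmp d) <| .seq (setTmp (d + 1) (tmp d)) <|
      .seq (setTmp (d + 2) (.reg x)) <| .seq (.setReg x (.const 0)) <|
      -- The values are collected in the buffer first, because `e` may read the array that is
      -- overwritten.
      .seq (countdown d (.seq (e.comp (d + 3)) <|
        .seq (.setCell 5 (.reg x) (tmp (d + 3))) (.setReg x (.add (.reg x) (.const 1))))) <|
      .seq (.setReg x (.const 0)) <|
      .seq (countdown (d + 1) (.seq (.setCell (2 * a) (.reg x) (.cell 5 (.reg x)))
        (.setReg x (.add (.reg x) (.const 1))))) <|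
      .setReg x (tmp (d + 2))
  | .write e, d => .seq (e.comp d) (.write (tmp d))
  | .push e, d => .seq (e.comp d) (.push (tmp d))
  | .ask x, _ => .ask x
  | .seq p q, d => .seq (p.comp d) (q.comp d)
  | .cond e p q, d => .seq (e.comp d) (.cond (tmp d) (p.comp d) (q.comp d))
  | .rep b p, d => .seq (b.comp d) (.seq (capTmp d) (countdown d (p.comp (d + 1))))

open Polynomial in
/-- A bound on the running time of a compiled expression, as a polynomial in the loop bound. -/
noncomputable def BExpr.time : BExpr → Polynomial ℕ
  | .const _ => 3
  | .reg _ => 3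
  | .cell _ i => i.time + 5
  | .add e f => e.time + f.time + 7
  | .sub e f => e.time + f.time + 7
  | .lt e f => e.time + f.time + 7
  | .eq e f => e.time + f.time + 7
  | .ite e f g => e.time + f.time + g.time + 3
  | .sum _ b e => b.time + 30 + X * (e.time + 30)

open Polynomial in
/-- A bound on the running time of a compiled program, as a polynomial in the loop bound. -/
noncomputable def BProg.time : BProg → Polynomial ℕ
  | .skip => 1
  | .setReg _ e => e.time + 3
  | .setCell _ i e => i.time + e.time + 5
  | .store _ _ b e => b.time + 50 + X * (e.time + 50)
  | .write e => e.time + 3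
  | .push e => e.time + 3
  | .ask _ => 1
  | .seq p q => p.time + q.time
  | .cond e p q => e.time + p.time + q.time + 3
  | .rep b p => b.time + 30 + X * (p.time + 30)

/-- The program `P` halts from `s` within `T` steps in a state that satisfies `Q`. -/
def Halts (O : Oracle) (P : Prog) (s : State) (T : ℕ) (Q : State → Prop) : Prop :=
  ∃ t ≤ T, ∃ s', Exec O P s t s' ∧ Q s'

/-! ### Rules for the running time and the final state of machine programs. -/

section Rules

variable {O : Oracle} {P P' : Prog} {s : State} {T T' : ℕ} {Q Q' : State → Prop} {e : Expr}

theorem Halts.mono (h : Halts O P s T Q) (hT : T ≤ T') (hQ : ∀ s', Q s' → Q' s') :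
    Halts O P s T' Q' := by
  obtain ⟨t, ht, s', hs, hq⟩ := h
  exact ⟨t, ht.trans hT, s', hs, hQ _ hq⟩

theorem Halts.seq (h : Halts O P s T fun s' => Halts O P' s' T' Q) :
    Halts O (.seq P P') s (T + T') Q := by
  obtain ⟨t, ht, s', hs, t', ht', s'', hs', hq⟩ := h
  exact ⟨t + t', by omega, s'', .seq hs hs', hq⟩

theorem Halts.setReg {x : ℕ} (h : Q { s with reg := Function.update s.reg x (e.eval s) }) :
    Halts O (.setReg x e) s (e.cost + 1) Q :=
  ⟨_, le_rfl, _, .setReg s x e, h⟩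

theorem Halts.setCell {a : ℕ} {i : Expr}
    (h : Q { s with
      cell := Function.update s.cell a (Function.update (s.cell a) (i.eval s) (e.eval s)) }) :
    Halts O (.setCell a i e) s (i.cost + e.cost + 1) Q :=
  ⟨_, le_rfl, _, .setCell s a i e, h⟩

theorem Halts.cond (h : if e.eval s ≠ 0 then Halts O P s T Q else Halts O P' s T' Q) :
    Halts O (.cond e P P') s (e.cost + 1 + (T + T')) Q := by
  split_ifs at h with he
  · obtain ⟨t, ht, s', hs, hq⟩ := h
    exact ⟨_, by omega, s', .condTrue he hs, hq⟩
  · obtain ⟨t, ht, s', hs, hq⟩ := h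
    exact ⟨_, by omega, s', .condFalse (by simpa using he) hs, hq⟩

/-- The rule for counting loops: `I j` holds when `j` rounds are left. -/
theorem Halts.countdown {d : ℕ} (I : ℕ → State → Prop)
    (hd : ∀ j s, I j s → s.cell 1 d = j)
    (step : ∀ j s, I (j + 1) s →
      Halts O P { s with cell := Function.update s.cell 1 (Function.update (s.cell 1) d j) } T
        (I j)) :
    ∀ j s, I j s → Halts O (countdown d P) s (3 + j * (T + 9)) (I 0) := by
  intro j
  induction j with
  | zero =>
    intro s hs
    refine ⟨3, by omega, s, ?_, hs⟩
    exact .loopDone (e := tmp d) (by simpa [tmp, Expr.eval] using hd _ _ hs)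
  | succ j ih =>
    intro s hs
    have hj := hd _ _ hs
    obtain ⟨t, ht, s₁, h₁, hI⟩ := step j s hs
    obtain ⟨t', ht', s₂, h₂, hI'⟩ := ih s₁ hI
    -- The decrement takes 6 steps and the loop test 3; together they are the 9 of the bound.
    have h₀ : Exec O (.seq (setTmp d (.sub (tmp d) (.const 1))) P) s (6 + t) s₁ := by
      refine .seq (t₁ := 6) (Exec.setCell s 1 (.const d) (.sub (tmp d) (.const 1))) ?_
      simpa [tmp, Expr.eval, hj] using h₁
    refine ⟨_, ?_, s₂, .loopStep (e := tmp d) (by simp [tmp, Expr.eval, hj]) h₀ h₂, hI'⟩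
    simp only [Expr.cost, tmp]
    ring_nf at ht' ⊢
    omega

end Rules

/-- The states `s` and `s'` differ only in the temporary cells from number `d` on. -/
structure SameBelow (d : ℕ) (s s' : State) : Prop where
  reg : s'.reg = s.reg
  cell : ∀ a ≠ 1, s'.cell a = s.cell a
  tmp : ∀ i < d, s'.cell 1 i = s.cell 1 i
  out : s'.out = s.out
  tape : s'.tape = s.tape
  asked : s'.asked = s.asked

theorem SameBelow.trans {d d' : ℕ} {s s' s'' : State} (h : SameBelow d s s')
    (h' : SameBelow d' s' s'') (hd : d ≤ d') : SameBelow d s s'' where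
  reg := h'.reg.trans h.reg
  cell a ha := (h'.cell a ha).trans (h.cell a ha)
  tmp i hi := (h'.tmp i (hi.trans_le hd)).trans (h.tmp i hi)
  out := h'.out.trans h.out
  tape := h'.tape.trans h.tape
  asked := h'.asked.trans h.asked

theorem SameBelow.set {d d' : ℕ} (hd : d ≤ d') (s : State) (v : ℕ) :
    SameBelow d s
      { s with cell := Function.update s.cell 1 (Function.update (s.cell 1) d' v) } where
  reg := rfl
  cell a ha := by simp [ha]
  tmp i hi := by simp [(hi.trans_le hd).ne]
  out := rfl
  tape := rfl
  asked := rfl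

theorem SameBelow.eval_eq {d : ℕ} {s s' : State} (h : SameBelow d s s') (N : ℕ) (e : BExpr) :
    e.eval N (fun a => s'.cell (2 * a)) s'.reg = e.eval N (fun a => s.cell (2 * a)) s.reg := by
  rw [h.reg]
  congr 1
  ext a : 1
  exact h.cell _ (by omega)

/-! ### Correctness of the compilation. -/

theorem Halts.setTmp {O : Oracle} {s : State} {d : ℕ} {e : Expr} {Q : State → Prop}
    (h : Q { s with cell := Function.update s.cell 1 (Function.update (s.cell 1) d (e.eval s)) }) :
    Halts O (setTmp d e) s (e.cost + 2) Q :=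
  (Halts.setCell (i := .const d) h).mono (by simp only [Expr.cost]; omega) fun _ => id

/-- The common pattern of the four binary operations: the second operand is evaluated from temporary
`d + 1` on and so leaves the first one in temporary `d` intact. -/
theorem halts_comp_binary {O : Oracle} {N d : ℕ} {e f : BExpr} {s : State}
    {op : Expr → Expr → Expr} {g : ℕ → ℕ → ℕ}
    (hcost : ∀ x y, (op x y).cost = x.cost + y.cost + 1)
    (hop : ∀ s x y, (op x y).eval s = g (x.eval s) (y.eval s))
    (ihe : ∀ (d : ℕ) (s : State), s.cell 3 0 = N →
      Halts O (e.comp d) s (e.time.eval N) fun s' =>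
        SameBelow d s s' ∧ s'.cell 1 d = e.eval N (fun a => s.cell (2 * a)) s.reg)
    (ihf : ∀ (d : ℕ) (s : State), s.cell 3 0 = N →
      Halts O (f.comp d) s (f.time.eval N) fun s' =>
        SameBelow d s s' ∧ s'.cell 1 d = f.eval N (fun a => s.cell (2 * a)) s.reg)
    (hs : s.cell 3 0 = N) :
    Halts O (.seq (e.comp d) (.seq (f.comp (d + 1)) (setTmp d (op (tmp d) (tmp (d + 1)))))) s
      (e.time.eval N + f.time.eval N + 7) fun s' =>
        SameBelow d s s' ∧ s'.cell 1 d =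
          g (e.eval N (fun a => s.cell (2 * a)) s.reg)
            (f.eval N (fun a => s.cell (2 * a)) s.reg) := by
  refine Halts.mono (T := e.time.eval N + (f.time.eval N + 7)) ?_ (by omega) fun _ => id
  refine Halts.seq ((ihe d s hs).mono le_rfl ?_)
  rintro s₁ ⟨h₁, h₁'⟩
  refine Halts.seq ((ihf (d + 1) s₁ (by rw [h₁.cell _ (by decide), hs])).mono le_rfl ?_)
  rintro s₂ ⟨h₂, h₂'⟩
  refine (Halts.setTmp ⟨(h₁.trans h₂ (by omega)).trans (SameBelow.set le_rfl _ _) le_rfl, ?_⟩).mono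
    (by simp only [hcost, tmp, Expr.cost]; omega) fun _ => id
  rw [h₁.eval_eq] at h₂'
  simp [hop, tmp, Expr.eval, h₂', h₂.tmp d (by omega), h₁']

/-- Induction on the expression. Only a sum needs a loop; it saves its register in a temporary and
restores it at the end, so that the compiled expression has no effect outside the temporaries from
`d` on. -/
theorem BExpr.halts_comp (O : Oracle) (N : ℕ) (e : BExpr) (d : ℕ) (s : State)
    (hs : s.cell 3 0 = N) :
    Halts O (e.comp d) s (e.time.eval N) fun s' =>
      SameBelow d s s' ∧ s'.cell 1 d = e.eval N (fun a => s.cell (2 * a)) s.reg := by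
  induction e generalizing d s with
  | const k =>
    exact (Halts.setTmp ⟨SameBelow.set le_rfl _ _, by simp [Expr.eval, BExpr.eval]⟩).mono
      (by simp [Expr.cost, BExpr.time]) fun _ => id
  | reg x =>
    exact (Halts.setTmp ⟨SameBelow.set le_rfl _ _, by simp [Expr.eval, BExpr.eval]⟩).mono
      (by simp [Expr.cost, BExpr.time]) fun _ => id
  | cell a i ih =>
    refine Halts.mono (Halts.seq ((ih d s hs).mono le_rfl ?_))
      (by simp only [BExpr.time, Polynomial.eval_add, Polynomial.eval_ofNat]; exact le_rfl)
      fun _ => id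
    rintro s₁ ⟨h₁, h₁'⟩
    refine (Halts.setTmp ⟨h₁.trans (SameBelow.set le_rfl _ _) le_rfl, ?_⟩).mono
      (by simp [tmp, Expr.cost]) fun _ => id
    simp [tmp, Expr.eval, BExpr.eval, h₁', h₁.cell (2 * a) (by omega)]
  | add e f ihe ihf =>
    exact (halts_comp_binary (g := fun x y => x + y) (fun _ _ => rfl) (fun _ _ _ => rfl)
      ihe ihf hs).mono (by simp [BExpr.time]) fun _ => id
  | sub e f ihe ihf =>
    exact (halts_comp_binary (g := fun x y => x - y) (fun _ _ => rfl) (fun _ _ _ => rfl)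
      ihe ihf hs).mono (by simp [BExpr.time]) fun _ => id
  | lt e f ihe ihf =>
    exact (halts_comp_binary (g := fun x y => if x < y then 1 else 0) (fun _ _ => rfl)
      (fun _ _ _ => rfl) ihe ihf hs).mono (by simp [BExpr.time]) fun _ => id
  | eq e f ihe ihf =>
    exact (halts_comp_binary (g := fun x y => if x = y then 1 else 0) (fun _ _ => rfl)
      (fun _ _ _ => rfl) ihe ihf hs).mono (by simp [BExpr.time]) fun _ => id
  | ite e f g ihe ihf ihg =>
    refine Halts.mono (Halts.seq (T' := f.time.eval N + g.time.eval N + 3)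
      ((ihe d s hs).mono le_rfl ?_))
      (by simp only [BExpr.time, Polynomial.eval_add, Polynomial.eval_ofNat]; omega) fun _ => id
    rintro s₁ ⟨h₁, h₁'⟩
    have hs₁ : s₁.cell 3 0 = N := by rw [h₁.cell _ (by decide), hs]
    refine Halts.mono (Halts.cond (T := f.time.eval N) (T' := g.time.eval N) ?_)
      (by simp only [tmp, Expr.cost]; omega) fun _ => id
    have ht : (tmp d).eval s₁ = e.eval N (fun a => s.cell (2 * a)) s.reg := h₁'
    rw [ht]
    simp only [BExpr.eval]
    split_ifs
    · refine (ihf d s₁ hs₁).mono le_rfl fun s₂ h₂ => ⟨h₁.trans h₂.1 le_rfl, ?_⟩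
      rw [h₂.2, h₁.eval_eq]
    · refine (ihg d s₁ hs₁).mono le_rfl fun s₂ h₂ => ⟨h₁.trans h₂.1 le_rfl, ?_⟩
      rw [h₂.2, h₁.eval_eq]
  | sum x b e ihb ihe =>
    set c := fun a => s.cell (2 * a) with hc
    set m := min (b.eval N c s.reg) N with hm
    refine Halts.mono (T := b.time.eval N + (10 + (3 + (4 + (2 + ((3 + m * (e.time.eval N + 11 + 9))
      + 3)))))) ?_ ?_ fun _ => id
    swap
    · have : m ≤ N := min_le_right _ _
      simp only [BExpr.time, Polynomial.eval_add, Polynomial.eval_mul, Polynomial.eval_ofNat,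
        Polynomial.eval_X]
      nlinarith [Nat.mul_le_mul_right (e.time.eval N + 30) this]
    refine Halts.seq ((ihb (d + 1) s hs).mono le_rfl ?_)
    rintro s₁ ⟨h₁, h₁'⟩
    rw [← hc] at h₁'
    refine Halts.seq ((Halts.setTmp ?_).mono (by simp [tmp, bound, Expr.cost]) fun _ => id)
    refine Halts.seq ((Halts.setTmp ?_).mono (by simp [Expr.cost]) fun _ => id)
    refine Halts.seq ((Halts.setTmp ?_).mono (by simp [Expr.cost]) fun _ => id)
    refine Halts.seq ((Halts.setReg ?_).mono (by simp [Expr.cost]) fun _ => id)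
    have hN : s₁.cell 3 0 = N := by rw [h₁.cell _ (by decide), hs]
    -- After `k` rounds, with `j` to go, temporary `d` holds the partial sum, `d + 1` the countdown
    -- and `d + 2` the old content of the register `x`.
    refine Halts.seq ((Halts.countdown (fun j s' => ∃ k, k + j = m ∧ s'.cell 1 (d + 1) = j ∧
      s'.cell 1 d = ∑ i ∈ Finset.range k, e.eval N c (Function.update s.reg x i) ∧
      s'.cell 1 (d + 2) = s.reg x ∧ s'.reg = Function.update s.reg x k ∧
      (∀ a ≠ 1, s'.cell a = s.cell a) ∧ (∀ i < d, s'.cell 1 i = s.cell 1 i) ∧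
      s'.out = s.out ∧ s'.tape = s.tape ∧ s'.asked = s.asked) ?_ ?_ m _ ?_).mono le_rfl ?_)
    · rintro j s' ⟨k, -, h, -⟩
      exact h
    · rintro j s' ⟨k, hk, hj, hsum, hsave, hreg, hcell, htmp, ho, ht, ha⟩
      refine Halts.mono (T := e.time.eval N + (7 + 4)) ?_ (by omega) fun _ => id
      refine Halts.seq ((ihe (d + 3) _ ?_).mono le_rfl ?_)
      · simp [hcell, hs]
      rintro s₂ ⟨h₂, h₂'⟩
      refine Halts.seq ((Halts.setTmp ?_).mono (by simp [tmp, Expr.cost]) fun _ => id)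
      refine (Halts.setReg ?_).mono (by simp [Expr.cost]) fun _ => id
      have hv : s₂.cell 1 (d + 3) = e.eval N c (Function.update s.reg x k) := by
        rw [h₂', hreg]
        congr 1
        ext a : 1
        have : (2 * a) ≠ 1 := by omega
        simp [hc, this, hcell]
      have hd := h₂.tmp d (by omega)
      have hd1 := h₂.tmp (d + 1) (by omega)
      have hd2 := h₂.tmp (d + 2) (by omega)
      simp only [Function.update_self, ne_eq, Nat.left_eq_add, one_ne_zero, not_false_eq_true,
        Function.update_of_ne, Nat.add_left_cancel_iff, OfNat.ofNat_ne_one] at hd hd1 hd2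
      refine ⟨k + 1, by omega, ?_, ?_, ?_, ?_, ?_, ?_, ?_, ?_, ?_⟩
      · simp [hd1]
      · simp [tmp, Expr.eval, hd, hsum, hv, Finset.sum_range_succ]
      · simp [hd2, hsave]
      · simp [Expr.eval, h₂.reg, hreg]
      · intro a ha
        simp [ha, h₂.cell a ha, hcell]
      · intro i hi
        have := h₂.tmp i (by omega)
        simp only at this
        simp [hi.ne, this, show i ≠ d + 1 by omega, htmp i hi]
      · exact h₂.out.trans ho
      · exact h₂.tape.trans ht
      · exact h₂.asked.trans ha
    · refine ⟨0, by omega, ?_, ?_, ?_, ?_, ?_, ?_, h₁.out, h₁.tape, h₁.asked⟩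
      · simp [tmp, bound, Expr.eval, h₁', hN, hm]
        omega
      · simp [Expr.eval]
      · simp [Expr.eval, h₁.reg]
      · simp [Expr.eval, h₁.reg]
      · intro a ha
        simp [ha, h₁.cell a ha]
      · intro i hi
        simp [hi.ne, show i ≠ d + 1 by omega, show i ≠ d + 2 by omega, h₁.tmp i (by omega)]
    · rintro s' ⟨k, hk, hj, hsum, hsave, hreg, hcell, htmp, ho, ht, ha⟩
      refine (Halts.setReg ⟨⟨?_, hcell, htmp, ho, ht, ha⟩, ?_⟩).mono (by simp [tmp, Expr.cost])
        fun _ => id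
      · simp [tmp, Expr.eval, hsave, hreg]
      · obtain rfl : k = m := by omega
        exact hsum

/-- The machine state `s` represents the state `u` of a bounded program. -/
structure Represents (N : ℕ) (u s : State) : Prop where
  reg : s.reg = u.reg
  cell : ∀ a, s.cell (2 * a) = u.cell a
  bound : s.cell 3 0 = N
  out : s.out = u.out
  tape : s.tape = u.tape
  asked : s.asked = u.asked

theorem Represents.sameBelow {N d : ℕ} {u s s' : State} (h : Represents N u s)
    (h' : SameBelow d s s') : Represents N u s' where
  reg := h'.reg.trans h.reg
  cell a := (h'.cell _ (by omega)).trans (h.cell a)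
  bound := by rw [h'.cell _ (by decide), h.bound]
  out := h'.out.trans h.out
  tape := h'.tape.trans h.tape
  asked := h'.asked.trans h.asked

theorem Represents.halts_expr {N : ℕ} {u s : State} (h : Represents N u s) (O : Oracle)
    (e : BExpr) (d : ℕ) :
    Halts O (e.comp d) s (e.time.eval N) fun s' =>
      Represents N u s' ∧ s'.cell 1 d = e.val N u ∧ SameBelow d s s' := by
  refine (e.halts_comp O N d s h.bound).mono le_rfl ?_
  rintro s' ⟨h₁, h₂⟩
  refine ⟨h.sameBelow h₁, ?_, h₁⟩
  rw [h₂, BExpr.val, h.reg]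
  congr 1
  exact funext h.cell

theorem Represents.halts_bound {N : ℕ} {u s : State} (h : Represents N u s) (O : Oracle)
    (b : BExpr) (d : ℕ) :
    Halts O (.seq (b.comp d) (capTmp d)) s (b.time.eval N + 10) fun s' =>
      Represents N u s' ∧ s'.cell 1 d = min (b.val N u) N ∧ ∀ i < d, s'.cell 1 i = s.cell 1 i := by
  refine Halts.seq ((h.halts_expr O b d).mono le_rfl ?_)
  rintro s₁ ⟨h₁, hv, -, -, hd, -⟩
  refine (Halts.setTmp ⟨h₁.sameBelow (SameBelow.set le_rfl _ _), ?_, ?_⟩).mono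
    (by simp [tmp, CutKernel.bound, Expr.cost]) fun _ => id
  · simp [tmp, CutKernel.bound, Expr.eval, hv, h₁.bound]
    omega
  · intro i hi
    simp [hi.ne, hd i hi]

/-- Makes `Represents.halts_bound` applicable, which treats the evaluation and the capping of a loop
bound as one block. -/
theorem Halts.assoc {O : Oracle} {P Q R : Prog} {s : State} {T : ℕ} {A : State → Prop}
    (h : Halts O (.seq (.seq P Q) R) s T A) : Halts O (.seq P (.seq Q R)) s T A := by
  obtain ⟨t, ht, s', hs, hA⟩ := h
  cases hs with
  | seq h₁ h₃ =>
    cases h₁ with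
    | seq h₁ h₂ => exact ⟨_, by omega, _, .seq h₁ (.seq h₂ h₃), hA⟩

/-- Every loop makes at most `N` rounds, so the time is a polynomial in `N` that depends only on the
program. Temporaries below `d` must survive because enclosing loops keep their counters there. -/
theorem BProg.halts_comp (O : Oracle) (N : ℕ) (p : BProg) (d : ℕ) (u s : State)
    (h : Represents N u s) :
    Halts O (p.comp d) s (p.time.eval N) fun s' =>
      Represents N (p.run N O u) s' ∧ ∀ i < d, s'.cell 1 i = s.cell 1 i := by
  induction p generalizing d u s with
  | skip => exact ⟨1, by simp [BProg.time], s, .skip s, h, fun _ _ => rfl⟩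
  | setReg x e =>
    refine Halts.mono (Halts.seq (T' := 3) ((h.halts_expr O e d).mono le_rfl ?_))
      (by simp [BProg.time]) fun _ => id
    rintro s₁ ⟨h₁, hv, -, -, hd, -⟩
    refine (Halts.setReg ⟨⟨?_, h₁.cell, h₁.bound, h₁.out, h₁.tape, h₁.asked⟩, hd⟩).mono
      (by simp [tmp, Expr.cost]) fun _ => id
    simp [tmp, Expr.eval, hv, h₁.reg, BProg.run]
  | setCell a i e =>
    refine Halts.mono (T := i.time.eval N + (e.time.eval N + 5)) 
      (Halts.seq ((h.halts_expr O i d).mono le_rfl ?_))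
      (by simp only [BProg.time, Polynomial.eval_add, Polynomial.eval_ofNat]; omega) fun _ => id
    rintro s₁ ⟨h₁, hv₁, -, -, hd₁, -⟩
    refine Halts.seq ((h₁.halts_expr O e (d + 1)).mono le_rfl ?_)
    rintro s₂ ⟨h₂, hv₂, -, -, hd₂, -⟩
    refine (Halts.setCell ⟨⟨h₂.reg, ?_, ?_, h₂.out, h₂.tape, h₂.asked⟩, ?_⟩).mono
      (by simp [tmp, Expr.cost]) fun _ => id
    · intro b
      by_cases hb : b = a
      · subst hb
        simp [tmp, Expr.eval, hv₂, hd₂ d (by omega), hv₁, BProg.run, h₂.cell]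
      · simp [BProg.run, h₂.cell, hb]
    · have : 3 ≠ 2 * a := by omega
      simp [this, h₂.bound]
    · intro j hj
      have : 1 ≠ 2 * a := by omega
      simp [this, hd₂ j (by omega), hd₁ j hj]
  | store a x b e =>
    set m := min (b.val N u) N with hm
    refine Halts.mono (T := b.time.eval N + 10 + (4 + (3 + (2 + ((3 + m * (e.time.eval N + 8 + 9))
      + (2 + ((3 + m * (8 + 9)) + 3))))))) (Halts.assoc ?_) ?_ fun _ => id
    swap
    · have : m ≤ N := min_le_right _ _
      simp only [BProg.time, Polynomial.eval_add, Polynomial.eval_mul, Polynomial.eval_ofNat,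
        Polynomial.eval_X]
      nlinarith [Nat.mul_le_mul_right (e.time.eval N + 50) this]
    refine Halts.seq ((h.halts_bound O b d).mono le_rfl ?_)
    rintro s₁ ⟨h₁, hv, hd⟩
    rw [← hm] at hv
    refine Halts.seq ((Halts.setTmp ?_).mono (by simp [tmp, Expr.cost]) fun _ => id)
    refine Halts.seq ((Halts.setTmp ?_).mono (by simp [Expr.cost]) fun _ => id)
    refine Halts.seq ((Halts.setReg ?_).mono (by simp [Expr.cost]) fun _ => id)
    refine Halts.seq ((Halts.countdown (fun j s' => ∃ k, k + j = m ∧ s'.cell 1 d = j ∧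
      (∀ i < k, s'.cell 5 i = e.eval N u.cell (Function.update u.reg x i)) ∧
      s'.cell 1 (d + 1) = m ∧ s'.cell 1 (d + 2) = u.reg x ∧
      Represents N { u with reg := Function.update u.reg x k } s' ∧
      (∀ i < d, s'.cell 1 i = s.cell 1 i)) ?_ ?_ m _ ?_).mono le_rfl ?_)
    · rintro j s' ⟨k, -, h, -⟩
      exact h
    · rintro j s' ⟨k, hk, hj, hc, hm', hsave, hr, htmp⟩
      refine Halts.mono (T := e.time.eval N + (4 + 4)) ?_ (by omega) fun _ => id
      refine Halts.seq (((hr.sameBelow (SameBelow.set le_rfl _ _)).halts_expr O e (d + 3)).mono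
        le_rfl ?_)
      rintro s₂ ⟨h₂, hv₂, -, hc₂, hd₂, -⟩
      refine Halts.seq ((Halts.setCell ?_).mono (by simp [tmp, Expr.cost]) fun _ => id)
      refine (Halts.setReg ?_).mono (by simp [Expr.cost]) fun _ => id
      have he : (tmp (d + 3)).eval s₂ = e.eval N u.cell (Function.update u.reg x k) := hv₂
      have hx : s₂.reg x = k := by simp [h₂.reg]
      have hd' := hd₂ d (by omega)
      have hd1 := hd₂ (d + 1) (by omega)
      have hd2 := hd₂ (d + 2) (by omega)
      simp at hd' hd1 hd2
      refine ⟨k + 1, by omega, ?_, ?_, ?_, ?_, ⟨?_, ?_, ?_, h₂.out, h₂.tape, h₂.asked⟩, ?_⟩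
      · simp [hd']
      · intro i hi
        by_cases hik : i = k
        · subst hik
          simp [Expr.eval, hx, he]
        · simpa [Expr.eval, hx, hik, hc₂] using hc i (by omega)
      · simp [hd1, hm']
      · simp [hd2, hsave]
      · simp [Expr.eval, h₂.reg]
      · intro b
        simp [show 2 * b ≠ 5 by omega, h₂.cell]
      · simp [h₂.bound]
      · intro i hi
        have := hd₂ i (by omega)
        simp only [Function.update_self, ne_eq, hi.ne, not_false_eq_true,
          Function.update_of_ne] at this
        simp [this, htmp i hi]
    · refine ⟨0, by omega, ?_, by simp, ?_, ?_, ⟨?_, ?_, ?_, h₁.out, h₁.tape, h₁.asked⟩, ?_⟩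
      · simp [hv]
      · simp [tmp, Expr.eval, hv]
      · simp [Expr.eval, h₁.reg]
      · simp [Expr.eval, h₁.reg]
      · intro b
        simp [show 2 * b ≠ 1 by omega, h₁.cell]
      · simp [h₁.bound]
      · intro i hi
        simp [show i ≠ d + 1 by omega, show i ≠ d + 2 by omega, hd i hi]
    rintro s₃ ⟨k, hk, -, hc, hm', hsave, hr, htmp⟩
    obtain rfl : k = m := by omega
    refine Halts.seq ((Halts.setReg ?_).mono (by simp [Expr.cost]) fun _ => id)
    -- The second loop copies the buffer into the array; after `k` rounds exactly the first `k`
    -- cells have their new values.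
    refine Halts.seq ((Halts.countdown (fun j s' => ∃ k, k + j = m ∧ s'.cell 1 (d + 1) = j ∧
      (∀ i < m, s'.cell 5 i = e.eval N u.cell (Function.update u.reg x i)) ∧
      s'.cell 1 (d + 2) = u.reg x ∧
      Represents N { u with
        reg := Function.update u.reg x k
        cell := Function.update u.cell a fun i =>
          if i < k then e.eval N u.cell (Function.update u.reg x i) else u.cell a i } s' ∧
      (∀ i < d, s'.cell 1 i = s.cell 1 i)) ?_ ?_ m _ ?_).mono le_rfl ?_)
    · rintro j s' ⟨k, -, h, -⟩
      exact h
    · rintro j s' ⟨k, hk, hj, hc, hsave, hr, htmp⟩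
      refine Halts.mono (T := 4 + 4) ?_ (by omega) fun _ => id
      refine Halts.seq ((Halts.setCell ?_).mono (by simp [Expr.cost]) fun _ => id)
      refine (Halts.setReg ?_).mono (by simp [Expr.cost]) fun _ => id
      have hx : s'.reg x = k := by simp [hr.reg]
      have h1 : 1 ≠ 2 * a := by omega
      have h3 : 3 ≠ 2 * a := by omega
      have h5 : 5 ≠ 2 * a := by omega
      refine ⟨k + 1, by omega, ?_, ?_, ?_, ⟨?_, ?_, ?_, hr.out, hr.tape, hr.asked⟩, ?_⟩
      · simp [h1]
      · simpa [h5] using hc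
      · simpa [h1] using hsave
      · simp [Expr.eval, hr.reg]
      · intro b
        by_cases hb : b = a
        · subst hb
          have := hr.cell b
          simp only [Function.update_self] at this
          ext i
          by_cases hik : i = k
          · subst hik
            simp [Expr.eval, hx, hc i (by omega)]
          · have h6 : i ≤ k ↔ i < k := by omega
            simp [Expr.eval, hx, hik, h6, this, show 2 * b ≠ 1 by omega]
        · simp [hb, show 2 * b ≠ 1 by omega, hr.cell]
      · simpa [h3] using hr.bound
      · intro i hi
        simp [h1, show i ≠ d + 1 by omega, htmp i hi]
    · refine ⟨0, by omega, hm', hc, hsave, ⟨?_, ?_, hr.bound, hr.out, hr.tape, hr.asked⟩, htmp⟩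
      · simp [Expr.eval, hr.reg]
      · intro b
        simpa using hr.cell b
    · rintro s₄ ⟨k, hk, -, -, hsave, hr, htmp⟩
      obtain rfl : k = m := by omega
      refine (Halts.setReg ⟨⟨?_, hr.cell, hr.bound, hr.out, hr.tape, hr.asked⟩, htmp⟩).mono
        (by simp [tmp, Expr.cost]) fun _ => id
      simp [tmp, Expr.eval, hr.reg, hsave, BProg.run]
  | write e =>
    refine Halts.mono (Halts.seq (T' := 3) ((h.halts_expr O e d).mono le_rfl ?_))
      (by simp [BProg.time]) fun _ => id
    rintro s₁ ⟨h₁, hv, -, -, hd, -⟩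
    refine ⟨3, le_rfl, _, .write s₁ (tmp d),
      ⟨h₁.reg, h₁.cell, h₁.bound, ?_, h₁.tape, h₁.asked⟩, hd⟩
    simp [tmp, Expr.eval, hv, h₁.out, BProg.run]
  | push e =>
    refine Halts.mono (Halts.seq (T' := 3) ((h.halts_expr O e d).mono le_rfl ?_))
      (by simp [BProg.time]) fun _ => id
    rintro s₁ ⟨h₁, hv, -, -, hd, -⟩
    refine ⟨3, le_rfl, _, .push s₁ (tmp d),
      ⟨h₁.reg, h₁.cell, h₁.bound, h₁.out, ?_, h₁.asked⟩, hd⟩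
    simp [tmp, Expr.eval, hv, h₁.tape, BProg.run]
  | ask x =>
    refine ⟨1, by simp [BProg.time], _, .ask s x, ⟨?_, h.cell, h.bound, h.out, rfl, ?_⟩,
      fun _ _ => rfl⟩
    · simp [h.reg, h.tape, BProg.run]
    · simp [h.asked, h.tape, BProg.run]
  | seq p q ihp ihq =>
    refine Halts.mono (Halts.seq ((ihp d u s h).mono le_rfl ?_))
      (by simp [BProg.time]; exact le_rfl)
      fun _ => id
    rintro s₁ ⟨h₁, hd₁⟩
    refine (ihq d _ s₁ h₁).mono le_rfl ?_
    rintro s₂ ⟨h₂, hd₂⟩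
    exact ⟨h₂, fun i hi => (hd₂ i hi).trans (hd₁ i hi)⟩
  | cond e p q ihp ihq =>
    refine Halts.mono (Halts.seq (T' := p.time.eval N + q.time.eval N + 3)
      ((h.halts_expr O e d).mono le_rfl ?_))
      (by simp only [BProg.time, Polynomial.eval_add, Polynomial.eval_ofNat]; omega) fun _ => id
    rintro s₁ ⟨h₁, hv, -, -, hd, -⟩
    refine Halts.mono (Halts.cond (T := p.time.eval N) (T' := q.time.eval N) ?_)
      (by simp only [tmp, Expr.cost]; omega) fun _ => id
    have ht : (tmp d).eval s₁ = e.val N u := hv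
    rw [ht]
    simp only [BProg.run]
    split_ifs
    · exact (ihp d u s₁ h₁).mono le_rfl fun s₂ h₂ => ⟨h₂.1, fun i hi => (h₂.2 i hi).trans (hd i hi)⟩
    · exact (ihq d u s₁ h₁).mono le_rfl fun s₂ h₂ => ⟨h₂.1, fun i hi => (h₂.2 i hi).trans (hd i hi)⟩
  | rep b p ihp =>
    set m := min (b.val N u) N with hm
    refine Halts.mono (T := b.time.eval N + 10 + (3 + m * (p.time.eval N + 9)))
      (Halts.assoc ?_) ?_ fun _ => id
    swap
    · have : m ≤ N := min_le_right _ _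
      simp only [BProg.time, Polynomial.eval_add, Polynomial.eval_mul, Polynomial.eval_ofNat,
        Polynomial.eval_X]
      nlinarith [Nat.mul_le_mul_right (p.time.eval N + 30) this]
    refine Halts.seq ((h.halts_bound O b d).mono le_rfl ?_)
    rintro s₁ ⟨h₁, hv, hd⟩
    rw [← hm] at hv
    refine (Halts.countdown (fun j s' => ∃ k, k + j = m ∧ s'.cell 1 d = j ∧
      Represents N ((p.run N O)^[k] u) s' ∧ (∀ i < d, s'.cell 1 i = s.cell 1 i))
      ?_ ?_ m _ ⟨0, by omega, hv, h₁, hd⟩).mono le_rfl ?_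
    · rintro j s' ⟨k, -, h, -⟩
      exact h
    · rintro j s' ⟨k, hk, hj, hr, htmp⟩
      refine (ihp (d + 1) _ _ (hr.sameBelow (SameBelow.set le_rfl _ _))).mono le_rfl ?_
      rintro s₂ ⟨h₂, hd₂⟩
      refine ⟨k + 1, by omega, ?_, ?_, ?_⟩
      · simpa using hd₂ d (by omega)
      · rwa [Function.iterate_succ_apply']
      · intro i hi
        simpa [hi.ne, htmp i hi] using hd₂ i (by omega)
    · rintro s' ⟨k, hk, hj, hr, htmp⟩
      obtain rfl : k = m := by omega
      exact ⟨hr, htmp⟩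

section

/-! ## Cuts and layouts -/

open Classical in
/-- The total weight of the arcs inside `S` that enter `X`. -/
noncomputable def cutWeight (w : ℕ → ℕ → ℕ) (S : Finset ℕ) (X : Set ℕ) : ℕ :=
  ∑ u ∈ S, ∑ v ∈ S, if u ∉ X ∧ v ∈ X then w u v else 0

/-- The weights `w` are the adjacency matrix of a semi-complete digraph on `S`. -/
structure IsSemiComplete (w : ℕ → ℕ → ℕ) (S : Finset ℕ) : Prop where
  le_one : ∀ u ∈ S, ∀ v ∈ S, w u v ≤ 1
  irrefl : ∀ u ∈ S, w u u = 0
  total : ∀ u ∈ S, ∀ v ∈ S, u ≠ v → 1 ≤ w u v + w v u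

/-- The numbering `f` of `S` has width at most `c`. -/
structure IsLayout (w : ℕ → ℕ → ℕ) (S : Finset ℕ) (c : ℕ) (f : ℕ → ℕ) : Prop where
  injOn : Set.InjOn f S
  cut_le : ∀ i, cutWeight w S {v | f v < i} ≤ c

/-- The number of elements of `S` that `f` numbers before `v`. -/
def rank (S : Finset ℕ) (f : ℕ → ℕ) (v : ℕ) : ℕ := (S.filter fun x => f x < f v).card

variable {w : ℕ → ℕ → ℕ} {S T : Finset ℕ} {X Y : Set ℕ}

/-! ### Cut weights: submodularity and dependence on the vertex set. -/

theorem cutWeight_congr (h : ∀ v ∈ S, v ∈ X ↔ v ∈ Y) : cutWeight w S X = cutWeight w S Y := by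
  classical
  unfold cutWeight
  refine Finset.sum_congr rfl fun u hu => Finset.sum_congr rfl fun v hv => ?_
  simp only [h u hu, h v hv]

/-- Submodularity, the engine of all uncrossing arguments below. It holds arc by arc, by the
positions of the two ends relative to `X` and `Y`. -/
theorem cutWeight_inter_add_union_le (w : ℕ → ℕ → ℕ) (S : Finset ℕ) (X Y : Set ℕ) :
    cutWeight w S (X ∩ Y) + cutWeight w S (X ∪ Y) ≤ cutWeight w S X + cutWeight w S Y := by
  classical
  simp only [cutWeight, ← Finset.sum_add_distrib]
  refine Finset.sum_le_sum fun u _ => Finset.sum_le_sum fun v _ => ?_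
  by_cases h1 : u ∈ X <;> by_cases h2 : u ∈ Y <;> by_cases h3 : v ∈ X <;> by_cases h4 : v ∈ Y <;>
    simp [h1, h2, h3, h4]

theorem cutWeight_eq_zero (h : ∀ v ∈ S, v ∉ X) : cutWeight w S X = 0 := by
  classical
  refine Finset.sum_eq_zero fun u _ => Finset.sum_eq_zero fun v hv => ?_
  simp [h v hv]

theorem cutWeight_eq_zero' (h : ∀ v ∈ S, v ∈ X) : cutWeight w S X = 0 := by
  classical
  refine Finset.sum_eq_zero fun u hu => Finset.sum_eq_zero fun v hv => ?_
  simp [h u hu]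

theorem cutWeight_mono (h : S ⊆ T) : cutWeight w S X ≤ cutWeight w T X := by
  classical
  refine (Finset.sum_le_sum_of_subset h).trans (Finset.sum_le_sum fun u _ => ?_)
  exact Finset.sum_le_sum_of_subset h

theorem cutWeight_eq_of_subset (h : S ⊆ T)
    (hS : ∀ u ∈ T, ∀ v ∈ T, w u v ≠ 0 → u ∉ X → v ∈ X → u ∈ S ∧ v ∈ S) :
    cutWeight w S X = cutWeight w T X := by
  classical
  unfold cutWeight
  have : ∀ u ∈ S, (∑ v ∈ S, if u ∉ X ∧ v ∈ X then w u v else 0) =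
      ∑ v ∈ T, if u ∉ X ∧ v ∈ X then w u v else 0 := by
    refine fun u hu => Finset.sum_subset h fun v hv hvS => ?_
    by_contra hne
    simp only [ite_eq_right_iff, not_forall] at hne
    exact hvS (hS u (h hu) v hv hne.2 hne.1.1 hne.1.2).2
  rw [Finset.sum_congr rfl this]
  refine Finset.sum_subset h fun u hu huS => Finset.sum_eq_zero fun v hv => ?_
  by_contra hne
  simp only [ite_eq_right_iff, not_forall] at hne
  exact huS (hS u hu v hv hne.2 hne.1.1 hne.1.2).1

theorem le_cutWeight {u v : ℕ} (hu : u ∈ S) (hv : v ∈ S) (huX : u ∉ X) (hvX : v ∈ X) :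
    w u v ≤ cutWeight w S X := by
  classical
  have h1 := Finset.single_le_sum (f := fun v => if u ∉ X ∧ v ∈ X then w u v else 0)
    (fun i _ => Nat.zero_le _) hv
  have h2 := Finset.single_le_sum (f := fun u => ∑ v ∈ S, if u ∉ X ∧ v ∈ X then w u v else 0)
    (fun i _ => Nat.zero_le _) hu
  refine le_trans (le_of_eq ?_) (h1.trans h2)
  simp [huX, hvX]

/-- The in-degree of `v` is close to its position in a layout. -/
theorem IsLayout.rank_le (hS : IsSemiComplete w S) {f : ℕ → ℕ} {c v : ℕ} (hf : IsLayout w S c f)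
    (hv : v ∈ S) : rank S f v ≤ ∑ x ∈ S, w x v + c := by
  classical
  -- An earlier vertex `x` without an arc to `v` receives an arc from `v`, and this arc crosses the
  -- cut just before `v`.
  have h : ∑ x ∈ S, (if f x < f v then w v x else 0) ≤ c := by
    refine le_trans ?_ (hf.cut_le (f v))
    refine le_trans ?_ (Finset.single_le_sum (fun i _ => Nat.zero_le _) hv)
    refine Finset.sum_le_sum fun x _ => ?_
    simp
  refine le_trans ?_ (Nat.add_le_add_left h _)
  rw [rank, Finset.card_filter, ← Finset.sum_add_distrib]
  refine Finset.sum_le_sum fun x hx => ?_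
  split_ifs with hx'
  · exact hS.total x hx v hv (by rintro rfl; exact lt_irrefl _ hx')
  · omega

/-- Arcs into `v` from later vertices cross the cut just after `v`, so there are at most `c` of
them; each earlier vertex contributes at most one more. -/
theorem IsLayout.indegree_le (hS : IsSemiComplete w S) {f : ℕ → ℕ} {c v : ℕ}
    (hf : IsLayout w S c f) (hv : v ∈ S) : ∑ x ∈ S, w x v ≤ rank S f v + c := by
  classical
  have h : ∑ x ∈ S, (if f v < f x then w x v else 0) ≤ c := by
    refine le_trans ?_ (hf.cut_le (f v + 1))
    refine Finset.sum_le_sum fun x _ => ?_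
    refine le_trans ?_ (Finset.single_le_sum (fun i _ => Nat.zero_le _) hv)
    simp only [Set.mem_ofPred_eq]
    split_ifs <;> omega
  refine le_trans ?_ (Nat.add_le_add_left h _)
  rw [rank, Finset.card_filter, ← Finset.sum_add_distrib]
  refine Finset.sum_le_sum fun x hx => ?_
  have := hS.le_one x hx v hv
  rcases lt_trichotomy (f x) (f v) with h | h | h
  · rw [if_pos h]
    omega
  · rw [hf.injOn hx hv h, hS.irrefl v hv]
    exact Nat.zero_le _
  · rw [if_pos h]
    omega

theorem rank_lt_rank {f : ℕ → ℕ} {u v : ℕ} (hu : u ∈ S) (h : f u < f v) :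
    rank S f u < rank S f v := by
  refine Finset.card_lt_card ⟨fun x hx => ?_, fun hs => ?_⟩
  · simp only [Finset.mem_filter] at hx ⊢
    exact ⟨hx.1, hx.2.trans h⟩
  · have := hs (Finset.mem_filter.2 ⟨hu, h⟩)
    simp at this

/-- Two vertices in different order in two layouts are close in both. -/
theorem IsLayout.rank_lt_of_inversion (hS : IsSemiComplete w S) {f g : ℕ → ℕ} {a b u v : ℕ}
    (hf : IsLayout w S a f) (hg : IsLayout w S b g) (hu : u ∈ S) (hv : v ∈ S)
    (h : g v < g u) : rank S f v < rank S f u + 2 * (a + b) := by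
  -- For `v`, and in the reverse direction for `u`, pass from the rank in `f` through the in-degree
  -- to the rank in `g`. Each vertex costs `a + b`.
  have h1 := hf.rank_le hS hv
  have h2 := hg.indegree_le hS hv
  have h3 := rank_lt_rank hv h
  have h4 := hg.rank_le hS hu
  have h5 := hf.indegree_le hS hu
  omega

/-- If `{f < k}` is a minimum cut in a wide window around position `k` then every layout of small
width can be changed so that it starts with `{f < k}`. -/
theorem IsLayout.split (hS : IsSemiComplete w S) {f g : ℕ → ℕ} {a b lo k hi : ℕ}
    (hf : IsLayout w S a f) (hg : IsLayout w S b g) (hlo : lo ≤ k) (hhi : k ≤ hi)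
    (hleft : ∀ u ∈ S, ∀ v ∈ S, f u < lo → k ≤ f v → rank S f u + 2 * (a + b) ≤ rank S f v)
    (hright : ∀ u ∈ S, ∀ v ∈ S, f u < k → hi ≤ f v → rank S f u + 2 * (a + b) ≤ rank S f v)
    (hmin : ∀ X : Set ℕ, (∀ v ∈ S, f v < lo → v ∈ X) → (∀ v ∈ S, v ∈ X → f v < hi) →
      cutWeight w S {v | f v < k} ≤ cutWeight w S X) {M : ℕ} (hM : ∀ v ∈ S, g v < M) :
    IsLayout w S b fun v => if f v < k then g v else M + g v := by
  set A : Set ℕ := {v | f v < k} with hA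
  -- Vertices that are too far apart to be inverted keep their order in `g`.
  have hinv : ∀ u ∈ S, ∀ v ∈ S, f u < k → hi ≤ f v → g u < g v := by
    intro u hu v hv h1 h2
    by_contra h
    rcases (not_lt.1 h).lt_or_eq with h | h
    · exact absurd (hright u hu v hv h1 h2) (hf.rank_lt_of_inversion hS hg hu hv h).not_ge
    · have := hg.injOn hv hu h
      subst this
      omega
  have hinv' : ∀ u ∈ S, ∀ v ∈ S, f u < lo → k ≤ f v → g u < g v := by
    intro u hu v hv h1 h2
    by_contra h
    rcases (not_lt.1 h).lt_or_eq with h | h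
    · exact absurd (hleft u hu v hv h1 h2) (hf.rank_lt_of_inversion hS hg hu hv h).not_ge
    · have := hg.injOn hv hu h
      subst this
      omega
  -- The shortest prefix of `g` that contains `A` respects the window, so minimality of `A` applies
  -- to it.
  have hAb : cutWeight w S A ≤ b := by
    by_cases hne : ∃ v ∈ S, f v < k
    · obtain ⟨a, ha, hmax⟩ := Finset.exists_max_image (S.filter (f · < k)) g
        (by simpa [Finset.Nonempty] using hne)
      simp only [Finset.mem_filter, and_imp] at ha hmax
      refine (hmin {v | g v < g a + 1} ?_ ?_).trans (hg.cut_le _)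
      · intro v hv h
        have := hmax v hv (h.trans_le hlo)
        simp only [Set.mem_ofPred_eq]
        omega
      · intro v hv h
        by_contra h'
        have := hinv a ha.1 v hv ha.2 (not_lt.1 h')
        simp only [Set.mem_ofPred_eq] at h
        omega
    · push Not at hne
      rw [cutWeight_eq_zero (fun v hv => by simpa [hA] using hne v hv)]
      exact Nat.zero_le _
  refine ⟨?_, fun i => ?_⟩
  · intro u hu v hv huv
    have h1 := hM u hu
    have h2 := hM v hv
    simp only at huv
    split_ifs at huv
    · exact hg.injOn hu hv huv
    · omega
    · omega
    · exact hg.injOn hu hv (by omega)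
  -- A prefix of the new numbering is `A ∩ Z` or `A ∪ Z` for a prefix `Z` of `g`. Unless it equals
  -- `A` on `S`, the other of the two sets respects the window and hence has at least the cut of
  -- `A`; submodularity then bounds the prefix by the cut of `Z`.
  rcases le_total i M with hi' | hi'
  · set Z : Set ℕ := {v | g v < i} with hZ
    rw [cutWeight_congr (Y := A ∩ Z) (fun v hv => by
      simp only [hA, hZ, Set.mem_inter_iff, Set.mem_ofPred_eq]
      split_ifs <;> simp_all; omega)]
    by_cases hsub : ∀ v ∈ S, v ∈ A → v ∈ Z
    · rw [cutWeight_congr (Y := A) (fun v hv => by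
        simp only [Set.mem_inter_iff, and_iff_left_iff_imp]
        exact hsub v hv)]
      exact hAb
    · push Not at hsub
      obtain ⟨a, ha, haA, haZ⟩ := hsub
      have h1 := cutWeight_inter_add_union_le w S A Z
      have h2 := hmin (A ∪ Z) (fun v hv h => Or.inl (h.trans_le hlo)) (by
        rintro v hv (h | h)
        · exact lt_of_lt_of_le h hhi
        · by_contra h'
          have := hinv a ha v hv haA (not_lt.1 h')
          exact haZ (this.trans h))
      have : cutWeight w S Z ≤ b := hg.cut_le i
      omega
  · obtain ⟨j, rfl⟩ := Nat.exists_eq_add_of_le hi'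
    set Z : Set ℕ := {v | g v < j} with hZ
    rw [cutWeight_congr (Y := A ∪ Z) (fun v hv => by
      have := hM v hv
      simp only [hA, hZ, Set.mem_union, Set.mem_ofPred_eq]
      by_cases h : f v < k
      · simp only [h, if_true, true_or, iff_true]
        omega
      · simp [h])]
    by_cases hsub : ∀ v ∈ S, v ∈ Z → v ∈ A
    · rw [cutWeight_congr (Y := A) (fun v hv => by
        simp only [Set.mem_union, or_iff_left_iff_imp]
        exact hsub v hv)]
      exact hAb
    · push Not at hsub
      obtain ⟨a, ha, haZ, haA⟩ := hsub
      have h1 := cutWeight_inter_add_union_le w S A Z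
      have h2 := hmin (A ∩ Z) (fun v hv h => ⟨h.trans_le hlo, by
          have := hinv' v hv a ha h (not_lt.1 haA)
          exact this.trans haZ⟩) (fun v hv h => lt_of_lt_of_le h.1 hhi)
      have : cutWeight w S Z ≤ b := hg.cut_le j
      omega

/-- Sorting by the difference of in-degree and out-degree gives twice the optimal width. -/
theorem IsLayout.cutWeight_le_of_sorted (hS : IsSemiComplete w S) {g key : ℕ → ℕ} {c : ℕ}
    (hg : IsLayout w S c g) (hkey : ∀ v ∈ S, key v = ∑ u ∈ S, (w u v + 1 - w v u))
    (hX : ∀ u ∈ S, ∀ v ∈ S, u ∈ X → v ∉ X → key u ≤ key v) :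
    cutWeight w S X ≤ 2 * c := by
  classical
  -- The ordered pairs inside `Z` contribute exactly the square of its size, since the two orders of
  -- a pair cancel except for the added ones. A pair with `u` outside and `v` inside contributes
  -- between one and two times `w u v`, by semi-completeness.
  have key_sum : ∀ Z : Set ℕ,
      cutWeight w S Z + (S.filter (· ∈ Z)).card ^ 2 ≤ ∑ v ∈ S.filter (· ∈ Z), key v ∧
      ∑ v ∈ S.filter (· ∈ Z), key v ≤ 2 * cutWeight w S Z + (S.filter (· ∈ Z)).card ^ 2 := by
    intro Z
    have e1 : ∑ v ∈ S.filter (· ∈ Z), key v =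
        ∑ v ∈ S.filter (· ∈ Z), ∑ u ∈ S.filter (· ∈ Z), (w u v + 1 - w v u) +
        ∑ v ∈ S.filter (· ∈ Z), ∑ u ∈ S.filter (· ∉ Z), (w u v + 1 - w v u) := by
      rw [← Finset.sum_add_distrib]
      refine Finset.sum_congr rfl fun v hv => ?_
      rw [hkey v (Finset.mem_filter.1 hv).1, Finset.sum_filter_add_sum_filter_not]
    have e2 : ∑ v ∈ S.filter (· ∈ Z), ∑ u ∈ S.filter (· ∈ Z), (w u v + 1 - w v u) =
        (S.filter (· ∈ Z)).card ^ 2 := by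
      have h1 : ∑ v ∈ S.filter (· ∈ Z), ∑ u ∈ S.filter (· ∈ Z), ((w u v + 1 - w v u) + w v u) =
          ∑ v ∈ S.filter (· ∈ Z), ∑ u ∈ S.filter (· ∈ Z), (1 + w u v) := by
        refine Finset.sum_congr rfl fun v hv => Finset.sum_congr rfl fun u hu => ?_
        have := hS.le_one v (Finset.mem_filter.1 hv).1 u (Finset.mem_filter.1 hu).1
        omega
      have h2 : ∑ v ∈ S.filter (· ∈ Z), ∑ u ∈ S.filter (· ∈ Z), w v u =
          ∑ v ∈ S.filter (· ∈ Z), ∑ u ∈ S.filter (· ∈ Z), w u v := Finset.sum_comm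
      simp only [Finset.sum_add_distrib, h2] at h1
      simp only [Finset.sum_const, smul_eq_mul, mul_one] at h1
      rw [sq]
      omega
    have e3 : cutWeight w S Z = ∑ v ∈ S.filter (· ∈ Z), ∑ u ∈ S.filter (· ∉ Z), w u v := by
      rw [cutWeight, Finset.sum_comm, Finset.sum_filter]
      refine Finset.sum_congr rfl fun v _ => ?_
      split_ifs with hv
      · rw [Finset.sum_filter]
        simp [hv]
      · simp [hv]
    have hb : ∀ v ∈ S.filter (· ∈ Z), ∀ u ∈ S.filter (· ∉ Z),
        w u v ≤ w u v + 1 - w v u ∧ w u v + 1 - w v u ≤ 2 * w u v := by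
      intro v hv u hu
      simp only [Finset.mem_filter] at hv hu
      have h1 := hS.le_one v hv.1 u hu.1
      have h2 := hS.le_one u hu.1 v hv.1
      have h3 := hS.total v hv.1 u hu.1 (by rintro rfl; exact hu.2 hv.2)
      omega
    rw [e1, e2, e3]
    constructor
    · rw [add_comm]
      exact Nat.add_le_add_left (Finset.sum_le_sum fun v hv => Finset.sum_le_sum fun u hu =>
        (hb v hv u hu).1) _
    · rw [add_comm]
      refine Nat.add_le_add_right ?_ _
      simp only [Finset.mul_sum]
      exact Finset.sum_le_sum fun v hv => Finset.sum_le_sum fun u hu => (hb v hv u hu).2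
  by_cases hfull : ∀ v ∈ S, v ∈ X
  · rw [cutWeight_eq_zero' hfull]
    exact Nat.zero_le _
  push Not at hfull
  -- a prefix of `g` with as many elements as `X`
  obtain ⟨i, hi⟩ : ∃ i, (S.filter (g · < i)).card = (S.filter (· ∈ X)).card := by
    set k := (S.filter (· ∈ X)).card with hk
    have hex : ∃ i, k ≤ (S.filter (g · < i)).card := by
      refine ⟨S.sup g + 1, ?_⟩
      rw [Finset.filter_true_of_mem (fun v hv => Nat.lt_succ_of_le (Finset.le_sup hv))]
      exact Finset.card_filter_le _ _
    -- As `g` is injective, prefixes grow by at most one element at a time, so the first that is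
    -- large enough has exactly the right size.
    refine ⟨Nat.find hex, le_antisymm ?_ (Nat.find_spec hex)⟩
    rcases h0 : Nat.find hex with _ | m
    · simp
    · have hm : (S.filter (g · < m)).card < k := not_le.1 (Nat.find_min hex (by omega))
      have : S.filter (g · < m + 1) ⊆ S.filter (g · < m) ∪ S.filter (g · = m) := by
        intro v
        simp only [Finset.mem_filter, Finset.mem_union]
        rintro ⟨h1, h2⟩
        rcases (Nat.lt_succ_iff_lt_or_eq.1 h2) with h | h
        · exact Or.inl ⟨h1, h⟩
        · exact Or.inr ⟨h1, h⟩
      have h1 : (S.filter (g · = m)).card ≤ 1 := by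
        rw [Finset.card_le_one]
        simp only [Finset.mem_filter]
        rintro a ⟨ha, ha'⟩ b ⟨hb, hb'⟩
        exact hg.injOn ha hb (ha'.trans hb'.symm)
      have := (Finset.card_le_card this).trans (Finset.card_union_le _ _)
      omega
  have hle : ∑ v ∈ S.filter (· ∈ X), key v ≤ ∑ v ∈ S.filter (g · < i), key v := by
    obtain ⟨v₀, hv₀, hv₀X⟩ := hfull
    obtain ⟨m, hm, hmin⟩ := Finset.exists_min_image (S.filter (· ∉ X)) key
      ⟨v₀, by simp [hv₀, hv₀X]⟩
    simp only [Finset.mem_filter, and_imp] at hm hmin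
    -- Exchange argument: `key m` separates the keys inside `X` from those outside, and both sets
    -- have the same size.
    have h : ∑ v ∈ S.filter (· ∈ X), key v + ∑ v ∈ S.filter (g · < i), key m ≤
        ∑ v ∈ S.filter (g · < i), key v + ∑ v ∈ S.filter (· ∈ X), key m := by
      simp only [Finset.sum_filter, ← Finset.sum_add_distrib]
      refine Finset.sum_le_sum fun v hv => ?_
      by_cases h1 : v ∈ X
      · have := hX v hv m hm.1 h1 hm.2
        split_ifs <;> omega
      · have := hmin v hv h1
        split_ifs <;> omega
    simp only [Finset.sum_const, smul_eq_mul, hi] at h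
    omega
  have h1 := (key_sum X).1
  have h2 := (key_sum {v | g v < i}).2
  have h3 := hg.cut_le i
  simp only [Set.mem_ofPred_eq] at h2
  rw [hi] at h2
  omega

end

section

/-! ## Orderings of `{0, …, n-1}`, minimum cuts and bags -/

section Orderings

variable (w : ℕ → ℕ → ℕ) (n : ℕ) (pos : ℕ → ℕ)

/-- `pos` is injective on `{0, …, n-1}` with values below `n`. -/
structure IsOrdering : Prop where
  lt : ∀ v < n, pos v < n
  inj : ∀ u < n, ∀ v < n, pos u = pos v → u = v

/-- The weight of the cut at position `j`. -/
noncomputable def prefixCut (j : ℕ) : ℕ := cutWeight w (Finset.range n) {v | pos v < j}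

/-- `X` contains the vertices at positions below `lo` and none from position `hi` on. -/
structure InWindow (lo hi : ℕ) (X : Set ℕ) : Prop where
  left : ∀ v < n, pos v < lo → v ∈ X
  right : ∀ v < n, v ∈ X → pos v < hi

/-- The cut at position `k` is minimum among the cuts at distance at most `r`. -/
def IsLocalMin (r k : ℕ) : Prop :=
  ∀ j ≤ n, k - r ≤ j → j ≤ k + r → prefixCut w n pos k ≤ prefixCut w n pos j

/-- Among the cuts in the window of radius `r` around position `k`, a prefix is minimum. -/
def IsLeanAt (r k : ℕ) : Prop :=
  ∀ X, InWindow n pos (k - r) (k + r) X → ∃ j ≤ n, k - r ≤ j ∧ j ≤ k + r ∧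
    prefixCut w n pos j ≤ cutWeight w (Finset.range n) X

/-- The condition for membership in the bag of the window from `lo` to `hi`: the vertices in the
window, the heads of the arcs over the left end, and the tails of the arcs over the right end. -/
def InBag (lo hi v : ℕ) : Prop :=
  (lo ≤ pos v ∧ pos v < hi) ∨ (pos v < lo ∧ ∃ u < n, w u v ≠ 0 ∧ lo ≤ pos u) ∨
    (hi ≤ pos v ∧ ∃ u < n, w v u ≠ 0 ∧ pos u < hi)

open Classical in
/-- The bag of the window from `lo` to `hi`. -/
noncomputable def bag (lo hi : ℕ) : Finset ℕ :=
  (Finset.range n).filter (InBag w n pos lo hi)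

open Classical in
/-- The last local minimum before `k`. -/
noncomputable def prevMin (r k : ℕ) : ℕ := Nat.findGreatest (IsLocalMin w n pos r) (k - 1)

/-- The sum of the cuts of a numbering of `{0, …, n-1}`. -/
noncomputable def totalCut (f : ℕ → ℕ) : ℕ :=
  ∑ v ∈ Finset.range n, cutWeight w (Finset.range n) {u | f u ≤ f v}

end Orderings

variable {w : ℕ → ℕ → ℕ} {n c : ℕ} {pos : ℕ → ℕ}

/-! ### Local minima of the cut vector, and bags. -/

theorem prefixCut_zero : prefixCut w n pos 0 = 0 := cutWeight_eq_zero (by simp)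

theorem IsOrdering.prefixCut_eq_zero (hp : IsOrdering n pos) {j : ℕ} (hj : n ≤ j) :
    prefixCut w n pos j = 0 :=
  cutWeight_eq_zero' fun v hv => (hp.lt v (Finset.mem_range.1 hv)).trans_le hj

theorem isLocalMin_zero (r : ℕ) : IsLocalMin w n pos r 0 := fun j _ _ _ => by
  rw [prefixCut_zero]
  exact Nat.zero_le _

theorem IsOrdering.isLocalMin_self (hp : IsOrdering n pos) (r : ℕ) : IsLocalMin w n pos r n :=
  fun j _ _ _ => by
    rw [hp.prefixCut_eq_zero le_rfl]
    exact Nat.zero_le _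

theorem prevMin_lt {r k : ℕ} (hk : 0 < k) : prevMin w n pos r k < k := by
  classical
  exact Nat.lt_of_le_of_lt (Nat.findGreatest_le (P := IsLocalMin w n pos r) (k - 1))
    (Nat.sub_lt hk one_pos)

theorem isLocalMin_prevMin (r k : ℕ) : IsLocalMin w n pos r (prevMin w n pos r k) := by
  classical
  exact Nat.findGreatest_spec (P := IsLocalMin w n pos r) (Nat.zero_le (k - 1))
    (isLocalMin_zero r)

theorem le_prevMin {r k j : ℕ} (hj : IsLocalMin w n pos r j) (h : j < k) :
    j ≤ prevMin w n pos r k := by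
  classical
  exact Nat.le_findGreatest (by omega) hj

/-- From every position a local minimum can be reached in a bounded distance. -/
theorem exists_isLocalMin_near {r : ℕ} (m : ℕ) : ∀ p ≤ n, prefixCut w n pos p ≤ m →
    ∃ q ≤ n, IsLocalMin w n pos r q ∧ p ≤ q + m * r ∧ q ≤ p + m * r := by
  induction m with
  | zero =>
    intro p hp h
    exact ⟨p, hp, fun j _ _ _ => by omega, by omega, by omega⟩
  | succ m ih =>
    intro p hp h
    by_cases hmin : IsLocalMin w n pos r p
    · exact ⟨p, hp, hmin, by omega, by omega⟩
    -- A position that is not a local minimum has a strictly smaller cut within distance `r`; the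
    -- bound `m` on the cut limits the number of such moves.
    · unfold IsLocalMin at hmin
      push Not at hmin
      obtain ⟨j, hj, h1, h2, h3⟩ := hmin
      obtain ⟨q, hq, hq', h4, h5⟩ := ih j hj (by omega)
      refine ⟨q, hq, hq', ?_, ?_⟩ <;> rw [Nat.succ_mul] <;> omega

/-- In a longer gap, descending from the position `m * r + 1` after its left end would reach another
local minimum without leaving the gap. -/
theorem sub_prevMin_le {r m k : ℕ} (hw : ∀ j, prefixCut w n pos j ≤ m) (hk : 0 < k)
    (hkn : k ≤ n) : k ≤ prevMin w n pos r k + 2 * (m * r) + 1 := by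
  by_contra h
  have hlt := prevMin_lt (w := w) (n := n) (pos := pos) (r := r) hk
  obtain ⟨q, hq, hq', h1, h2⟩ := exists_isLocalMin_near (w := w) (n := n) (pos := pos) (r := r) m
    (prevMin w n pos r k + m * r + 1) (by omega) (hw _)
  have := le_prevMin hq' (show q < k by omega)
  omega

theorem mem_bag {lo hi v : ℕ} : v ∈ bag w n pos lo hi ↔ v < n ∧ InBag w n pos lo hi v := by
  classical
  simp [bag]

theorem bag_subset {lo hi : ℕ} : bag w n pos lo hi ⊆ Finset.range n := by
  classical
  exact Finset.filter_subset _ _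

/-- The vertices in the window have distinct positions. The vertices on either side of it are ends
of distinct arcs of a single cut, so there are at most `m` on each side. -/
theorem card_bag_le (hp : IsOrdering n pos) {lo hi m : ℕ} (hw : ∀ j, prefixCut w n pos j ≤ m) :
    (bag w n pos lo hi).card ≤ (hi - lo) + 2 * m := by
  classical
  have h1 : ((Finset.range n).filter fun v => lo ≤ pos v ∧ pos v < hi).card ≤ hi - lo := by
    rw [← Nat.card_Ico]
    refine Finset.card_le_card_of_injOn pos ?_ ?_
    · intro v hv
      simpa using (Finset.mem_filter.1 hv).2
    · intro u hu v hv
      simp only [Finset.coe_filter, Finset.mem_range, Set.mem_ofPred_eq] at hu hv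
      exact hp.inj u hu.1 v hv.1
  have h2 : ((Finset.range n).filter fun v => pos v < lo ∧ ∃ u < n, w u v ≠ 0 ∧ lo ≤ pos u).card
      ≤ m := by
    refine le_trans ?_ (hw lo)
    rw [prefixCut, cutWeight, Finset.sum_comm, Finset.card_filter]
    refine Finset.sum_le_sum fun v hv => ?_
    split_ifs with h
    · obtain ⟨h, u, hu, hwu, hlo⟩ := h
      refine le_trans ?_ (Finset.single_le_sum (fun i _ => Nat.zero_le _) (Finset.mem_range.2 hu))
      simp only [Set.mem_ofPred_eq, not_lt, hlo, h, and_self, if_true]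
      omega
    · exact Nat.zero_le _
  have h3 : ((Finset.range n).filter fun v => hi ≤ pos v ∧ ∃ u < n, w v u ≠ 0 ∧ pos u < hi).card
      ≤ m := by
    refine le_trans ?_ (hw hi)
    rw [prefixCut, cutWeight, Finset.card_filter]
    refine Finset.sum_le_sum fun v hv => ?_
    split_ifs with h
    · obtain ⟨h, u, hu, hwu, hlo⟩ := h
      refine le_trans ?_ (Finset.single_le_sum (fun i _ => Nat.zero_le _) (Finset.mem_range.2 hu))
      simp only [Set.mem_ofPred_eq, not_lt, hlo, h, and_self, if_true]
      omega
    · exact Nat.zero_le _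
  have h4 : bag w n pos lo hi ⊆ ((Finset.range n).filter fun v => lo ≤ pos v ∧ pos v < hi) ∪
      (((Finset.range n).filter fun v => pos v < lo ∧ ∃ u < n, w u v ≠ 0 ∧ lo ≤ pos u) ∪
      ((Finset.range n).filter fun v => hi ≤ pos v ∧ ∃ u < n, w v u ≠ 0 ∧ pos u < hi)) := by
    intro v hv
    obtain ⟨hv, hb⟩ := mem_bag.1 hv
    simp only [Finset.mem_union, Finset.mem_filter, Finset.mem_range, hv, true_and]
    exact hb
  have h5 := Finset.card_le_card h4
  have h6 := Finset.card_union_le ((Finset.range n).filter fun v => lo ≤ pos v ∧ pos v < hi)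
      (((Finset.range n).filter fun v => pos v < lo ∧ ∃ u < n, w u v ≠ 0 ∧ lo ≤ pos u) ∪
      ((Finset.range n).filter fun v => hi ≤ pos v ∧ ∃ u < n, w v u ≠ 0 ∧ pos u < hi))
  have h7 := Finset.card_union_le
      ((Finset.range n).filter fun v => pos v < lo ∧ ∃ u < n, w u v ≠ 0 ∧ lo ≤ pos u)
      ((Finset.range n).filter fun v => hi ≤ pos v ∧ ∃ u < n, w v u ≠ 0 ∧ pos u < hi)
  omega

/-- An arc that enters `X` has its tail at or after `lo` and its head before `hi`. If an end lies
outside the window, this is just the condition under which the bag includes it. -/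
theorem cutWeight_bag {lo hi : ℕ} {X : Set ℕ} (hX : InWindow n pos lo hi X) :
    cutWeight w (bag w n pos lo hi) X = cutWeight w (Finset.range n) X := by
  refine cutWeight_eq_of_subset bag_subset fun u hu v hv huv huX hvX => ?_
  rw [Finset.mem_range] at hu hv
  have h1 : lo ≤ pos u := not_lt.1 fun h => huX (hX.left u hu h)
  have h2 := hX.right v hv hvX
  constructor
  · refine mem_bag.2 ⟨hu, ?_⟩
    by_cases h : pos u < hi
    · exact Or.inl ⟨h1, h⟩
    · exact Or.inr (Or.inr ⟨not_lt.1 h, v, hv, huv, h2⟩)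
  · refine mem_bag.2 ⟨hv, ?_⟩
    by_cases h : lo ≤ pos v
    · exact Or.inl ⟨h, h2⟩
    · exact Or.inr (Or.inl ⟨not_le.1 h, u, hu, huv, h1⟩)

/-! ### Splitting and combining layouts of bags. -/

theorem IsSemiComplete.mono {S T : Finset ℕ} (h : IsSemiComplete w T) (hST : S ⊆ T) :
    IsSemiComplete w S where
  le_one u hu v hv := h.le_one u (hST hu) v (hST hv)
  irrefl u hu := h.irrefl u (hST hu)
  total u hu v hv := h.total u (hST hu) v (hST hv)

theorem IsLayout.mono {S T : Finset ℕ} {f : ℕ → ℕ} (h : IsLayout w T c f) (hST : S ⊆ T) :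
    IsLayout w S c f where
  injOn := h.injOn.mono hST
  cut_le i := (cutWeight_mono hST).trans (h.cut_le i)

theorem IsOrdering.injOn (hp : IsOrdering n pos) : Set.InjOn pos (Finset.range n) :=
  fun u hu v hv => hp.inj u (by simpa using hu) v (by simpa using hv)

theorem IsOrdering.surj (hp : IsOrdering n pos) {i : ℕ} (hi : i < n) : ∃ v < n, pos v = i := by
  have := Finset.surj_on_of_inj_on_of_card_le (s := Finset.range n) (t := Finset.range n)
    (fun v _ => pos v) (fun v hv => by simpa using hp.lt v (by simpa using hv))
    (fun u v hu hv h => hp.injOn hu hv h) le_rfl i (by simpa using hi)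
  obtain ⟨v, hv, h⟩ := this
  exact ⟨v, by simpa using hv, h.symm⟩

/-- In a bag, ranks grow at least as fast as positions do inside the window. -/
theorem IsOrdering.rank_add_le (hp : IsOrdering n pos) {lo hi a b u v : ℕ} (ha : lo ≤ a)
    (hb : b ≤ hi) (hu : pos u < a) (hv : b ≤ pos v) (hvn : v < n) (hab : a ≤ b) :
    rank (bag w n pos lo hi) pos u + (b - a) ≤ rank (bag w n pos lo hi) pos v := by
  classical
  have h1 : Finset.Ico a b ⊆
      ((bag w n pos lo hi).filter fun x => a ≤ pos x ∧ pos x < b).image pos := by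
    intro i hi'
    rw [Finset.mem_Ico] at hi'
    have := hp.lt v hvn
    obtain ⟨x, hx, rfl⟩ := hp.surj (show i < n by omega)
    refine Finset.mem_image_of_mem _ (Finset.mem_filter.2 ⟨mem_bag.2 ⟨hx, Or.inl ?_⟩, hi'⟩)
    omega
  have h2 := (Finset.card_le_card h1).trans Finset.card_image_le
  rw [Nat.card_Ico] at h2
  refine (Nat.add_le_add_left h2 _).trans ?_
  rw [rank, ← Finset.card_union_of_disjoint]
  · refine Finset.card_le_card fun x hx => ?_
    simp only [Finset.mem_union, Finset.mem_filter] at hx ⊢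
    rcases hx with ⟨h, h'⟩ | ⟨h, h', h''⟩ <;> exact ⟨h, by omega⟩
  · rw [Finset.disjoint_filter]
    intro x _ h3 h4
    omega

theorem IsOrdering.isLayout (hp : IsOrdering n pos) {m : ℕ}
    (hw : ∀ j, prefixCut w n pos j ≤ m) : IsLayout w (Finset.range n) m pos :=
  ⟨hp.injOn, hw⟩

/-- Layouts of a bag can be split at local minima. -/
theorem IsLayout.split_bag (hS : IsSemiComplete w (Finset.range n)) (hp : IsOrdering n pos)
    (hw : ∀ j, prefixCut w n pos j ≤ 2 * c) {lo hi k M : ℕ} {g : ℕ → ℕ}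
    (hk : IsLocalMin w n pos (6 * c) k) (hlean : IsLeanAt w n pos (6 * c) k)
    (hlo : lo ≤ k - 6 * c) (hhi : k + 6 * c ≤ hi) (hg : IsLayout w (bag w n pos lo hi) c g)
    (hM : ∀ v ∈ bag w n pos lo hi, g v < M) :
    IsLayout w (bag w n pos lo hi) c fun v => if pos v < k then g v else M + g v := by
  -- The widths are `2 * c` for `pos` and `c` for `g`, so the distance `2 * (a + b)` of
  -- `IsLayout.split` is the radius `6 * c`.
  refine IsLayout.split (hS.mono bag_subset) ((hp.isLayout hw).mono bag_subset) hg
    (Nat.sub_le k (6 * c)) (Nat.le_add_right k (6 * c)) ?_ ?_ ?_ hM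
  · intro u hu v hv h1 h2
    have := hp.rank_add_le (w := w) hlo (show k ≤ hi by omega) h1 h2 (mem_bag.1 hv).1
      (Nat.sub_le _ _)
    omega
  · intro u hu v hv h1 h2
    have := hp.rank_add_le (w := w) (show lo ≤ k by omega) hhi h1 h2 (mem_bag.1 hv).1
      (Nat.le_add_right _ _)
    omega
  · intro X hXl hXr
    have hB : ∀ v < n, v ∉ bag w n pos lo hi → pos v < hi → pos v < lo := by
      intro v hv h1 h2
      by_contra h3
      exact h1 (mem_bag.2 ⟨hv, Or.inl ⟨not_lt.1 h3, h2⟩⟩)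
    -- `X` is constrained only on the bag. `Y` agrees with it there and is completed to a set in the
    -- window of the whole digraph, so that leanness applies.
    set Y : Set ℕ := {v | pos v < lo ∨ (v ∈ X ∧ pos v < hi)} with hY
    have e1 : cutWeight w (bag w n pos lo hi) X = cutWeight w (bag w n pos lo hi) Y := by
      refine cutWeight_congr fun v hv => ⟨fun h => Or.inr ⟨h, ?_⟩, ?_⟩
      · exact (hXr v hv h).trans_le hhi
      · rintro (h | h)
        · exact hXl v hv (h.trans_le hlo)
        · exact h.1
    have hYw : InWindow n pos (k - 6 * c) (k + 6 * c) Y := by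
      refine ⟨fun v hv h => ?_, fun v hv h => ?_⟩
      · by_cases hvB : v ∈ bag w n pos lo hi
        · exact Or.inr ⟨hXl v hvB h, by omega⟩
        · exact Or.inl (hB v hv hvB (by omega))
      · rcases h with h | ⟨h, h'⟩
        · omega
        · by_cases hvB : v ∈ bag w n pos lo hi
          · exact hXr v hvB h
          · have := hB v hv hvB h'
            omega
    have hYw' : InWindow n pos lo hi Y :=
      ⟨fun v hv h => hYw.left v hv (h.trans_le hlo),
        fun v hv h => (hYw.right v hv h).trans_le hhi⟩
    have hkw : InWindow n pos lo hi {v | pos v < k} :=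
      ⟨fun v hv h => lt_of_lt_of_le h (by omega), fun v hv h => lt_of_lt_of_le h (by omega)⟩
    rw [e1, cutWeight_bag hYw', cutWeight_bag hkw]
    obtain ⟨j, hj, h1, h2, h3⟩ := hlean Y hYw
    exact (hk j hj h1 h2).trans h3

/-- Good layouts of all bags can be combined to a layout of the whole digraph. -/
theorem exists_isLayout_of_bags (hS : IsSemiComplete w (Finset.range n)) (hp : IsOrdering n pos)
    (hw : ∀ j, prefixCut w n pos j ≤ 2 * c) (hlean : ∀ k ≤ n, IsLeanAt w n pos (6 * c) k)
    (hbag : ∀ k ≤ n, 0 < k → IsLocalMin w n pos (6 * c) k → ∃ g,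
      IsLayout w (bag w n pos (prevMin w n pos (6 * c) k - 6 * c) (k + 6 * c)) c g) :
    ∃ h, IsLayout w (Finset.range n) c h := by
  classical
  set P := prevMin w n pos (6 * c) with hP
  set B := fun k => bag w n pos (P k - 6 * c) (k + 6 * c) with hB
  -- Splitting the layout of a bag at `k` and then at the preceding local minimum makes the segment
  -- between the two minima contiguous. The second split preserves the effect of the first.
  have key : ∀ k, ∃ g, k ≤ n → 0 < k → IsLocalMin w n pos (6 * c) k →
      IsLayout w (B k) c g ∧
      (∀ u ∈ B k, ∀ v ∈ B k, pos u < P k → P k ≤ pos v → g u < g v) ∧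
      (∀ u ∈ B k, ∀ v ∈ B k, pos u < k → k ≤ pos v → g u < g v) := by
    intro k
    by_cases hk : k ≤ n ∧ 0 < k ∧ IsLocalMin w n pos (6 * c) k
    swap
    · exact ⟨id, fun h1 h2 h3 => absurd ⟨h1, h2, h3⟩ hk⟩
    obtain ⟨hkn, hk0, hk⟩ := hk
    obtain ⟨g, hg⟩ := hbag k hkn hk0 hk
    have hlt : P k < k := prevMin_lt hk0
    have hM : ∀ v ∈ B k, g v < (B k).sup g + 1 := fun v hv => Nat.lt_succ_of_le (Finset.le_sup hv)
    set M := (B k).sup g + 1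
    have hg1 := hg.split_bag hS hp hw hk (hlean k hkn) (by omega) le_rfl hM
    set g1 : ℕ → ℕ := fun v => if pos v < k then g v else M + g v with hg1'
    have hM1 : ∀ v ∈ B k, g1 v < (B k).sup g1 + 1 :=
      fun v hv => Nat.lt_succ_of_le (Finset.le_sup hv)
    set M1 := (B k).sup g1 + 1
    have hg2 := hg1.split_bag hS hp hw (isLocalMin_prevMin (6 * c) k)
      (hlean (P k) (by omega)) le_rfl (show P k + 6 * c ≤ k + 6 * c by omega) hM1
    refine ⟨_, fun _ _ _ => ⟨hg2, ?_, ?_⟩⟩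
    · intro u hu v hv h1 h2
      have := hM1 u hu
      simp only [← hP]
      rw [if_pos h1, if_neg (by omega)]
      omega
    · intro u hu v hv h1 h2
      have h3 := hM u hu
      have h4 := hM1 u hu
      simp only [← hP, hg1', if_pos h1, if_neg (not_lt.2 h2), if_neg (show ¬ pos v < P k by omega)]
      split_ifs <;> omega
  choose G hG using key
  -- The right end of the segment that contains `v`: the first local minimum after its position. It
  -- exists because the cut at `n` is empty.
  have hnext : ∀ v, ∃ k, v < n → pos v < k ∧ k ≤ n ∧ IsLocalMin w n pos (6 * c) k ∧
      P k ≤ pos v := by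
    intro v
    by_cases hv : v < n
    swap
    · exact ⟨0, fun h => absurd h hv⟩
    have hex : ∃ k, pos v < k ∧ k ≤ n ∧ IsLocalMin w n pos (6 * c) k :=
      ⟨n, hp.lt v hv, le_rfl, hp.isLocalMin_self _⟩
    obtain ⟨h1, h2, h3⟩ := Nat.find_spec hex
    refine ⟨Nat.find hex, fun _ => ⟨h1, h2, h3, ?_⟩⟩
    by_contra h
    have hlt : P (Nat.find hex) < Nat.find hex := prevMin_lt (by omega)
    exact Nat.find_min hex hlt ⟨not_le.1 h, by omega, isLocalMin_prevMin _ _⟩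
  choose κ hκ using hnext
  have hκle : ∀ v < n, ∀ k, IsLocalMin w n pos (6 * c) k → pos v < k → κ v ≤ k := by
    intro v hv k hk h
    by_contra h'
    have : k ≤ P (κ v) := le_prevMin hk (not_le.1 h')
    have := (hκ v hv).2.2.2
    omega
  have hmemB : ∀ v < n, ∀ k, P k ≤ pos v → pos v < k → v ∈ B k := fun v hv k h1 h2 =>
    mem_bag.2 ⟨hv, Or.inl ⟨by omega, by omega⟩⟩
  set M := (Finset.range n).sup (fun v => G (κ v) v) + 1 with hMdef
  have hM : ∀ v < n, G (κ v) v < M := fun v hv =>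
    Nat.lt_succ_of_le (Finset.le_sup (f := fun v => G (κ v) v) (Finset.mem_range.2 hv))
  -- Lexicographic order: first by segment, then by the layout of the bag of the segment.
  set h : ℕ → ℕ := fun v => κ v * M + G (κ v) v with hh
  have hlex : ∀ u < n, ∀ v < n, κ u < κ v → h u < h v := by
    intro u hu v hv huv
    have h1 := hM u hu
    have h2 : (κ u + 1) * M ≤ κ v * M := Nat.mul_le_mul_right _ huv
    simp only [hh]
    rw [Nat.succ_mul] at h2
    omega
  refine ⟨h, ⟨?_, fun i => ?_⟩⟩
  · intro u hu v hv huv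
    simp only [Finset.coe_range, Set.mem_Iio] at hu hv
    have hκuv : κ u = κ v := by
      rcases lt_trichotomy (κ u) (κ v) with h1 | h1 | h1
      · exact absurd huv (hlex u hu v hv h1).ne
      · exact h1
      · exact absurd huv (hlex v hv u hu h1).ne'
    obtain ⟨h1, h2, h3, h4⟩ := hκ u hu
    obtain ⟨h1', h2', h3', h4'⟩ := hκ v hv
    refine (hG (κ u) h2 (by omega) h3).1.injOn (hmemB u hu _ h4 h1)
      (hmemB v hv _ (by rwa [hκuv]) (by rwa [hκuv])) ?_
    simp only [hh, hκuv] at huv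
    rw [hκuv]
    omega
  by_cases hne : ∃ v < n, h v < i
  swap
  · push Not at hne
    rw [cutWeight_eq_zero (fun v hv => by simpa using hne v (Finset.mem_range.1 hv))]
    exact Nat.zero_le _
  obtain ⟨z, hz, hmax⟩ := Finset.exists_max_image ((Finset.range n).filter (h · < i)) h (by
    obtain ⟨v, hv, hvi⟩ := hne
    exact ⟨v, by simp [hv, hvi]⟩)
  simp only [Finset.mem_filter, Finset.mem_range, and_imp] at hz hmax
  obtain ⟨hz, hzi⟩ := hz
  obtain ⟨k1, k2, k3, k4⟩ := hκ z hz
  set k := κ z with hk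
  obtain ⟨hGl, hG1, hG2⟩ := hG k k2 (by omega) k3
  have hzB := hmemB z hz k k4 k1
  have hlt : P k < k := by omega
  have hleft : ∀ v < n, pos v < P k → h v < i := by
    intro v hv hvP
    have := hκle v hv (P k) (isLocalMin_prevMin _ _) hvP
    exact (hlex v hv z hz (by omega)).trans hzi
  have hright : ∀ v < n, h v < i → pos v < k := by
    intro v hv hvi
    have := hmax v hv hvi
    by_contra hkv
    have h1 := (hκ v hv).1
    have := hlex z hz v hv (by omega)
    omega
  -- The prefix of `h` that ends with `z` lies in the window of the bag of `z`, so its cut can be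
  -- computed in that bag. There it coincides with the prefix of `G k` that ends with `z`.
  rw [← cutWeight_bag (pos := pos) (X := {v | h v < i}) (lo := P k - 6 * c) (hi := k + 6 * c)
    ⟨fun v hv hl => hleft v hv (by omega), fun v hv hl => by
      have := hright v hv hl
      omega⟩]
  refine le_trans (le_of_eq (cutWeight_congr fun v hv => ?_)) (hGl.cut_le (G k z + 1))
  have hvn := (mem_bag.1 hv).1
  simp only [Set.mem_ofPred_eq]
  by_cases h1 : pos v < P k
  · have := hG1 v hv z hzB h1 k4
    have := hleft v hvn h1
    omega
  by_cases h2 : pos v < k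
  · have e : κ v = k := by
      refine le_antisymm (hκle v hvn k k3 h2) ?_
      by_contra h3
      have : κ v ≤ P k := le_prevMin (hκ v hvn).2.2.1 (not_le.1 h3)
      have := (hκ v hvn).1
      omega
    have e1 : h v = k * M + G k v := by simp only [hh, e]
    have e2 : h z = k * M + G k z := by simp only [hh, ← hk]
    have := hmax v hvn
    omega
  · have := hG2 z hzB v hv k1 (not_lt.1 h2)
    have := hright v hvn
    omega

/-! ### Moving a minimum cut to the front -/

theorem rank_lt_iff {S : Finset ℕ} {f : ℕ → ℕ} {u v : ℕ} (hu : u ∈ S) (hv : v ∈ S) :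
    rank S f u < rank S f v ↔ f u < f v := by
  refine ⟨fun h => ?_, rank_lt_rank hu⟩
  by_contra h'
  rcases (not_lt.1 h').lt_or_eq with h1 | h1
  · exact absurd (rank_lt_rank hv h1) h.not_gt
  · rw [rank, rank, h1] at h
    exact lt_irrefl _ h

theorem isOrdering_rank {f : ℕ → ℕ} (hf : ∀ u < n, ∀ v < n, f u = f v → u = v) :
    IsOrdering n (rank (Finset.range n) f) where
  lt v hv := by
    have : (Finset.range n).filter (f · < f v) ⊂ Finset.range n :=
      Finset.filter_ssubset.2 ⟨v, by simpa using hv, by simp⟩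
    simpa [rank] using Finset.card_lt_card this
  inj u hu v hv h := by
    rw [← Finset.mem_range] at hu hv
    have h1 := (rank_lt_iff (f := f) hu hv).not.1 h.not_lt
    have h2 := (rank_lt_iff (f := f) hv hu).not.1 h.symm.not_lt
    rw [Finset.mem_range] at hu hv
    exact hf u hu v hv (by omega)

theorem cutWeight_rank (f : ℕ → ℕ) {v : ℕ} (hv : v < n) :
    cutWeight w (Finset.range n) {u | rank (Finset.range n) f u ≤ rank (Finset.range n) f v} =
      cutWeight w (Finset.range n) {u | f u ≤ f v} := by
  refine cutWeight_congr fun u hu => ?_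
  simp only [Set.mem_ofPred_eq, ← not_lt]
  exact (rank_lt_iff (Finset.mem_range.2 hv) hu).not

theorem totalCut_rank (f : ℕ → ℕ) : totalCut w n (rank (Finset.range n) f) = totalCut w n f :=
  Finset.sum_congr rfl fun _ hv => cutWeight_rank f (Finset.mem_range.1 hv)

/-- A nonempty prefix has a last vertex, so it suffices to know the cuts just after vertices. -/
theorem prefixCut_le {f : ℕ → ℕ} {m : ℕ}
    (h : ∀ v < n, cutWeight w (Finset.range n) {u | f u ≤ f v} ≤ m) (j : ℕ) :
    prefixCut w n f j ≤ m := by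
  by_cases hne : ∃ v < n, f v < j
  · obtain ⟨z, hz, hmax⟩ := Finset.exists_max_image ((Finset.range n).filter (f · < j)) f (by
      obtain ⟨v, hv, hvi⟩ := hne
      exact ⟨v, by simp [hv, hvi]⟩)
    simp only [Finset.mem_filter, Finset.mem_range, and_imp] at hz hmax
    refine le_trans (le_of_eq (cutWeight_congr fun v hv => ?_)) (h z hz.1)
    simp only [Set.mem_ofPred_eq]
    exact ⟨hmax v (Finset.mem_range.1 hv), fun h => h.trans_lt hz.2⟩
  · push Not at hne
    rw [prefixCut, cutWeight_eq_zero (fun v hv => by simpa using hne v (Finset.mem_range.1 hv))]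
    exact Nat.zero_le _

theorem cutWeight_le_prefixCut (v : ℕ) :
    cutWeight w (Finset.range n) {u | pos u ≤ pos v} = prefixCut w n pos (pos v + 1) :=
  cutWeight_congr fun u _ => by simp

section MoveToFront

variable {lo hi : ℕ} {X : Set ℕ} {f : ℕ → ℕ}

/-- Moving a minimum cut of a window to the front does not increase any cut. -/
theorem IsOrdering.cutWeight_moveToFront_le (hp : IsOrdering n pos) (hX : InWindow n pos lo hi X)
    (hmin : ∀ Y, InWindow n pos lo hi Y →
      cutWeight w (Finset.range n) X ≤ cutWeight w (Finset.range n) Y)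
    (hfX : ∀ v < n, v ∈ X → f v = pos v) (hfX' : ∀ v < n, v ∉ X → f v = n + pos v)
    {v : ℕ} (hv : v < n) :
    cutWeight w (Finset.range n) {u | f u ≤ f v} ≤
      cutWeight w (Finset.range n) {u | pos u ≤ pos v} := by
  set A : Set ℕ := {u | pos u ≤ pos v} with hA
  have hsub := cutWeight_inter_add_union_le w (Finset.range n) X A
  have hpv := hp.lt v hv
  -- The new prefix ending with `v` is `X ∩ A` or `X ∪ A`, depending on whether `v` belongs to `X`.
  -- In either case the other set lies in the window, so its cut is at least that of `X`, and
  -- submodularity finishes.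
  by_cases hvX : v ∈ X
  · have e : cutWeight w (Finset.range n) {u | f u ≤ f v} =
        cutWeight w (Finset.range n) (X ∩ A) := by
      refine cutWeight_congr fun u hu => ?_
      rw [Finset.mem_range] at hu
      simp only [hA, Set.mem_ofPred_eq, Set.mem_inter_iff, hfX v hv hvX]
      by_cases huX : u ∈ X
      · simp [hfX u hu huX, huX]
      · simp only [hfX' u hu huX, huX, false_and, iff_false]
        omega
    have := hmin (X ∪ A) ⟨fun u hu h => Or.inl (hX.left u hu h), by
      rintro u hu (h | h)
      · exact hX.right u hu h
      · exact lt_of_le_of_lt h (hX.right v hv hvX)⟩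
    omega
  · have e : cutWeight w (Finset.range n) {u | f u ≤ f v} =
        cutWeight w (Finset.range n) (X ∪ A) := by
      refine cutWeight_congr fun u hu => ?_
      rw [Finset.mem_range] at hu
      have hpu := hp.lt u hu
      simp only [hA, Set.mem_ofPred_eq, Set.mem_union, hfX' v hv hvX]
      by_cases huX : u ∈ X
      · simp only [hfX u hu huX, huX, true_or, iff_true]
        omega
      · simp [hfX' u hu huX, huX]
    have := hmin (X ∩ A) ⟨fun u hu h => ⟨hX.left u hu h, by
      by_contra h'
      simp only [hA, Set.mem_ofPred_eq, not_le] at h'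
      exact hvX (hX.left v hv (h'.trans h))⟩, fun u hu h => hX.right u hu h.1⟩
    omega

/-- Moving a minimum cut of a window to the front decreases the total if the cut is smaller than
all prefixes in the window. -/
theorem IsOrdering.totalCut_moveToFront_lt (hp : IsOrdering n pos) (hX : InWindow n pos lo hi X)
    (hmin : ∀ Y, InWindow n pos lo hi Y →
      cutWeight w (Finset.range n) X ≤ cutWeight w (Finset.range n) Y)
    (hfX : ∀ v < n, v ∈ X → f v = pos v) (hfX' : ∀ v < n, v ∉ X → f v = n + pos v)
    (hlo : lo ≤ n) (hlohi : lo ≤ hi)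
    (hlt : ∀ j ≤ n, lo ≤ j → j ≤ hi → cutWeight w (Finset.range n) X < prefixCut w n pos j) :
    totalCut w n f < totalCut w n pos := by
  classical
  refine Finset.sum_lt_sum (fun v hv => hp.cutWeight_moveToFront_le hX hmin hfX hfX'
    (Finset.mem_range.1 hv)) ?_
  -- `X` has a smaller cut than the prefix at `lo`, so it reaches into the window. Its last vertex
  -- `z` witnesses the strict decrease: the prefix ending with `z` becomes `X` itself.
  have hne : ∃ v < n, v ∈ X ∧ lo ≤ pos v := by
    by_contra h
    push Not at h
    refine (hlt lo hlo le_rfl hlohi).ne (cutWeight_congr fun v hv => ?_)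
    rw [Finset.mem_range] at hv
    exact ⟨fun h1 => h v hv h1, fun h1 => hX.left v hv h1⟩
  obtain ⟨v₀, hv₀, hv₀X, hv₀lo⟩ := hne
  obtain ⟨z, hz, hmax⟩ := Finset.exists_max_image ((Finset.range n).filter (· ∈ X)) pos
    ⟨v₀, by simp [hv₀, hv₀X]⟩
  simp only [Finset.mem_filter, Finset.mem_range, and_imp] at hz hmax
  refine ⟨z, Finset.mem_range.2 hz.1, ?_⟩
  have h1 := hX.right z hz.1 hz.2
  have h2 := hp.lt z hz.1
  have h3 := hmax v₀ hv₀ hv₀X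
  rw [cutWeight_le_prefixCut (pos := pos)]
  refine lt_of_le_of_lt (le_of_eq (cutWeight_congr fun u hu => ?_))
    (hlt (pos z + 1) h2 (by omega) h1)
  rw [Finset.mem_range] at hu
  simp only [Set.mem_ofPred_eq, hfX z hz.1 hz.2]
  by_cases huX : u ∈ X
  · simp [hfX u hu huX, huX, hmax u hu huX]
  · simp only [hfX' u hu huX, huX, iff_false]
    omega

end MoveToFront

end

/-! ## Residual weights and reachability -/

section Reach

variable {n : ℕ} {w : ℕ → ℕ → ℕ} {src : ℕ → Prop} {a a' : ℕ → ℕ} {j : ℕ}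

/-- `a` is the result of `j` rounds of breadth-first search along the arcs of positive weight from
the sources `src`: vertices not reached have age `0`, the others the number of rounds since they
were reached. -/
structure IsAge (n : ℕ) (w : ℕ → ℕ → ℕ) (src : ℕ → Prop) (j : ℕ) (a : ℕ → ℕ) : Prop where
  le : ∀ v < n, a v ≤ j
  pred : ∀ v < n, a v ≠ 0 → ¬ src v → ∃ u < n, w u v ≠ 0 ∧ a v < a u
  closed : j ≤ ((Finset.range n).filter (a · ≠ 0)).card ∨
    ((∀ v < n, src v → a v ≠ 0) ∧ ∀ u < n, ∀ v < n, a u ≠ 0 → w u v ≠ 0 → a v ≠ 0)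

theorem isAge_zero (ha : ∀ v < n, a v = 0) : IsAge n w src 0 a where
  le v hv := (ha v hv).le
  pred v hv h := absurd (ha v hv) h
  closed := Or.inl (Nat.zero_le _)

/-- All reached vertices age together and new ones start at age one, so an older predecessor remains
older. If a round reaches nothing new, the reached set is closed under arcs; otherwise it grows by
at least one. -/
theorem IsAge.step (h : IsAge n w src j a)
    (hs : ∀ v < n, (src v ∨ a v ≠ 0 ∨ ∃ u < n, a u ≠ 0 ∧ w u v ≠ 0) → a' v = a v + 1)
    (hs' : ∀ v < n, ¬ (src v ∨ a v ≠ 0 ∨ ∃ u < n, a u ≠ 0 ∧ w u v ≠ 0) → a' v = 0) :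
    IsAge n w src (j + 1) a' := by
  have hne : ∀ v < n, (a' v ≠ 0 ↔ (src v ∨ a v ≠ 0 ∨ ∃ u < n, a u ≠ 0 ∧ w u v ≠ 0)) := by
    intro v hv
    by_cases hc : src v ∨ a v ≠ 0 ∨ ∃ u < n, a u ≠ 0 ∧ w u v ≠ 0
    · simp only [hs v hv hc, hc, iff_true]
      omega
    · simp only [hs' v hv hc, hc, iff_false, not_not]
  have hpos : ∀ v < n, a v ≠ 0 → a' v = a v + 1 := fun v hv h => hs v hv (Or.inr (Or.inl h))
  refine ⟨fun v hv => ?_, fun v hv hv0 hsrc => ?_, ?_⟩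
  · have := h.le v hv
    by_cases hc : src v ∨ a v ≠ 0 ∨ ∃ u < n, a u ≠ 0 ∧ w u v ≠ 0
    · rw [hs v hv hc]
      omega
    · rw [hs' v hv hc]
      omega
  · by_cases hav : a v = 0
    · rcases (hne v hv).1 hv0 with h1 | h1 | ⟨u, hu, h1, h2⟩
      · exact absurd h1 hsrc
      · exact absurd hav h1
      · refine ⟨u, hu, h2, ?_⟩
        rw [hpos u hu h1, hs v hv ((hne v hv).1 hv0), hav]
        omega
    · obtain ⟨u, hu, h1, h2⟩ := h.pred v hv hav hsrc
      refine ⟨u, hu, h1, ?_⟩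
      rw [hpos u hu (by omega), hpos v hv hav]
      omega
  · have hsub : (Finset.range n).filter (a · ≠ 0) ⊆ (Finset.range n).filter (a' · ≠ 0) := by
      intro v hv
      simp only [Finset.mem_filter, Finset.mem_range] at hv ⊢
      exact ⟨hv.1, by rw [hpos v hv.1 hv.2]; omega⟩
    have hclosed : (∀ v < n, a' v ≠ 0 → a v ≠ 0) → (∀ v < n, src v → a' v ≠ 0) ∧
        ∀ u < n, ∀ v < n, a' u ≠ 0 → w u v ≠ 0 → a' v ≠ 0 := fun h' =>
      ⟨fun v hv h1 => (hne v hv).2 (Or.inl h1), fun u hu v hv h1 h2 =>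
        (hne v hv).2 (Or.inr (Or.inr ⟨u, hu, h' u hu h1, h2⟩))⟩
    rcases h.closed with hc | ⟨hc1, hc2⟩
    · rcases hsub.eq_or_ssubset with heq | hss
      · refine Or.inr (hclosed fun v hv h1 => ?_)
        have : v ∈ (Finset.range n).filter (a · ≠ 0) := by
          rw [heq]
          simp [hv, h1]
        exact (Finset.mem_filter.1 this).2
      · exact Or.inl (hc.trans_lt (Finset.card_lt_card hss))
    · refine Or.inr (hclosed fun v hv h1 => ?_)
      rcases (hne v hv).1 h1 with h2 | h2 | ⟨u, hu, h2, h3⟩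
      · exact hc1 v hv h2
      · exact h2
      · exact hc2 u hu v hv h2 h3

/-- More than `n` rounds cannot all have reached a new vertex. -/
theorem IsAge.closed_of_lt (h : IsAge n w src j a) (hj : n < j) :
    (∀ v < n, src v → a v ≠ 0) ∧ ∀ u < n, ∀ v < n, a u ≠ 0 → w u v ≠ 0 → a v ≠ 0 := by
  refine h.closed.resolve_left fun hc => ?_
  have := Finset.card_filter_le (Finset.range n) (a · ≠ 0)
  rw [Finset.card_range] at this
  omega

end Reach

open Classical in
/-- Reversing one unit of the weight from `u` to `v`. -/
theorem cutWeight_flip {w w' : ℕ → ℕ → ℕ} {S : Finset ℕ} {u v : ℕ} (hu : u ∈ S) (hv : v ∈ S)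
    (huv : u ≠ v) (hw : w u v ≠ 0) (h1 : w' u v = w u v - 1) (h2 : w' v u = w v u + 1)
    (h3 : ∀ x ∈ S, ∀ y ∈ S, ¬ (x = u ∧ y = v) → ¬ (x = v ∧ y = u) → w' x y = w x y) (X : Set ℕ) :
    cutWeight w' S X + (if v ∈ X then 1 else 0) = cutWeight w S X + if u ∈ X then 1 else 0 := by
  have point : ∀ (a b k : ℕ), a ∈ S → b ∈ S →
      (∑ x ∈ S, ∑ y ∈ S, if x = a ∧ y = b then k else 0) = k := by
    intro a b k ha hb
    rw [Finset.sum_eq_single a]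
    · rw [Finset.sum_eq_single b]
      · simp
      · intro y _ hy
        simp [hy]
      · exact fun h => absurd hb h
    · intro x _ hx
      simp [hx]
    · exact fun h => absurd ha h
  have h : cutWeight w' S X + (if u ∉ X ∧ v ∈ X then 1 else 0) =
      cutWeight w S X + if v ∉ X ∧ u ∈ X then 1 else 0 := by
    rw [← point u v (if u ∉ X ∧ v ∈ X then 1 else 0) hu hv,
      ← point v u (if v ∉ X ∧ u ∈ X then 1 else 0) hv hu, cutWeight, cutWeight]
    simp only [← Finset.sum_add_distrib]
    refine Finset.sum_congr rfl fun x hx => Finset.sum_congr rfl fun y hy => ?_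
    by_cases c1 : x = u ∧ y = v
    · obtain ⟨rfl, rfl⟩ := c1
      simp only [h1, huv, false_and, and_self, if_true, if_false]
      split_ifs <;> omega
    · by_cases c2 : x = v ∧ y = u
      · obtain ⟨rfl, rfl⟩ := c2
        simp only [h2, huv.symm, false_and, and_self, if_true, if_false]
        split_ifs <;> omega
      · simp only [h3 x hx y hy c1 c2, c1, c2, if_false]
  by_cases hu' : u ∈ X <;> by_cases hv' : v ∈ X <;> simp_all

/-! ## Specification of bounded programs -/

/-- The registers that a program may change. -/
def BProg.regs : BProg → List ℕ
  | .setReg x _ => [x]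
  | .ask x => [x]
  | .seq p q => p.regs ++ q.regs
  | .cond _ p q => p.regs ++ q.regs
  | .rep _ p => p.regs
  | _ => []

/-- The arrays that a program may change. -/
def BProg.arrays : BProg → List ℕ
  | .setCell a _ _ => [a]
  | .store a _ _ _ => [a]
  | .seq p q => p.arrays ++ q.arrays
  | .cond _ p q => p.arrays ++ q.arrays
  | .rep _ p => p.arrays
  | _ => []

/-- Programs without output, query tape and oracle. -/
def BProg.silent : BProg → Bool
  | .write _ => false
  | .push _ => false
  | .ask _ => false
  | .seq p q => p.silent && q.silent
  | .cond _ p q => p.silent && q.silent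
  | .rep _ p => p.silent
  | _ => true

/-- Programs without oracle calls. -/
def BProg.noAsk : BProg → Bool
  | .ask _ => false
  | .seq p q => p.noAsk && q.noAsk
  | .cond _ p q => p.noAsk && q.noAsk
  | .rep _ p => p.noAsk
  | _ => true

/-! ### Invariants of loops, and what a program leaves unchanged. -/

section Frame

variable {N : ℕ} {O : Oracle}

theorem iterate_invariant {α : Type*} {f : α → α} (I : ℕ → α → Prop) {m : ℕ} {a : α} (h0 : I 0 a)
    (hs : ∀ i < m, ∀ b, I i b → I (i + 1) (f b)) : I m (f^[m] a) := by
  induction m with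
  | zero => exact h0
  | succ m ih =>
    rw [Function.iterate_succ_apply']
    exact hs m (Nat.lt_succ_self m) _ (ih fun i hi => hs i (hi.trans (Nat.lt_succ_self m)))

theorem BProg.run_reg {p : BProg} {x : ℕ} (h : x ∉ p.regs) (s : State) :
    (p.run N O s).reg x = s.reg x := by
  induction p generalizing s with
  | setReg y e =>
    simp only [BProg.regs, List.mem_singleton] at h
    simp [BProg.run, h]
  | ask y =>
    simp only [BProg.regs, List.mem_singleton] at h
    simp [BProg.run, h]
  | seq p q ihp ihq =>
    simp only [BProg.regs, List.mem_append, not_or] at h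
    rw [BProg.run, ihq h.2, ihp h.1]
  | cond e p q ihp ihq =>
    simp only [BProg.regs, List.mem_append, not_or] at h
    rw [BProg.run]
    split_ifs
    · exact ihp h.1 s
    · exact ihq h.2 s
  | rep b p ih =>
    exact iterate_invariant (fun _ s' => s'.reg x = s.reg x) rfl fun _ _ s' h' => (ih h s').trans h'
  | _ => rfl

theorem BProg.run_cell {p : BProg} {a : ℕ} (h : a ∉ p.arrays) (s : State) :
    (p.run N O s).cell a = s.cell a := by
  induction p generalizing s with
  | setCell b i e =>
    simp only [BProg.arrays, List.mem_singleton] at h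
    simp [BProg.run, h]
  | store b x m e =>
    simp only [BProg.arrays, List.mem_singleton] at h
    simp [BProg.run, h]
  | seq p q ihp ihq =>
    simp only [BProg.arrays, List.mem_append, not_or] at h
    rw [BProg.run, ihq h.2, ihp h.1]
  | cond e p q ihp ihq =>
    simp only [BProg.arrays, List.mem_append, not_or] at h
    rw [BProg.run]
    split_ifs
    · exact ihp h.1 s
    · exact ihq h.2 s
  | rep b p ih =>
    exact iterate_invariant (fun _ s' => s'.cell a = s.cell a) rfl
      fun _ _ s' h' => (ih h s').trans h'
  | _ => rfl

theorem BProg.run_silent {p : BProg} (h : p.silent = true) (s : State) :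
    (p.run N O s).out = s.out ∧ (p.run N O s).tape = s.tape ∧
      (p.run N O s).asked = s.asked := by
  induction p generalizing s with
  | write e => simp [BProg.silent] at h
  | push e => simp [BProg.silent] at h
  | ask x => simp [BProg.silent] at h
  | seq p q ihp ihq =>
    simp only [BProg.silent, Bool.and_eq_true] at h
    obtain ⟨h1, h2, h3⟩ := ihp h.1 s
    obtain ⟨h4, h5, h6⟩ := ihq h.2 (p.run N O s)
    exact ⟨h4.trans h1, h5.trans h2, h6.trans h3⟩
  | cond e p q ihp ihq =>
    simp only [BProg.silent, Bool.and_eq_true] at h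
    rw [BProg.run]
    split_ifs
    · exact ihp h.1 s
    · exact ihq h.2 s
  | rep b p ih =>
    refine iterate_invariant
      (fun _ (s' : State) => s'.out = s.out ∧ s'.tape = s.tape ∧ s'.asked = s.asked)
      ⟨rfl, rfl, rfl⟩ fun _ _ s' h' => ?_
    obtain ⟨h4, h5, h6⟩ := ih h s'
    exact ⟨h4.trans h'.1, h5.trans h'.2.1, h6.trans h'.2.2⟩
  | _ => exact ⟨rfl, rfl, rfl⟩

theorem BProg.run_noAsk {p : BProg} (h : p.noAsk = true) (O O' : Oracle) (s : State) :
    p.run N O s = p.run N O' s ∧ (p.run N O s).asked = s.asked := by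
  induction p generalizing s with
  | ask x => simp [BProg.noAsk] at h
  | seq p q ihp ihq =>
    simp only [BProg.noAsk, Bool.and_eq_true] at h
    simp only [BProg.run, ← (ihp h.1 s).1]
    exact ⟨(ihq h.2 _).1, (ihq h.2 _).2.trans (ihp h.1 s).2⟩
  | cond e p q ihp ihq =>
    simp only [BProg.noAsk, Bool.and_eq_true] at h
    simp only [BProg.run]
    split_ifs
    · exact ihp h.1 s
    · exact ihq h.2 s
  | rep b p ih =>
    have he : p.run N O = p.run N O' := funext fun s => (ih h s).1
    refine ⟨by simp only [BProg.run, he], ?_⟩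
    exact iterate_invariant (fun _ (s' : State) => s'.asked = s.asked) rfl
      fun _ _ s' h' => (ih h s').2.trans h'
  | _ => exact ⟨rfl, rfl⟩

end Frame

/-- The machine program of a bounded program. -/
def BProg.toProg (p : BProg) : Prog := .seq (.setCell 3 (.const 0) (.reg 0)) (p.comp 0)

theorem polynomial_eval_le (p : Polynomial ℕ) {a b : ℕ} (h : a ≤ b) :
    p.eval a ≤ p.eval b := by
  rw [Polynomial.eval_eq_sum, Polynomial.eval_eq_sum]
  exact Finset.sum_le_sum fun i _ => Nat.mul_le_mul_left _ (Nat.pow_le_pow_left h i)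

theorem length_le_bitLength (x : List ℕ) : x.length ≤ bitLength x := by
  induction x with
  | nil => exact Nat.zero_le _
  | cons a x ih =>
    simp only [bitLength, List.map_cons, List.sum_cons, List.length_cons] at ih ⊢
    omega

/-- The machine program of a bounded program runs in polynomial time and computes its effect. -/
theorem BProg.runs_toProg (p : BProg) (O : Oracle) (x : List ℕ) :
    ∃ t ≤ (p.time + 3).eval (bitLength x), Runs O p.toProg x t
      (p.run x.length O (initState x)).asked (p.run x.length O (initState x)).out := by
  have h : Halts O p.toProg (initState x) (3 + p.time.eval x.length) fun s' =>
      Represents x.length (p.run x.length O (initState x)) s' := by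
    refine Halts.seq (Halts.setCell ?_)
    refine Halts.mono (p.halts_comp O x.length 0 (initState x)
      { initState x with cell := _ } ⟨rfl, ?_, ?_, rfl, rfl, rfl⟩) le_rfl fun _ h => h.1
    · intro a
      have : 2 * a ≠ 3 := by omega
      rcases Nat.eq_zero_or_pos a with rfl | ha
      · simp [initState]
      · simp [initState, this, ha.ne']
    · simp [Expr.eval, initState]
  obtain ⟨t, ht, s', hs, hr⟩ := h
  refine ⟨t, ?_, s', hs, hr.out, hr.asked⟩
  have := polynomial_eval_le p.time (length_le_bitLength x)
  simp only [Polynomial.eval_add, Polynomial.eval_ofNat]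
  omega

/-! ## The program that computes an ordering -/

attribute [simp] BExpr.eval

namespace BExpr

/-- Negation. -/
def not (e : BExpr) : BExpr := .eq e (.const 0)

/-- Conjunction. -/
def and (e f : BExpr) : BExpr := .ite e f (.const 0)

/-- The test `e ≤ f`. -/
def le (e f : BExpr) : BExpr := .not (.lt f e)

/-- The product of `e` with the content of register `1`. -/
def mulReg (e : BExpr) : BExpr := .sum 30 e (.reg 1)

/-- The index of the matrix entry in row `e` and column `f`. -/
def idx (e f : BExpr) : BExpr := .add (.mulReg e) f

/-- The position of a vertex. -/
def pos (e : BExpr) : BExpr := .cell 1 e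

/-- The adjacency of two vertices. -/
def adj (e f : BExpr) : BExpr := .cell 0 (.add (.const 3) (.idx e f))

/-- The residual weight of a pair of vertices. -/
def res (e f : BExpr) : BExpr := .cell 3 (.idx e f)

/-- The total weight of the arcs that leave the vertices (in register `20`) with property `φ` and
enter the vertices (in register `21`) with property `ψ`. -/
def arcs (φ ψ : BExpr) : BExpr :=
  .sum 20 (.reg 1) (.sum 21 (.reg 1) (.ite (.and φ ψ) (.adj (.reg 20) (.reg 21)) (.const 0)))

/-- The cut at position `j`. -/
def cut (j : BExpr) : BExpr :=
  .arcs (.le j (.pos (.reg 20))) (.lt (.pos (.reg 21)) j)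

/-- The least value below `b` of register `29` with property `φ`. -/
def find (b φ : BExpr) : BExpr :=
  .sum 28 b (.not (.sum 29 (.add (.reg 28) (.const 1)) φ))

end BExpr

/-! ### Values of the derived expressions. -/

section Expressions

variable {N n : ℕ} {w : ℕ → ℕ → ℕ} {c : ℕ → ℕ → ℕ} {r : ℕ → ℕ} {e f φ b : BExpr}

/-- Register `1` holds the number of vertices and array `0` the adjacency matrix. -/
structure HasInput (N n : ℕ) (w c : ℕ → ℕ → ℕ) (r : ℕ → ℕ) : Prop where
  n_eq : r 1 = n
  le : n * n + 3 ≤ N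
  adj : ∀ u < n, ∀ v < n, c 0 (3 + (u * n + v)) = w u v

theorem HasInput.n_lt (h : HasInput N n w c r) : n + 1 < N := by
  have := h.le
  nlinarith [Nat.le_mul_self n]

theorem HasInput.update (h : HasInput N n w c r) {x : ℕ} (hx : x ≠ 1) (i : ℕ) :
    HasInput N n w c (Function.update r x i) :=
  ⟨by rw [Function.update_of_ne hx.symm, h.n_eq], h.le, h.adj⟩

@[simp] theorem BExpr.eval_not : (BExpr.not e).eval N c r = if e.eval N c r = 0 then 1 else 0 := rfl

@[simp] theorem BExpr.eval_and :
    (BExpr.and e f).eval N c r = if e.eval N c r ≠ 0 then f.eval N c r else 0 := rfl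

@[simp] theorem BExpr.eval_le :
    (BExpr.le e f).eval N c r = if e.eval N c r ≤ f.eval N c r then 1 else 0 := by
  by_cases h : e.eval N c r ≤ f.eval N c r
  · simp [BExpr.le, h, not_lt.2 h]
  · simp [BExpr.le, h, not_le.1 h]

@[simp] theorem BExpr.eval_mulReg : (BExpr.mulReg e).eval N c r = min (e.eval N c r) N * r 1 := by
  simp [BExpr.mulReg]

@[simp] theorem BExpr.eval_idx :
    (BExpr.idx e f).eval N c r = min (e.eval N c r) N * r 1 + f.eval N c r := by
  simp [BExpr.idx]

@[simp] theorem BExpr.eval_pos : (BExpr.pos e).eval N c r = c 1 (e.eval N c r) := rfl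

theorem HasInput.eval_adj (h : HasInput N n w c r) (he : e.eval N c r < n) (hf : f.eval N c r < n) :
    (BExpr.adj e f).eval N c r = w (e.eval N c r) (f.eval N c r) := by
  have := h.n_lt
  simp [BExpr.adj, h.n_eq, min_eq_left (show e.eval N c r ≤ N by omega), h.adj _ he _ hf]

theorem HasInput.eval_res (h : HasInput N n w c r) (he : e.eval N c r < n) :
    (BExpr.res e f).eval N c r = c 3 (e.eval N c r * n + f.eval N c r) := by
  have := h.n_lt
  simp [BExpr.res, h.n_eq, min_eq_left (show e.eval N c r ≤ N by omega)]

theorem HasInput.eval_arcs (h : HasInput N n w c r) {X : Set ℕ} {φ ψ : BExpr}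
    (hφ : ∀ u < n, ∀ v < n,
      φ.eval N c (Function.update (Function.update r 20 u) 21 v) ≠ 0 ↔ u ∉ X)
    (hψ : ∀ u < n, ∀ v < n,
      ψ.eval N c (Function.update (Function.update r 20 u) 21 v) ≠ 0 ↔ v ∈ X) :
    (BExpr.arcs φ ψ).eval N c r = cutWeight w (Finset.range n) X := by
  classical
  have := h.n_lt
  simp only [BExpr.arcs, BExpr.eval, cutWeight, h.n_eq,
    Function.update_of_ne (show 1 ≠ 20 by decide),
    min_eq_left (show n ≤ N by omega)]
  refine Finset.sum_congr rfl fun u hu => Finset.sum_congr rfl fun v hv => ?_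
  rw [Finset.mem_range] at hu hv
  rw [((h.update (show 20 ≠ 1 by decide) u).update (show 21 ≠ 1 by decide) v).eval_adj
    (by simpa [Function.update_apply]) (by simpa [Function.update_apply])]
  have h2 := hφ u hu v hv
  have h3 := hψ u hu v hv
  refine if_congr ?_ (by simp) rfl
  rw [BExpr.eval_and]
  split_ifs with h4
  · rw [h3]
    exact (and_iff_right (h2.1 h4)).symm
  · exact iff_of_false (fun h5 => h5 rfl) fun h5 => h4 (h2.2 h5.1)

theorem HasInput.eval_cut (h : HasInput N n w c r) {j : BExpr} {J : ℕ}
    (hj : ∀ u v, j.eval N c (Function.update (Function.update r 20 u) 21 v) = J) :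
    (BExpr.cut j).eval N c r = prefixCut w n (c 1) J := by
  refine h.eval_arcs (fun u hu v hv => ?_) fun u hu v hv => ?_
  · simp [hj]
  · simp [hj]

/-- The indices `i` for which no `j ≤ i` has the property are exactly those before the first hit, so
their number is the position of this hit. -/
theorem sum_find (p : ℕ → Prop) [DecidablePred p] {b : ℕ} (h : ∃ i < b, p i) :
    (∑ i ∈ Finset.range b, if ∀ j < i + 1, ¬ p j then 1 else 0) < b ∧
      p (∑ i ∈ Finset.range b, if ∀ j < i + 1, ¬ p j then 1 else 0) := by
  have hex : ∃ i, p i := ⟨h.choose, h.choose_spec.2⟩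
  have hlt : Nat.find hex < b := (Nat.find_min' hex h.choose_spec.2).trans_lt h.choose_spec.1
  have e : (∑ i ∈ Finset.range b, if ∀ j < i + 1, ¬ p j then 1 else 0) = Nat.find hex := by
    rw [← Finset.card_filter]
    have : (Finset.range b).filter (fun i => ∀ j < i + 1, ¬ p j) =
        Finset.range (Nat.find hex) := by
      ext i
      simp only [Finset.mem_filter, Finset.mem_range]
      constructor
      · rintro ⟨_, h2⟩
        by_contra h3
        exact h2 _ (by omega) (Nat.find_spec hex)
      · exact fun h1 => ⟨h1.trans hlt, fun j hj => Nat.find_min hex (by omega)⟩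
    rw [this, Finset.card_range]
  rw [e]
  exact ⟨hlt, Nat.find_spec hex⟩

/-- Without a hit the value is the bound itself; `BProg.augment` uses this to detect that no path is
left. -/
theorem BExpr.eval_find {B : ℕ} (hB : b.eval N c r = B) (hBN : B < N) (p : ℕ → Prop)
    (hp : ∀ i < B, ∀ j ≤ i,
      φ.eval N c (Function.update (Function.update r 28 i) 29 j) ≠ 0 ↔ p j) :
    ((∃ i < B, p i) → (BExpr.find b φ).eval N c r < B ∧ p ((BExpr.find b φ).eval N c r)) ∧
      ((∀ i < B, ¬ p i) → (BExpr.find b φ).eval N c r = B) := by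
  classical
  have e : (BExpr.find b φ).eval N c r =
      ∑ i ∈ Finset.range B, if ∀ j < i + 1, ¬ p j then 1 else 0 := by
    simp only [BExpr.find, BExpr.eval, hB, min_eq_left hBN.le, BExpr.eval_not]
    refine Finset.sum_congr rfl fun i hi => ?_
    rw [Finset.mem_range] at hi
    simp only [Function.update_self, min_eq_left (show i + 1 ≤ N by omega),
      Finset.sum_eq_zero_iff, Finset.mem_range]
    refine if_congr (forall₂_congr fun j hj => ?_) rfl rfl
    rw [← hp i hi j (by omega), not_not]
  rw [e]
  refine ⟨sum_find p, fun h => ?_⟩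
  rw [Finset.sum_congr rfl fun i hi => if_pos fun j hj => h j (by
    rw [Finset.mem_range] at hi
    omega)]
  simp

end Expressions

/-! ### Programs -/

namespace BProg

/-- Stores in array `1` the ranks of the vertices in the numbering in array `4`. -/
def rankVertices : BProg :=
  .store 1 23 (.reg 1) (.sum 20 (.reg 1) (.lt (.cell 4 (.reg 20)) (.cell 4 (.reg 23))))

/-- Stores in array `4` a numbering by the difference of in-degree and out-degree. -/
def degreeKeys : BProg :=
  -- The number of the vertex in the last digit to base `n` breaks ties, which makes the keys
  -- distinct.
  .store 4 23 (.reg 1) (.add (.mulReg (.sum 20 (.reg 1)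
    (.sub (.add (.adj (.reg 20) (.reg 23)) (.const 1)) (.adj (.reg 23) (.reg 20))))) (.reg 23))

/-- A round of breadth-first search from the positions at least the content of register `6`. -/
def searchStep : BProg :=
  .store 2 23 (.reg 1) (.ite
    (.add (.le (.reg 6) (.pos (.reg 23))) (.add (.cell 2 (.reg 23))
      (.sum 24 (.reg 1) (.and (.cell 2 (.reg 24)) (.res (.reg 24) (.reg 23))))))
    (.add (.cell 2 (.reg 23)) (.const 1)) (.const 0))

/-- Breadth-first search. -/
def search : BProg := .seq (.store 2 23 (.reg 1) (.const 0)) (.rep (.reg 0) searchStep)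

/-- A step back from the vertex in register `7` along a search path, with reversal of the arc. -/
def walkStep : BProg :=
  .cond (.lt (.pos (.reg 7)) (.reg 6))
    (.seq (.setReg 8 (.find (.reg 1)
        (.and (.res (.reg 29) (.reg 7)) (.lt (.cell 2 (.reg 7)) (.cell 2 (.reg 29))))))
      (.seq (.setCell 3 (.idx (.reg 8) (.reg 7)) (.sub (.res (.reg 8) (.reg 7)) (.const 1)))
      (.seq (.setCell 3 (.idx (.reg 7) (.reg 8)) (.add (.res (.reg 7) (.reg 8)) (.const 1)))
      (.setReg 7 (.reg 8)))))
    .skip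

/-- Search for a path to the positions below the content of register `5`, and its reversal. -/
def augment : BProg :=
  .seq search (.seq (.setReg 7 (.find (.reg 1)
      (.and (.cell 2 (.reg 29)) (.lt (.pos (.reg 29)) (.reg 5)))))
    (.cond (.lt (.reg 7) (.reg 1)) (.rep (.reg 0) walkStep) .skip))

/-- The vertices with entry `0` in array `2` become a minimum cut of the window. -/
def minCut : BProg :=
  .seq (.store 3 23 (.mulReg (.reg 1)) (.cell 0 (.add (.const 3) (.reg 23))))
    (.seq (.rep (.reg 0) augment) search)

/-- The number of prefixes in the window whose cut is at most that given by array `2`. -/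
def smallPrefixes : BExpr :=
  .sum 22 (.add (.reg 1) (.const 1)) (.and (.le (.reg 5) (.reg 22)) (.and (.le (.reg 22) (.reg 6))
    (.le (.cut (.reg 22)) (.arcs (.cell 2 (.reg 20)) (.not (.cell 2 (.reg 21)))))))

/-- Improves the ordering in the window around the position in register `4`, if possible. -/
def improve : BProg :=
  -- Registers `5` and `6` hold the ends of the window. Array `1` holds the positions, `2` the ages
  -- of the search, `3` the residual weights and `4` the numbering to be ranked.
  .seq (.setReg 5 (.sub (.reg 4) (.reg 3))) <| .seq (.setReg 6 (.add (.reg 4) (.reg 3))) <|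
  .seq minCut <| .seq
    (.cond smallPrefixes .skip
      (.seq (.store 4 23 (.reg 1)
        (.ite (.cell 2 (.reg 23)) (.add (.reg 1) (.pos (.reg 23))) (.pos (.reg 23)))) rankVertices))
    (.setReg 4 (.add (.reg 4) (.const 1)))

/-- Improves the ordering in all windows. -/
def improveAll : BProg :=
  .seq (.setReg 4 (.const 0)) (.rep (.add (.reg 1) (.const 1)) improve)

/-- Improves the ordering until it is lean. -/
def makeLean : BProg := .rep (.reg 0) (.rep (.reg 0) improveAll)

end BProg

/-! ### Sorting and breadth-first search. -/

section Specifications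

variable {N n : ℕ} {w : ℕ → ℕ → ℕ} {O : Oracle} {s : State}

theorem BProg.run_seq (p q : BProg) : (BProg.seq p q).run N O s = q.run N O (p.run N O s) := rfl

theorem BProg.run_rep (b : BExpr) (p : BProg) :
    (BProg.rep b p).run N O s = (p.run N O)^[min (b.eval N s.cell s.reg) N] s := rfl

theorem BProg.run_cond (e : BExpr) (p q : BProg) : (BProg.cond e p q).run N O s =
    if e.eval N s.cell s.reg ≠ 0 then p.run N O s else q.run N O s := rfl

theorem BProg.run_store_cell (a x i : ℕ) (b e : BExpr) :
    ((BProg.store a x b e).run N O s).cell a i = if i < min (b.eval N s.cell s.reg) N then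
      e.eval N s.cell (Function.update s.reg x i) else s.cell a i := by
  simp [BProg.run, BExpr.val]

theorem BProg.run_setReg_reg (x : ℕ) (e : BExpr) :
    ((BProg.setReg x e).run N O s).reg = Function.update s.reg x (e.eval N s.cell s.reg) := rfl

theorem BProg.run_setCell_cell (a : ℕ) (i e : BExpr) :
    ((BProg.setCell a i e).run N O s).cell a =
      Function.update (s.cell a) (i.eval N s.cell s.reg) (e.eval N s.cell s.reg) := by
  simp [BProg.run, BExpr.val]

/-- Matrices in array `3`. -/
def State.matrix (s : State) (n : ℕ) (u v : ℕ) : ℕ := s.cell 3 (u * n + v)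

theorem rankVertices_spec (h : HasInput N n w s.cell s.reg) {v : ℕ} (hv : v < n) :
    (BProg.rankVertices.run N O s).cell 1 v = rank (Finset.range n) (s.cell 4) v := by
  have := h.n_lt
  rw [rank, Finset.card_filter, BProg.rankVertices, BProg.run_store_cell]
  simp only [BExpr.eval, h.n_eq, min_eq_left (show n ≤ N by omega), hv, if_true,
    Function.update_of_ne (show 1 ≠ 23 by decide), Function.update_self,
    Function.update_of_ne (show 23 ≠ 20 by decide)]

theorem degreeKeys_spec (h : HasInput N n w s.cell s.reg) (hw : ∀ u < n, ∀ v < n, w u v ≤ 1)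
    {v : ℕ} (hv : v < n) :
    (BProg.degreeKeys.run N O s).cell 4 v =
      (∑ u ∈ Finset.range n, (w u v + 1 - w v u)) * n + v := by
  have hN := h.n_lt
  have e : ∀ i ∈ Finset.range n,
      (BExpr.sub (.add (.adj (.reg 20) (.reg 23)) (.const 1)) (.adj (.reg 23) (.reg 20))).eval N
        s.cell (Function.update (Function.update s.reg 23 v) 20 i) = w i v + 1 - w v i := by
    intro i hi
    rw [Finset.mem_range] at hi
    have h' := (h.update (show 23 ≠ 1 by decide) v).update (show 20 ≠ 1 by decide) i
    rw [BExpr.eval, BExpr.eval, h'.eval_adj (by simpa [Function.update_apply])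
      (by simpa [Function.update_apply]), h'.eval_adj (by simpa [Function.update_apply])
      (by simpa [Function.update_apply])]
    simp
  -- `BExpr.mulReg` caps its factor at `N`; here the factor is at most `2 * n`, which does not
  -- exceed `n * n + 3`.
  have hle : ∑ u ∈ Finset.range n, (w u v + 1 - w v u) ≤ N := by
    have h1 : ∑ u ∈ Finset.range n, (w u v + 1 - w v u) ≤ ∑ u ∈ Finset.range n, 2 :=
      Finset.sum_le_sum fun u hu => by
        have := hw u (Finset.mem_range.1 hu) v hv
        omega
    simp only [Finset.sum_const, Finset.card_range, smul_eq_mul] at h1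
    have := h.le
    nlinarith [sq_nonneg ((n : ℤ) - 1)]
  have hlt : v < min n N := by omega
  rw [BProg.degreeKeys, BProg.run_store_cell, BExpr.eval, h.n_eq, if_pos hlt, BExpr.eval,
    BExpr.eval_mulReg, BExpr.eval, BExpr.eval,
    BExpr.eval,
    Function.update_of_ne (show 1 ≠ 23 by decide), h.n_eq, min_eq_left (show n ≤ N by omega),
    Finset.sum_congr rfl e, min_eq_left hle]
  simp

/-- `BProg.store` reads the old ages throughout, so each repetition is one round in the sense of
`IsAge.step`. -/
theorem search_spec (h : HasInput N n w s.cell s.reg) (h0 : s.reg 0 = N) :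
    IsAge n (s.matrix n) (fun v => s.reg 6 ≤ s.cell 1 v) N
      ((BProg.search.run N O s).cell 2) := by
  have hN := h.n_lt
  rw [BProg.search, BProg.run_seq, BProg.run_rep]
  set s₀ := BProg.run N O (.store 2 23 (.reg 1) (.const 0)) s with hs₀
  have hfr : ∀ x, s₀.reg x = s.reg x := fun x => rfl
  have hfc : ∀ a ≠ 2, s₀.cell a = s.cell a := fun a ha => BProg.run_cell (by simpa [BProg.arrays]) s
  have hb : min ((BExpr.reg 0).eval N s₀.cell s₀.reg) N = N := by simp [hfr, h0]
  rw [hb]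
  have hz : ∀ v < n, s₀.cell 2 v = 0 := by
    intro v hv
    simp [hs₀, BProg.run_store_cell, h.n_eq, hv, hv.trans (show n < N by omega)]
  refine (iterate_invariant (fun j (s' : State) => s'.reg = s.reg ∧ (∀ a ≠ 2, s'.cell a = s.cell a) ∧
    IsAge n (s.matrix n) (fun v => s.reg 6 ≤ s.cell 1 v) j (s'.cell 2))
    ⟨funext hfr, hfc, isAge_zero hz⟩ ?_).2.2
  rintro j - s' ⟨hr, hc, ha⟩
  refine ⟨?_, fun a ha => ?_, ?_⟩
  · rw [← hr]
    exact funext fun x => BProg.run_reg (by simp [BProg.searchStep, BProg.regs]) s'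
  · rw [← hc a ha]
    exact BProg.run_cell (by simpa [BProg.searchStep, BProg.arrays]) s'
  · have h' : HasInput N n w s'.cell s'.reg :=
      ⟨by rw [hr, h.n_eq], h.le, by rw [hc 0 (by decide)]; exact h.adj⟩
    have key : ∀ v < n, (BProg.searchStep.run N O s').cell 2 v =
        if s.reg 6 ≤ s.cell 1 v ∨ s'.cell 2 v ≠ 0 ∨
          ∃ u < n, s'.cell 2 u ≠ 0 ∧ s.matrix n u v ≠ 0 then s'.cell 2 v + 1 else 0 := by
      intro v hv
      have hlt : v < min n N := by omega
      have hsum : (BExpr.sum 24 (.reg 1) (.and (.cell 2 (.reg 24))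
          (.res (.reg 24) (.reg 23)))).eval N s'.cell (Function.update s'.reg 23 v) = 0 ↔
          ¬ ∃ u < n, s'.cell 2 u ≠ 0 ∧ s.matrix n u v ≠ 0 := by
        rw [BExpr.eval, BExpr.eval, Function.update_of_ne (show 1 ≠ 23 by decide), h'.n_eq,
          min_eq_left (show n ≤ N by omega), Finset.sum_eq_zero_iff]
        push Not
        refine forall_congr' fun u => ?_
        rw [Finset.mem_range]
        refine imp_congr_right fun hu => ?_
        rw [BExpr.eval_and, ((h'.update (show 23 ≠ 1 by decide) v).update
          (show 24 ≠ 1 by decide) u).eval_res (by simpa [Function.update_apply])]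
        simp [State.matrix, hc 3 (by decide)]
      rw [BProg.searchStep, BProg.run_store_cell, BExpr.eval, h'.n_eq, if_pos hlt, BExpr.eval]
      refine if_congr ?_ (by simp) rfl
      rw [BExpr.eval, BExpr.eval, ne_eq, Nat.add_eq_zero_iff, Nat.add_eq_zero_iff, hsum,
        not_and_or, not_and_or, not_not]
      simp [hr, hc 1 (by decide)]
    refine ha.step (fun v hv hcond => ?_) fun v hv hcond => ?_
    · rw [key v hv, if_pos hcond]
    · rw [key v hv, if_neg hcond]

end Specifications

/-! ### Minimum cuts by augmenting paths. -/

section Specifications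

variable {N n : ℕ} {w : ℕ → ℕ → ℕ} {O : Oracle} {s : State}

theorem HasInput.run (h : HasInput N n w s.cell s.reg) {p : BProg} (hr : 1 ∉ p.regs)
    (hc : 0 ∉ p.arrays) : HasInput N n w (p.run N O s).cell (p.run N O s).reg :=
  ⟨by rw [BProg.run_reg hr, h.n_eq], h.le, by rw [BProg.run_cell hc]; exact h.adj⟩

theorem index_inj {u v x y : ℕ} (hv : v < n) (hy : y < n) (h : x * n + y = u * n + v) :
    x = u ∧ y = v := by
  have h1 : (x * n + y) / n = x := by
    rw [mul_comm, Nat.mul_add_div (by omega), Nat.div_eq_of_lt hy, add_zero]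
  have h2 : (u * n + v) / n = u := by
    rw [mul_comm, Nat.mul_add_div (by omega), Nat.div_eq_of_lt hv, add_zero]
  have h3 : x = u := by rw [← h1, h, h2]
  subst h3
  exact ⟨rfl, by omega⟩

/-- The predecessor that is found is strictly older than the current vertex. The two are therefore
distinct, and the matrix cells of the arc and of its reverse do not interfere. -/
theorem walkStep_spec (h : HasInput N n w s.cell s.reg) (hcur : s.reg 7 < n)
    (hpos : s.cell 1 (s.reg 7) < s.reg 6)
    (hex : ∃ u < n, s.matrix n u (s.reg 7) ≠ 0 ∧ s.cell 2 (s.reg 7) < s.cell 2 u) :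
    ∃ u < n, s.matrix n u (s.reg 7) ≠ 0 ∧ s.cell 2 (s.reg 7) < s.cell 2 u ∧
      (BProg.walkStep.run N O s).reg 7 = u ∧
      (BProg.walkStep.run N O s).matrix n u (s.reg 7) = s.matrix n u (s.reg 7) - 1 ∧
      (BProg.walkStep.run N O s).matrix n (s.reg 7) u = s.matrix n (s.reg 7) u + 1 ∧
      ∀ x < n, ∀ y < n, ¬ (x = u ∧ y = s.reg 7) → ¬ (x = s.reg 7 ∧ y = u) →
        (BProg.walkStep.run N O s).matrix n x y = s.matrix n x y := by
  have hN := h.n_lt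
  have hc : (BExpr.lt (.pos (.reg 7)) (.reg 6)).eval N s.cell s.reg ≠ 0 := by simp [hpos]
  rw [BProg.walkStep, BProg.run_cond, if_pos hc, BProg.run_seq, BProg.run_seq, BProg.run_seq]
  have hfind := ((BExpr.eval_find (N := N) (c := s.cell) (r := s.reg) (b := .reg 1)
    (φ := .and (.res (.reg 29) (.reg 7)) (.lt (.cell 2 (.reg 7)) (.cell 2 (.reg 29))))
    (B := n) h.n_eq (by omega)
    (fun u => s.matrix n u (s.reg 7) ≠ 0 ∧ s.cell 2 (s.reg 7) < s.cell 2 u) (by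
      intro i hi j hj
      rw [BExpr.eval_and, ((h.update (show 28 ≠ 1 by decide) i).update (show 29 ≠ 1 by decide)
        j).eval_res (by simpa using by omega)]
      simp [State.matrix])).1 hex)
  set e := BExpr.find (.reg 1)
    (.and (.res (.reg 29) (.reg 7)) (.lt (.cell 2 (.reg 7)) (.cell 2 (.reg 29))))
  obtain ⟨hu, hMu, hau⟩ := hfind
  set u := e.eval N s.cell s.reg with hu'
  set cur := s.reg 7 with hcur'
  have huc : u ≠ cur := by
    intro h'
    rw [h'] at hau
    exact lt_irrefl _ hau
  set s₁ := (BProg.setReg 8 e).run N O s with hs₁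
  have h₁ : HasInput N n w s₁.cell s₁.reg :=
    h.run (by simp [BProg.regs]) (by simp [BProg.arrays])
  have r8 : s₁.reg 8 = u := by simp [hs₁, BProg.run_setReg_reg, hu']
  have r7 : s₁.reg 7 = cur := BProg.run_reg (by simp [BProg.regs]) s
  have c3 : s₁.cell 3 = s.cell 3 := BProg.run_cell (by simp [BProg.arrays]) s
  set s₂ := (BProg.setCell 3 (.idx (.reg 8) (.reg 7))
    (.sub (.res (.reg 8) (.reg 7)) (.const 1))).run N O s₁ with hs₂
  have h₂ : HasInput N n w s₂.cell s₂.reg :=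
    h₁.run (by simp [BProg.regs]) (by simp [BProg.arrays])
  have r8' : s₂.reg 8 = u := (BProg.run_reg (by simp [BProg.regs]) s₁).trans r8
  have r7' : s₂.reg 7 = cur := (BProg.run_reg (by simp [BProg.regs]) s₁).trans r7
  have c3' : s₂.cell 3 = Function.update (s.cell 3) (u * n + cur) (s.cell 3 (u * n + cur) - 1) := by
    rw [hs₂, BProg.run_setCell_cell, BExpr.eval, h₁.eval_res (by simpa [r8]), c3]
    simp [r8, r7, h₁.n_eq, min_eq_left (show u ≤ N by omega)]
  set s₃ := (BProg.setCell 3 (.idx (.reg 7) (.reg 8))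
    (.add (.res (.reg 7) (.reg 8)) (.const 1))).run N O s₂ with hs₃
  have r8'' : s₃.reg 8 = u := (BProg.run_reg (by simp [BProg.regs]) s₂).trans r8'
  have c3'' : s₃.cell 3 = Function.update (s₂.cell 3) (cur * n + u) (s₂.cell 3 (cur * n + u) + 1) := by
    rw [hs₃, BProg.run_setCell_cell, BExpr.eval, h₂.eval_res (by simpa [r7'])]
    simp [r8', r7', h₂.n_eq, min_eq_left (show cur ≤ N by omega)]
  have c3f : ((BProg.setReg 7 (.reg 8)).run N O s₃).cell 3 = s₃.cell 3 :=
    BProg.run_cell (by simp [BProg.arrays]) s₃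
  refine ⟨u, hu, hMu, hau, by simp [BProg.run_setReg_reg, r8''], ?_, ?_, ?_⟩
  · rw [State.matrix, c3f, c3'', Function.update_of_ne, c3', Function.update_self]
    · rfl
    · exact fun h' => huc (index_inj hu hcur h').1
  · rw [State.matrix, c3f, c3'', Function.update_self, c3', Function.update_of_ne]
    · rfl
    · exact fun h' => huc (index_inj hcur hu h').1.symm
  · intro x hx y hy h1 h2
    rw [State.matrix, c3f, c3'', Function.update_of_ne, c3', Function.update_of_ne]
    · rfl
    · exact fun h' => h1 (index_inj hcur hy h')
    · exact fun h' => h2 (index_inj hu hy h')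

open Classical in
/-- Walking back from `t` to a source reverses a path. -/
theorem walk_spec (h : HasInput N n w s.cell s.reg) {t : ℕ} (ht : s.reg 7 = t) (htn : t < n)
    (hage : IsAge n (s.matrix n) (fun v => s.reg 6 ≤ s.cell 1 v) N (s.cell 2))
    (hat : s.cell 2 t ≠ 0) {X : Set ℕ} (htX : t ∈ X) (hX : ∀ v < n, v ∈ X → s.cell 1 v < s.reg 6) :
    cutWeight (((BProg.walkStep.run N O)^[N] s).matrix n) (Finset.range n) X + 1 =
      cutWeight (s.matrix n) (Finset.range n) X := by
  -- Rows of vertices older than the current one are untouched, so the rest of the path is still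
  -- available. The age exceeds the number of steps until a source is reached, so `N` steps suffice.
  -- The changes of the cut telescope and leave only the indicator of the current vertex.
  have key := iterate_invariant (f := BProg.walkStep.run N O) (m := N) (a := s)
    (fun j (s' : State) => HasInput N n w s'.cell s'.reg ∧ s'.reg 6 = s.reg 6 ∧
      s'.cell 1 = s.cell 1 ∧ s'.cell 2 = s.cell 2 ∧ s'.reg 7 < n ∧ s.cell 2 (s'.reg 7) ≠ 0 ∧
      (s.reg 6 ≤ s.cell 1 (s'.reg 7) ∨ j < s.cell 2 (s'.reg 7)) ∧
      (∀ x < n, ∀ y < n, s.cell 2 (s'.reg 7) < s.cell 2 x → s'.matrix n x y = s.matrix n x y) ∧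
      cutWeight (s'.matrix n) (Finset.range n) X + 1 =
        cutWeight (s.matrix n) (Finset.range n) X + if s'.reg 7 ∈ X then 1 else 0)
    ⟨h, rfl, rfl, rfl, by rwa [ht], by rwa [ht], Or.inr (by rw [ht]; omega),
      fun _ _ _ _ _ => rfl, by rw [ht, if_pos htX]⟩ ?_
  · obtain ⟨-, -, -, -, h7, -, hj, -, hcut⟩ := key
    have hsrc : s.reg 6 ≤ s.cell 1 (((BProg.walkStep.run N O)^[N] s).reg 7) :=
      hj.resolve_right (not_lt.2 (hage.le _ h7))
    rwa [if_neg fun h' => absurd (hX _ h7 h') (not_lt.2 hsrc)] at hcut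
  · rintro j - s' ⟨h', h6, h1, h2, h7, h2', hj, hM, hcut⟩
    by_cases hsrc : s.reg 6 ≤ s.cell 1 (s'.reg 7)
    · have : BProg.walkStep.run N O s' = s' := by
        rw [BProg.walkStep, BProg.run_cond, if_neg]
        · rfl
        · simp [h6, h1, hsrc]
      rw [this]
      exact ⟨h', h6, h1, h2, h7, h2', Or.inl hsrc, hM, hcut⟩
    · obtain ⟨u₀, hu₀, hw₀, ha₀⟩ := hage.pred _ h7 h2' hsrc
      obtain ⟨u, hu, hMu, hau, e7, e1, e2, e3⟩ := walkStep_spec (O := O) h' h7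
        (by rw [h1, h6]; omega) ⟨u₀, hu₀, by rwa [hM u₀ hu₀ _ h7 ha₀], by rwa [h2]⟩
      rw [h2] at hau
      have huc : u ≠ s'.reg 7 := by
        intro h'
        rw [h'] at hau
        exact lt_irrefl _ hau
      refine ⟨h'.run (by simp [BProg.walkStep, BProg.regs]) (by simp [BProg.walkStep, BProg.arrays]),
        (BProg.run_reg (by simp [BProg.walkStep, BProg.regs]) s').trans h6,
        (BProg.run_cell (by simp [BProg.walkStep, BProg.arrays]) s').trans h1,
        (BProg.run_cell (by simp [BProg.walkStep, BProg.arrays]) s').trans h2,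
        by rwa [e7], by rw [e7]; omega, ?_, ?_, ?_⟩
      · rw [e7]
        rcases hj with hj | hj
        · exact absurd hj hsrc
        · exact Or.inr (by omega)
      · intro x hx y hy hlt
        rw [e7] at hlt
        rw [e3 x hx y hy, hM x hx y hy (by omega)]
        · rintro ⟨rfl, -⟩
          exact lt_irrefl _ hlt
        · rintro ⟨rfl, -⟩
          omega
      · rw [e7]
        have := cutWeight_flip (Finset.mem_range.2 hu) (Finset.mem_range.2 h7) huc hMu e1 e2
          (fun x hx y hy => e3 x (Finset.mem_range.1 hx) y (Finset.mem_range.1 hy)) X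
        omega

/-- Either all cuts of the window lose one unit, or there is no path left. -/
theorem augment_spec (h : HasInput N n w s.cell s.reg) (h0 : s.reg 0 = N) :
    (∀ X, InWindow n (s.cell 1) (s.reg 5) (s.reg 6) X →
      cutWeight ((BProg.augment.run N O s).matrix n) (Finset.range n) X + 1 =
        cutWeight (s.matrix n) (Finset.range n) X) ∨
    ((BProg.augment.run N O s).matrix n = s.matrix n ∧
      ∃ X, InWindow n (s.cell 1) (s.reg 5) (s.reg 6) X ∧
        cutWeight (s.matrix n) (Finset.range n) X = 0) := by
  have hN := h.n_lt
  rw [BProg.augment, BProg.run_seq, BProg.run_seq, BProg.run_cond]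
  have hage := search_spec (O := O) h h0
  set s₁ := BProg.search.run N O s with hs₁
  have h₁ : HasInput N n w s₁.cell s₁.reg :=
    h.run (by simp [BProg.search, BProg.searchStep, BProg.regs])
      (by simp [BProg.search, BProg.searchStep, BProg.arrays])
  have r₁ : s₁.reg = s.reg :=
    funext fun x => BProg.run_reg (by simp [BProg.search, BProg.searchStep, BProg.regs]) s
  have c₁ : ∀ a ≠ 2, s₁.cell a = s.cell a := fun a ha =>
    BProg.run_cell (by simpa [BProg.search, BProg.searchStep, BProg.arrays]) s
  have hfind := BExpr.eval_find (N := N) (c := s₁.cell) (r := s₁.reg) (b := .reg 1)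
    (φ := .and (.cell 2 (.reg 29)) (.lt (.pos (.reg 29)) (.reg 5)))
    (B := n) h₁.n_eq (by omega)
    (fun v => s₁.cell 2 v ≠ 0 ∧ s₁.cell 1 v < s₁.reg 5) (by
      intro i hi j hj
      simp)
  set e := BExpr.find (.reg 1) (.and (.cell 2 (.reg 29)) (.lt (.pos (.reg 29)) (.reg 5)))
  set s₂ := (BProg.setReg 7 e).run N O s₁ with hs₂
  have r7 : s₂.reg 7 = e.eval N s₁.cell s₁.reg := by simp [hs₂, BProg.run_setReg_reg]
  have r₂ : ∀ x ≠ 7, s₂.reg x = s.reg x := fun x hx =>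
    (BProg.run_reg (by simpa [BProg.regs]) s₁).trans (congrFun r₁ x)
  have c₂ : s₂.cell = s₁.cell := rfl
  have hm : s₂.matrix n = s.matrix n := by
    ext u v
    rw [State.matrix, c₂, c₁ 3 (by decide)]
    rfl
  by_cases hex : ∃ v < n, s₁.cell 2 v ≠ 0 ∧ s₁.cell 1 v < s₁.reg 5
  · obtain ⟨ht, hat, hpt⟩ := hfind.1 hex
    rw [← r7] at ht hat hpt
    rw [if_pos (by simpa [r₂ 1 (by decide), h.n_eq])]
    left
    intro X hX
    have hb : min ((BExpr.reg 0).eval N s₂.cell s₂.reg) N = N := by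
      simp [r₂ 0 (by decide), h0]
    rw [BProg.run_rep, hb, ← hm]
    refine walk_spec (h₁.run (by simp [BProg.regs]) (by simp [BProg.arrays])) rfl ht ?_ hat
      (hX.left _ ht ?_) ?_
    · rw [hm, r₂ 6 (by decide), c₂, c₁ 1 (by decide)]
      exact hage
    · rwa [← c₁ 1 (by decide), ← r₁]
    · rw [c₂, c₁ 1 (by decide), r₂ 6 (by decide)]
      exact hX.right
  · push Not at hex
    have hn := hfind.2 (fun v hv h' => absurd h'.2 (not_lt.2 (hex v hv h'.1)))
    rw [if_neg (by simp [r₂ 1 (by decide), h.n_eq, r7, hn])]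
    right
    -- No residual arc leaves the set of reached vertices, so the unreached ones form a residual cut
    -- of weight zero.
    refine ⟨hm, {v | s₁.cell 2 v = 0}, ⟨?_, ?_⟩, ?_⟩
    · intro v hv hlt
      by_contra h'
      have := hex v hv h'
      rw [c₁ 1 (by decide), r₁] at this
      omega
    · intro v hv h'
      by_contra hlt
      exact (hage.closed_of_lt (by omega)).1 v hv (not_lt.1 hlt) h'
    · refine Finset.sum_eq_zero fun u hu => Finset.sum_eq_zero fun v hv => ?_
      rw [Finset.mem_range] at hu hv
      split_ifs with h'
      · by_contra hne
        exact (hage.closed_of_lt (by omega)).2 u hu v hv h'.1 hne h'.2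
      · rfl

theorem cutWeight_le_sq (hw : ∀ u < n, ∀ v < n, w u v ≤ 1) (X : Set ℕ) :
    cutWeight w (Finset.range n) X ≤ n * n := by
  classical
  have : cutWeight w (Finset.range n) X ≤ ∑ u ∈ Finset.range n, ∑ v ∈ Finset.range n, 1 := by
    refine Finset.sum_le_sum fun u hu => Finset.sum_le_sum fun v hv => ?_
    have := hw u (Finset.mem_range.1 hu) v (Finset.mem_range.1 hv)
    split_ifs <;> omega
  simpa using this

/-- The argument of max-flow min-cut: augmentations lower the residual weights of all cuts in the
window by a common amount, so a cut with residual weight zero is a minimum cut. -/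
theorem minCut_spec (h : HasInput N n w s.cell s.reg) (h0 : s.reg 0 = N)
    (hw : ∀ u < n, ∀ v < n, w u v ≤ 1) (hlohi : s.reg 5 ≤ s.reg 6) :
    InWindow n (s.cell 1) (s.reg 5) (s.reg 6) {v | (BProg.minCut.run N O s).cell 2 v = 0} ∧
    ∀ Y, InWindow n (s.cell 1) (s.reg 5) (s.reg 6) Y →
      cutWeight w (Finset.range n) {v | (BProg.minCut.run N O s).cell 2 v = 0} ≤
        cutWeight w (Finset.range n) Y := by
  have hN := h.n_lt
  rw [BProg.minCut, BProg.run_seq, BProg.run_seq, BProg.run_rep]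
  set s₁ := BProg.run N O (.store 3 23 (.mulReg (.reg 1)) (.cell 0 (.add (.const 3) (.reg 23)))) s
    with hs₁
  have h₁ : HasInput N n w s₁.cell s₁.reg := h.run (by simp [BProg.regs]) (by simp [BProg.arrays])
  have r₁ : s₁.reg = s.reg := rfl
  have c₁ : ∀ a ≠ 3, s₁.cell a = s.cell a := fun a ha =>
    BProg.run_cell (by simpa [BProg.arrays]) s
  have m₁ : ∀ u < n, ∀ v < n, s₁.matrix n u v = w u v := by
    intro u hu v hv
    have hlt : u * n + v < n * n := by nlinarith
    have := h.le
    rw [State.matrix, hs₁, BProg.run_store_cell, BExpr.eval_mulReg, BExpr.eval, h.n_eq,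
      min_eq_left (show n ≤ N by omega), min_eq_left (show n * n ≤ N by omega), if_pos hlt]
    simp [h.adj u hu v hv]
  have hb : min ((BExpr.reg 0).eval N s₁.cell s₁.reg) N = N := by simp [r₁, h0]
  rw [hb]
  set W := InWindow n (s.cell 1) (s.reg 5) (s.reg 6) with hW
  have hcw : ∀ X, cutWeight (s₁.matrix n) (Finset.range n) X = cutWeight w (Finset.range n) X := by
    classical
    refine fun X => Finset.sum_congr rfl fun u hu => Finset.sum_congr rfl fun v hv => ?_
    rw [m₁ u (Finset.mem_range.1 hu) v (Finset.mem_range.1 hv)]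
  have hreg : ∀ x < 7, x ∉ BProg.augment.regs := by
    intro x hx
    simp only [BProg.augment, BProg.search, BProg.searchStep, BProg.walkStep, BProg.regs,
      List.append_nil, List.nil_append, List.mem_append, List.mem_singleton]
    simp
    omega
  have hcell : ∀ a < 2, a ∉ BProg.augment.arrays := by
    intro a ha
    simp only [BProg.augment, BProg.search, BProg.searchStep, BProg.walkStep, BProg.arrays]
    simp
    omega
  -- The number `m` is the value of the flow; it counts the rounds until some cut of the window is
  -- saturated.
  have key := iterate_invariant (f := BProg.augment.run N O) (m := N) (a := s₁)
    (fun j (s' : State) => HasInput N n w s'.cell s'.reg ∧ (∀ x < 7, s'.reg x = s.reg x) ∧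
      (∀ a < 2, s'.cell a = s.cell a) ∧
      ∃ m, (∀ X, W X → cutWeight (s'.matrix n) (Finset.range n) X + m =
        cutWeight w (Finset.range n) X) ∧
        (m = j ∨ ∃ X, W X ∧ cutWeight (s'.matrix n) (Finset.range n) X = 0))
    ⟨h₁, fun _ _ => rfl, fun a ha => c₁ a (by omega), 0, fun X _ => by rw [hcw, add_zero],
      Or.inl rfl⟩ ?_
  swap
  · rintro j - s' ⟨h', hr, hc, m, hm, hm'⟩
    refine ⟨h'.run (hreg 1 (by omega)) (hcell 0 (by omega)),
      fun x hx => (BProg.run_reg (hreg x hx) s').trans (hr x hx),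
      fun a ha => (BProg.run_cell (hcell a ha) s').trans (hc a ha), ?_⟩
    have ha := augment_spec (O := O) h' (by rw [hr 0 (by omega), h0])
    rw [hr 5 (by omega), hr 6 (by omega), hc 1 (by omega)] at ha
    rcases ha with ha | ⟨he, X, hX, hX0⟩
    · refine ⟨m + 1, fun X hX => ?_, ?_⟩
      · have h1 := ha X hX
        have h2 := hm X hX
        omega
      · rcases hm' with rfl | ⟨X, hX, hX0⟩
        · exact Or.inl rfl
        · have := ha X hX
          omega
    · exact ⟨m, by rwa [he], Or.inr ⟨X, hX, by rwa [he]⟩⟩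
  obtain ⟨h', hr, hc, m, hm, hm'⟩ := key
  set s₂ := (BProg.augment.run N O)^[N] s₁
  have hage := search_spec (O := O) h' (by rw [hr 0 (by omega), h0])
  rw [hr 6 (by omega), hc 1 (by omega)] at hage
  set a := (BProg.search.run N O s₂).cell 2
  obtain ⟨hcl1, hcl2⟩ := hage.closed_of_lt (by omega)
  -- A flow of value `N` is impossible, because no cut has weight more than `n * n`, which is less
  -- than `N`.
  have hX₀ : ∃ X, W X ∧ cutWeight (s₂.matrix n) (Finset.range n) X = 0 := by
    refine hm'.resolve_left fun hmN => ?_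
    have h1 := hm {v | s.cell 1 v < s.reg 5} ⟨fun v _ h => h, fun v _ h => lt_of_lt_of_le h hlohi⟩
    have h2 := cutWeight_le_sq hw {v | s.cell 1 v < s.reg 5}
    have := h.le
    omega
  obtain ⟨X₀, hX₀W, hX₀⟩ := hX₀
  -- Induction from the oldest vertices on. A reached vertex in `X₀` is not a source, so it has an
  -- older predecessor, which is outside `X₀` by induction; the residual arc between them would
  -- enter `X₀`.
  have hreach : ∀ d, ∀ v < n, N - a v ≤ d → a v ≠ 0 → v ∉ X₀ := by
    intro d
    induction d with
    | zero =>
      intro v hv hd h1 h2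
      have hsrc : ¬ s.reg 6 ≤ s.cell 1 v := not_le.2 (hX₀W.right v hv h2)
      obtain ⟨u, hu, hwu, hau⟩ := hage.pred v hv h1 hsrc
      have := hage.le u hu
      omega
    | succ d ih =>
      intro v hv hd h1 h2
      have hsrc : ¬ s.reg 6 ≤ s.cell 1 v := not_le.2 (hX₀W.right v hv h2)
      obtain ⟨u, hu, hwu, hau⟩ := hage.pred v hv h1 hsrc
      have h3 := hage.le u hu
      have h4 := ih u hu (by omega) (by omega)
      have h5 := le_cutWeight (w := s₂.matrix n) (Finset.mem_range.2 hu) (Finset.mem_range.2 hv)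
        h4 h2
      omega
  have hXW : W {v | a v = 0} := by
    refine ⟨fun v hv hlt => ?_, fun v hv h1 => ?_⟩
    · by_contra h1
      exact hreach _ v hv le_rfl h1 (hX₀W.left v hv hlt)
    · by_contra hlt
      exact hcl1 v hv (not_lt.1 hlt) h1
  refine ⟨hXW, fun Y hY => ?_⟩
  have hz : cutWeight (s₂.matrix n) (Finset.range n) {v | a v = 0} = 0 := by
    refine Finset.sum_eq_zero fun u hu => Finset.sum_eq_zero fun v hv => ?_
    rw [Finset.mem_range] at hu hv
    split_ifs with h'
    · by_contra hne
      exact hcl2 u hu v hv h'.1 hne h'.2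
    · rfl
  have h1 := hm _ hXW
  have h2 := hm Y hY
  omega

end Specifications

/-! ### Improving an ordering until it is lean. -/

section Specifications

variable {N n m r : ℕ} {w : ℕ → ℕ → ℕ} {O : Oracle} {s : State}

/-- Array `1` holds an ordering of width at most `m`. -/
structure HasOrdering (N n m r : ℕ) (w : ℕ → ℕ → ℕ) (s : State) : Prop where
  input : HasInput N n w s.cell s.reg
  bound : s.reg 0 = N
  radius : s.reg 3 = r
  ordering : IsOrdering n (s.cell 1)
  width : ∀ v < n, cutWeight w (Finset.range n) {u | s.cell 1 u ≤ s.cell 1 v} ≤ m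

theorem totalCut_congr {f g : ℕ → ℕ} (h : ∀ v < n, f v = g v) :
    totalCut w n f = totalCut w n g := by
  refine Finset.sum_congr rfl fun v hv => cutWeight_congr fun u hu => ?_
  rw [Finset.mem_range] at hu hv
  simp [h u hu, h v hv]

theorem smallPrefixes_spec (h : HasInput N n w s.cell s.reg) :
    BProg.smallPrefixes.eval N s.cell s.reg = 0 ↔
      ∀ j ≤ n, s.reg 5 ≤ j → j ≤ s.reg 6 →
        cutWeight w (Finset.range n) {v | s.cell 2 v = 0} < prefixCut w n (s.cell 1) j := by
  have hN := h.n_lt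
  rw [BProg.smallPrefixes, BExpr.eval, BExpr.eval, BExpr.eval, BExpr.eval, h.n_eq,
    min_eq_left (show n + 1 ≤ N by omega), Finset.sum_eq_zero_iff]
  refine forall_congr' fun j => ?_
  rw [Finset.mem_range, Nat.lt_succ_iff]
  refine imp_congr_right fun hj => ?_
  have h' := h.update (show 22 ≠ 1 by decide) j
  rw [BExpr.eval_and, BExpr.eval_and, BExpr.eval_le, BExpr.eval_le, BExpr.eval_le,
    h'.eval_cut (J := j) (by simp), h'.eval_arcs (X := {v | s.cell 2 v = 0}) (by simp) (by simp)]
  simp only [BExpr.eval, Function.update_self, Function.update_of_ne (show 5 ≠ 22 by decide),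
    Function.update_of_ne (show 6 ≠ 22 by decide)]
  split_ifs <;> simp_all

/-- Leanness at a position can be tested on one minimum cut of the window: either some prefix in the
window is at most this cut, or moving the cut to the front is an improvement. -/
theorem improve_spec (hw : ∀ u < n, ∀ v < n, w u v ≤ 1) (h : HasOrdering N n m r w s)
    (hk : s.reg 4 ≤ n) :
    HasOrdering N n m r w (BProg.improve.run N O s) ∧
    (BProg.improve.run N O s).reg 4 = s.reg 4 + 1 ∧
    ((IsLeanAt w n (s.cell 1) r (s.reg 4) ∧ (BProg.improve.run N O s).cell 1 = s.cell 1) ∨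
      (¬ IsLeanAt w n (s.cell 1) r (s.reg 4) ∧
        totalCut w n ((BProg.improve.run N O s).cell 1) < totalCut w n (s.cell 1))) := by
  have hframe : ∀ x < 4, (BProg.improve.run N O s).reg x = s.reg x := by
    intro x hx
    refine BProg.run_reg ?_ s
    interval_cases x <;> decide
  have hinput : HasInput N n w (BProg.improve.run N O s).cell (BProg.improve.run N O s).reg :=
    h.input.run (by decide) (by decide)
  suffices hsuff : IsOrdering n ((BProg.improve.run N O s).cell 1) ∧
      (∀ v < n, cutWeight w (Finset.range n) {u | (BProg.improve.run N O s).cell 1 u ≤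
        (BProg.improve.run N O s).cell 1 v} ≤ m) ∧
      (BProg.improve.run N O s).reg 4 = s.reg 4 + 1 ∧
      ((IsLeanAt w n (s.cell 1) r (s.reg 4) ∧ (BProg.improve.run N O s).cell 1 = s.cell 1) ∨
      (¬ IsLeanAt w n (s.cell 1) r (s.reg 4) ∧
        totalCut w n ((BProg.improve.run N O s).cell 1) < totalCut w n (s.cell 1))) by
    exact ⟨⟨hinput, (hframe 0 (by omega)).trans h.bound, (hframe 3 (by omega)).trans h.radius,
      hsuff.1, hsuff.2.1⟩, hsuff.2.2⟩
  clear hframe hinput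
  rw [BProg.improve, BProg.run_seq, BProg.run_seq, BProg.run_seq, BProg.run_seq]
  set s₂ := (BProg.setReg 6 (.add (.reg 4) (.reg 3))).run N O
    ((BProg.setReg 5 (.sub (.reg 4) (.reg 3))).run N O s) with hs₂
  have h₂ : HasInput N n w s₂.cell s₂.reg := (h.input.run (by decide) (by decide)).run
    (by decide) (by decide)
  have c₂ : s₂.cell = s.cell := rfl
  have r0 : s₂.reg 0 = N := h.bound
  have r4 : s₂.reg 4 = s.reg 4 := rfl
  have r5 : s₂.reg 5 = s.reg 4 - r := by
    rw [← h.radius]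
    rfl
  have r6 : s₂.reg 6 = s.reg 4 + r := by
    rw [← h.radius]
    rfl
  obtain ⟨hXw, hXmin⟩ := minCut_spec (O := O) h₂ r0 hw (by omega)
  set s₃ := BProg.minCut.run N O s₂ with hs₃
  have h₃ : HasInput N n w s₃.cell s₃.reg := h₂.run (by decide) (by decide)
  have c1 : s₃.cell 1 = s.cell 1 := by
    rw [← c₂]
    exact BProg.run_cell (by decide) s₂
  have r4' : s₃.reg 4 = s.reg 4 := by
    rw [← r4]
    exact BProg.run_reg (by decide) s₂
  have r5' : s₃.reg 5 = s.reg 4 - r := by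
    rw [← r5]
    exact BProg.run_reg (by decide) s₂
  have r6' : s₃.reg 6 = s.reg 4 + r := by
    rw [← r6]
    exact BProg.run_reg (by decide) s₂
  set X : Set ℕ := {v | s₃.cell 2 v = 0} with hX
  rw [c₂, r5, r6] at hXw hXmin
  have hsp := smallPrefixes_spec h₃
  rw [r5', r6', c1, ← hX] at hsp
  have hlast : ∀ s' : State, ((BProg.setReg 4 (.add (.reg 4) (.const 1))).run N O s').cell =
    s'.cell := fun _ => rfl
  have hlast' : ∀ s' : State, ((BProg.setReg 4 (.add (.reg 4) (.const 1))).run N O s').reg 4 =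
    s'.reg 4 + 1 := fun _ => rfl
  rw [hlast, hlast', BProg.run_cond]
  by_cases hsm : BProg.smallPrefixes.eval N s₃.cell s₃.reg = 0
  · rw [if_neg (not_not.2 hsm), BProg.run_seq]
    have hviol := hsp.1 hsm
    set s₄ := BProg.run N O (.store 4 23 (.reg 1)
        (.ite (.cell 2 (.reg 23)) (.add (.reg 1) (.pos (.reg 23))) (.pos (.reg 23)))) s₃ with hs₄
    have h₄ : HasInput N n w s₄.cell s₄.reg := h₃.run (by decide) (by decide)
    have hN := h₄.n_lt
    have hrank : ∀ v < n, (BProg.rankVertices.run N O s₄).cell 1 v =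
        rank (Finset.range n) (s₄.cell 4) v := fun v hv => rankVertices_spec h₄ hv
    have hf : ∀ v < n, s₄.cell 4 v = if v ∈ X then s.cell 1 v else n + s.cell 1 v := by
      intro v hv
      rw [hs₄, BProg.run_store_cell, BExpr.eval, h₃.n_eq, if_pos (by omega), BExpr.eval]
      by_cases hv' : s₃.cell 2 v = 0
      · simp [hX, hv', c1]
      · simp [hX, hv', c1, h₃.n_eq]
    have hfX : ∀ v < n, v ∈ X → s₄.cell 4 v = s.cell 1 v := fun v hv hvX => by
      rw [hf v hv, if_pos hvX]
    have hfX' : ∀ v < n, v ∉ X → s₄.cell 4 v = n + s.cell 1 v := fun v hv hvX => by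
      rw [hf v hv, if_neg hvX]
    have hinj : ∀ u < n, ∀ v < n, s₄.cell 4 u = s₄.cell 4 v → u = v := by
      intro u hu v hv huv
      have h1 := h.ordering.lt u hu
      have h2 := h.ordering.lt v hv
      rw [hf u hu, hf v hv] at huv
      refine h.ordering.inj u hu v hv ?_
      split_ifs at huv <;> omega
    have hord := isOrdering_rank hinj
    have hle : ∀ v < n, cutWeight w (Finset.range n) {u |
        (BProg.rankVertices.run N O s₄).cell 1 u ≤ (BProg.rankVertices.run N O s₄).cell 1 v} ≤
        cutWeight w (Finset.range n) {u | s.cell 1 u ≤ s.cell 1 v} := by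
      intro v hv
      refine le_trans (le_of_eq ?_) (h.ordering.cutWeight_moveToFront_le hXw hXmin hfX hfX' hv)
      rw [← cutWeight_rank (s₄.cell 4) hv]
      refine cutWeight_congr fun u hu => ?_
      simp only [Set.mem_ofPred_eq, hrank u (Finset.mem_range.1 hu), hrank v hv]
    refine ⟨⟨fun v hv => ?_, fun u hu v hv huv => ?_⟩, fun v hv => (hle v hv).trans (h.width v hv),
      ?_, Or.inr ⟨fun hlean => ?_, ?_⟩⟩
    · rw [hrank v hv]
      exact hord.lt v hv
    · rw [hrank u hu, hrank v hv] at huv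
      exact hord.inj u hu v hv huv
    · rw [← r4', BProg.run_reg (by decide)]
      rfl
    · obtain ⟨j, hj, h1, h2, h3⟩ := hlean X hXw
      exact absurd (hviol j hj h1 h2) (not_lt.2 h3)
    · rw [totalCut_congr hrank, totalCut_rank]
      exact h.ordering.totalCut_moveToFront_lt hXw hXmin hfX hfX' (by omega) (by omega) hviol
  · rw [if_pos hsm]
    have hskip : (BProg.skip.run N O s₃) = s₃ := rfl
    rw [hskip, c1]
    refine ⟨h.ordering, h.width, by rw [r4'], Or.inl ⟨fun Y hY => ?_, rfl⟩⟩
    have hex := hsp.not.1 hsm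
    push Not at hex
    obtain ⟨j, hj, h1, h2, h3⟩ := hex
    exact ⟨j, hj, h1, h2, h3.trans (hXmin Y hY)⟩

/-- Until the first improvement the ordering is unchanged, so the tests at all positions refer to
the same ordering. After it the total remains below its initial value. -/
theorem improveAll_spec (hw : ∀ u < n, ∀ v < n, w u v ≤ 1) (h : HasOrdering N n m r w s) :
    HasOrdering N n m r w (BProg.improveAll.run N O s) ∧
    (((∀ k ≤ n, IsLeanAt w n (s.cell 1) r k) ∧ (BProg.improveAll.run N O s).cell 1 = s.cell 1) ∨
      ((∃ k ≤ n, ¬ IsLeanAt w n (s.cell 1) r k) ∧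
        totalCut w n ((BProg.improveAll.run N O s).cell 1) < totalCut w n (s.cell 1))) := by
  have hN := h.input.n_lt
  rw [BProg.improveAll, BProg.run_seq, BProg.run_rep]
  set s₁ := (BProg.setReg 4 (.const 0)).run N O s with hs₁
  have h₁ : HasOrdering N n m r w s₁ :=
    ⟨h.input.run (by decide) (by decide), h.bound, h.radius, h.ordering, h.width⟩
  have hb : min ((BExpr.add (.reg 1) (.const 1)).eval N s₁.cell s₁.reg) N = n + 1 := by
    rw [BExpr.eval, BExpr.eval, BExpr.eval, h₁.input.n_eq]
    omega
  rw [hb]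
  have key := iterate_invariant (f := BProg.improve.run N O) (m := n + 1) (a := s₁)
    (fun j (s' : State) => HasOrdering N n m r w s' ∧ s'.reg 4 = j ∧
      (((∀ k < j, IsLeanAt w n (s.cell 1) r k) ∧ s'.cell 1 = s.cell 1) ∨
      ((∃ k ≤ n, ¬ IsLeanAt w n (s.cell 1) r k) ∧
        totalCut w n (s'.cell 1) < totalCut w n (s.cell 1))))
    ⟨h₁, rfl, Or.inl ⟨fun k hk => absurd hk (Nat.not_lt_zero k), rfl⟩⟩ ?_
  · obtain ⟨h', -, hc⟩ := key
    refine ⟨h', hc.imp_left fun h'' => ⟨fun k hk => h''.1 k (by omega), h''.2⟩⟩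
  · rintro j hj s' ⟨h', h4, hc⟩
    obtain ⟨h1, h2, h3⟩ := improve_spec (O := O) hw h' (by omega)
    rw [h4] at h2 h3
    refine ⟨h1, h2, ?_⟩
    rcases hc with ⟨hc, he⟩ | ⟨hc, hlt⟩
    · rw [he] at h3
      rcases h3 with ⟨h3, h4⟩ | ⟨h3, h4⟩
      · refine Or.inl ⟨fun k hk => ?_, h4⟩
        rcases Nat.lt_succ_iff_lt_or_eq.1 hk with hk | rfl
        · exact hc k hk
        · exact h3
      · exact Or.inr ⟨⟨j, by omega, h3⟩, h4⟩
    · refine Or.inr ⟨hc, ?_⟩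
      rcases h3 with ⟨h3, h4⟩ | ⟨h3, h4⟩
      · rwa [h4]
      · exact h4.trans hlt

/-- Every sweep over an ordering that is not lean lowers the total of the cuts. The total is at most
`n * (n * n)`, which is less than `N * N`; two nested loops provide this many sweeps. -/
theorem makeLean_spec (hw : ∀ u < n, ∀ v < n, w u v ≤ 1) (h : HasOrdering N n m r w s) :
    HasOrdering N n m r w (BProg.makeLean.run N O s) ∧
      ∀ k ≤ n, IsLeanAt w n ((BProg.makeLean.run N O s).cell 1) r k := by
  have hb : ∀ s' : State, s'.reg 0 = N → min ((BExpr.reg 0).eval N s'.cell s'.reg) N = N := by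
    intro s' h'
    simp [h']
  have hit : ∀ s' : State, s'.reg 0 = N → (BProg.rep (.reg 0) BProg.improveAll).run N O s' =
      (BProg.improveAll.run N O)^[N] s' := fun s' h' => by
    rw [BProg.run_rep, hb s' h']
  set I : ℕ → State → Prop := fun j s' => HasOrdering N n m r w s' ∧
      ((∀ k ≤ n, IsLeanAt w n (s'.cell 1) r k) ∨
        totalCut w n (s'.cell 1) + j ≤ totalCut w n (s.cell 1)) with hI
  have hstep : ∀ j s', I j s' → I (j + 1) (BProg.improveAll.run N O s') := by
    rintro j s' ⟨h', hc⟩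
    obtain ⟨h1, h2⟩ := improveAll_spec (O := O) hw h'
    refine ⟨h1, ?_⟩
    rcases h2 with ⟨h2, h3⟩ | ⟨⟨k, hk, h2⟩, h3⟩
    · exact Or.inl (by rwa [h3])
    · rcases hc with hc | hc
      · exact absurd (hc k hk) h2
      · exact Or.inr (by omega)
  rw [BProg.makeLean, BProg.run_rep, hb s h.bound]
  have key := iterate_invariant (f := (BProg.rep (.reg 0) BProg.improveAll).run N O) (m := N)
    (a := s) (fun j (s' : State) => I (j * N) s') ⟨h, Or.inr (by omega)⟩ ?_
  · refine ⟨key.1, key.2.resolve_right fun hle => ?_⟩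
    have h1 : totalCut w n (s.cell 1) ≤ ∑ v ∈ Finset.range n, n * n :=
      Finset.sum_le_sum fun v _ => cutWeight_le_sq hw _
    simp only [Finset.sum_const, Finset.card_range, smul_eq_mul] at h1
    have h2 := h.input.le
    have h3 := h.input.n_lt
    have h4 : n * (n * n) < N * N :=
      Nat.mul_lt_mul_of_lt_of_le (by omega) (by omega) (by omega)
    omega
  · intro j _ s' hs'
    rw [hit s' hs'.1.bound, Nat.succ_mul]
    exact iterate_invariant (fun i (s' : State) => I (j * N + i) s') hs' fun i _ s'' h'' =>
      hstep (j * N + i) s'' h''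

end Specifications

/-! ## Cutwidth and layouts -/

section Cutwidth

variable {V : Type*} [Fintype V] {D : Digraph V} {ι : V → ℕ} {w : ℕ → ℕ → ℕ} {S : Finset ℕ} {c : ℕ}

theorem ctw_le_iff : ctw D ≤ c ↔ ∃ π, width D π ≤ c := by
  constructor
  · intro h
    have hne : (Set.range (width D)).Nonempty := ⟨_, Fintype.equivFin V, rfl⟩
    obtain ⟨π, hπ⟩ := Nat.sInf_mem hne
    exact ⟨π, by rw [hπ]; exact h⟩
  · rintro ⟨π, hπ⟩
    exact (Nat.sInf_le (s := Set.range (width D)) (Set.mem_range_self π)).trans hπ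

open Classical in
theorem ncard_eq_cutWeight (hι : Function.Injective ι) (hS : S = Finset.univ.image ι)
    (hw : ∀ a b, w (ι a) (ι b) = if D.Adj a b then 1 else 0) (X : Set ℕ) :
    {p : V × V | D.Adj p.1 p.2 ∧ ι p.1 ∉ X ∧ ι p.2 ∈ X}.ncard = cutWeight w S X := by
  rw [Set.ncard_eq_toFinset_card', cutWeight, hS, Finset.sum_image fun a _ b _ h => hι h]
  simp only [Finset.sum_image fun a _ b _ h => hι h]
  rw [← Finset.sum_product', Finset.univ_product_univ]
  have : ({p : V × V | D.Adj p.1 p.2 ∧ ι p.1 ∉ X ∧ ι p.2 ∈ X} : Set (V × V)).toFinset =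
      Finset.univ.filter fun p : V × V => D.Adj p.1 p.2 ∧ ι p.1 ∉ X ∧ ι p.2 ∈ X := by
    ext p
    simp
  rw [this, Finset.card_filter]
  refine Finset.sum_congr rfl fun p _ => ?_
  rw [hw]
  split_ifs <;> simp_all

/-- Replacing the numbers by ranks keeps the family of prefixes and makes the values consecutive, as
a `VertexOrdering` requires. -/
theorem IsLayout.rank {f : ℕ → ℕ} (h : IsLayout w S c f) : IsLayout w S c (rank S f) := by
  refine ⟨fun u hu v hv huv => ?_, fun i => ?_⟩
  · have h1 := (rank_lt_iff (f := f) hu hv).not.1 huv.not_lt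
    have h2 := (rank_lt_iff (f := f) hv hu).not.1 huv.symm.not_lt
    exact h.injOn hu hv (by omega)
  · by_cases hne : ∃ v ∈ S, CutKernel.rank S f v < i
    · obtain ⟨z, hz, hmax⟩ := Finset.exists_max_image (S.filter (CutKernel.rank S f · < i))
        (CutKernel.rank S f) (by
          obtain ⟨v, hv, hvi⟩ := hne
          exact ⟨v, by simp [hv, hvi]⟩)
      simp only [Finset.mem_filter, and_imp] at hz hmax
      refine le_trans (le_of_eq (cutWeight_congr fun v hv => ?_)) (h.cut_le (f z + 1))
      simp only [Set.mem_ofPred_eq, Nat.lt_succ_iff]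
      have h1 := rank_lt_iff (f := f) hz.1 hv
      have h2 := hmax v hv
      omega
    · push Not at hne
      rw [cutWeight_eq_zero (fun v hv => by simpa using hne v hv)]
      exact Nat.zero_le _

/-- Cutwidth in terms of layouts of a set of natural numbers. -/
theorem ctw_le_iff_exists_isLayout (hι : Function.Injective ι) (hS : ∀ x, x ∈ S ↔ ∃ a, ι a = x)
    (hw : ∀ a b, D.Adj a b → w (ι a) (ι b) = 1) (hw' : ∀ a b, ¬ D.Adj a b → w (ι a) (ι b) = 0) :
    ctw D ≤ c ↔ ∃ f, IsLayout w S c f := by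
  classical
  have hS' : S = Finset.univ.image ι := by
    ext x
    simp [hS]
  have hww : ∀ a b, w (ι a) (ι b) = if D.Adj a b then 1 else 0 := by
    intro a b
    split_ifs with h
    · exact hw a b h
    · exact hw' a b h
  have hcut : ∀ (π : VertexOrdering V) (f : ℕ → ℕ), (∀ a, f (ι a) = π a) → ∀ i,
      cutSize D π i = cutWeight w S {x | f x < i} := by
    intro π f hf i
    rw [← ncard_eq_cutWeight hι hS' hww, cutSize]
    simp [hf]
  rw [ctw_le_iff]
  constructor
  · rintro ⟨π, hπ⟩
    set f : ℕ → ℕ := Function.extend ι (fun a => (π a : ℕ)) 0 with hf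
    have hfι : ∀ a, f (ι a) = π a := fun a => hι.extend_apply _ _ a
    refine ⟨f, ⟨?_, fun i => ?_⟩⟩
    · intro x hx y hy hxy
      obtain ⟨a, rfl⟩ := (hS x).1 hx
      obtain ⟨b, rfl⟩ := (hS y).1 hy
      rw [hfι, hfι] at hxy
      rw [π.injective (Fin.ext hxy)]
    · by_cases hi : i < Fintype.card V + 1
      · rw [← hcut π f hfι]
        exact (Finset.le_sup (f := cutSize D π) (Finset.mem_range.2 hi)).trans hπ
      · rw [cutWeight_eq_zero' fun v hv => ?_]
        · exact Nat.zero_le _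
        · obtain ⟨a, rfl⟩ := (hS v).1 hv
          have := (π a).isLt
          simp only [Set.mem_ofPred_eq, hfι]
          omega
  · rintro ⟨f, hf⟩
    have hmem : ∀ a, ι a ∈ S := fun a => (hS _).2 ⟨a, rfl⟩
    have hlt : ∀ a, rank S f (ι a) < Fintype.card V := by
      intro a
      have hcard : S.card = Fintype.card V := by
        rw [hS', Finset.card_image_of_injective _ hι, Finset.card_univ]
      rw [← hcard]
      exact Finset.card_lt_card (Finset.filter_ssubset.2 ⟨ι a, hmem a, by simp⟩)
    have hbij : Function.Bijective fun a => (⟨rank S f (ι a), hlt a⟩ : Fin (Fintype.card V)) := by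
      rw [Fintype.bijective_iff_injective_and_card]
      refine ⟨fun a b hab => ?_, by simp⟩
      exact hι (hf.rank.injOn (hmem a) (hmem b) (Fin.mk.inj hab))
    refine ⟨Equiv.ofBijective _ hbij, Finset.sup_le fun i _ => ?_⟩
    rw [hcut _ (rank S f) (fun a => rfl)]
    exact hf.rank.cut_le i

end Cutwidth

/-! ## The program that computes the bags -/

namespace BExpr

/-- The test whether the cut at the position in register `x` is a local minimum. -/
def isMin (x : ℕ) : BExpr :=
  .not (.sum 22 (.add (.reg 1) (.const 1)) (.and (.le (.sub (.reg x) (.reg 3)) (.reg 22))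
    (.and (.le (.reg 22) (.add (.reg x) (.reg 3))) (.lt (.cut (.reg 22)) (.cut (.reg x))))))

/-- The number of bags. -/
def numBags : BExpr :=
  .sum 26 (.add (.reg 1) (.const 1)) (.and (.lt (.const 0) (.reg 26)) (.isMin 26))

/-- The number of positions whose cut is larger than twice the content of register `2`. -/
def wide : BExpr :=
  .sum 22 (.add (.reg 1) (.const 1)) (.lt (.add (.reg 2) (.reg 2)) (.cut (.reg 22)))

/-- The left end of the current window. -/
def left : BExpr := .sub (.reg 9) (.reg 3)

/-- The right end of the current window. -/
def right : BExpr := .add (.reg 4) (.reg 3)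

end BExpr

namespace BProg

/-- Stores the bag of the current window in array `5`. -/
def storeBag : BProg :=
  .store 5 23 (.reg 1) (.ite
    (.add (.and (.le .left (.pos (.reg 23))) (.lt (.pos (.reg 23)) .right))
    (.add (.and (.lt (.pos (.reg 23)) .left)
        (.sum 24 (.reg 1) (.and (.adj (.reg 24) (.reg 23)) (.le .left (.pos (.reg 24))))))
      (.and (.le .right (.pos (.reg 23)))
        (.sum 24 (.reg 1) (.and (.adj (.reg 23) (.reg 24)) (.lt (.pos (.reg 24)) .right))))))
    (.const 1) (.const 0))

/-- Runs `p` for the values `0, …, b - 1` of register `x`. -/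
def forEach (x : ℕ) (b : BExpr) (p : BProg) : BProg :=
  .seq (.setReg x (.const 0)) (.rep b (.seq p (.setReg x (.add (.reg x) (.const 1)))))

/-- Runs `p` for all bags. -/
def eachBag (p : BProg) : BProg :=
  .seq (.setReg 9 (.const 0)) (.forEach 4 (.add (.reg 1) (.const 1))
    (.cond (.and (.lt (.const 0) (.reg 4)) (.isMin 4))
      (.seq storeBag (.seq p (.setReg 9 (.reg 4)))) .skip))

/-- Reads the input and sorts the vertices. -/
def setup : BProg :=
  .seq (.setReg 1 (.cell 0 (.const 0))) <| .seq (.setReg 2 (.cell 0 (.const 2))) <|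
  -- The radius `6 * c` is twice the sum of the widths `2 * c` and `c`.
  .seq (.setReg 3 (.add (.add (.add (.reg 2) (.reg 2)) (.add (.reg 2) (.reg 2)))
    (.add (.reg 2) (.reg 2)))) <|
  .seq degreeKeys rankVertices

/-- The common part of the kernelization programs: `fail` is run if the cutwidth is found to be too
large, otherwise `start`, then `p` for all bags, then `finish`. -/
def kernel (fail start p finish : BProg) : BProg :=
  .seq setup (.cond (.add (.cell 0 (.const 1)) .wide) fail
    (.seq makeLean (.seq start (.seq (eachBag p) finish))))

end BProg

/-! ### Enumeration of the bags. -/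

section Specifications

variable {N n c r : ℕ} {w : ℕ → ℕ → ℕ} {O : Oracle} {s : State} {pos : ℕ → ℕ}

/-- The invariant must not depend on the loop register; the step may use that this register holds
the index. -/
theorem run_forEach {x B : ℕ} {b : BExpr} {p : BProg} (I : ℕ → State → Prop) (hx : x ∉ p.regs)
    (hb : b.eval N s.cell (Function.update s.reg x 0) = B) (hB : B ≤ N)
    (hI : ∀ i s' v, I i s' → I i { s' with reg := Function.update s'.reg x v }) (h0 : I 0 s)
    (hs : ∀ i < B, ∀ s', s'.reg x = i → I i s' → I (i + 1) (p.run N O s')) :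
    I B ((BProg.forEach x b p).run N O s) := by
  rw [BProg.forEach, BProg.run_seq, BProg.run_rep]
  have hb' : min (b.eval N ((BProg.setReg x (.const 0)).run N O s).cell
      ((BProg.setReg x (.const 0)).run N O s).reg) N = B := by
    rw [BProg.run_setReg_reg, BExpr.eval]
    exact (congrArg (min · N) hb).trans (min_eq_left hB)
  rw [hb']
  refine (iterate_invariant (fun i (s' : State) => s'.reg x = i ∧ I i s') ⟨?_, hI _ _ _ h0⟩ ?_).2
  · exact Function.update_self ..
  · rintro i hi s' ⟨h1, h2⟩
    rw [BProg.run_seq]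
    refine ⟨?_, hI _ _ _ (hs i hi s' h1 h2)⟩
    simp [BProg.run_setReg_reg, BProg.run_reg hx, h1]

/-- The state contains the input, the ordering `pos`, the target width and the radius. -/
structure IsContext (N n c : ℕ) (w : ℕ → ℕ → ℕ) (pos : ℕ → ℕ) (s : State) : Prop where
  input : HasInput N n w s.cell s.reg
  bound : s.reg 0 = N
  target : s.reg 2 = c
  radius : s.reg 3 = 6 * c
  pos_eq : s.cell 1 = pos

theorem IsContext.run (h : IsContext N n c w pos s) {p : BProg} (h0 : 0 ∉ p.regs) (h1 : 1 ∉ p.regs)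
    (h2 : 2 ∉ p.regs) (h3 : 3 ∉ p.regs) (h0' : 0 ∉ p.arrays) (h1' : 1 ∉ p.arrays) :
    IsContext N n c w pos (p.run N O s) where
  input := h.input.run h1 h0'
  bound := (BProg.run_reg h0 s).trans h.bound
  target := (BProg.run_reg h2 s).trans h.target
  radius := (BProg.run_reg h3 s).trans h.radius
  pos_eq := (BProg.run_cell h1' s).trans h.pos_eq

theorem BExpr.eval_and_eq_zero {C : ℕ → ℕ → ℕ} {R : ℕ → ℕ} {e f : BExpr} :
    (BExpr.and e f).eval N C R = 0 ↔ ¬ (e.eval N C R ≠ 0 ∧ f.eval N C R ≠ 0) := by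
  rw [BExpr.eval_and]
  split_ifs with he <;> simp [he]

theorem BExpr.eval_le_eq_zero {C : ℕ → ℕ → ℕ} {R : ℕ → ℕ} {e f : BExpr} :
    (BExpr.le e f).eval N C R = 0 ↔ ¬ e.eval N C R ≤ f.eval N C R := by
  rw [BExpr.eval_le]
  split_ifs with he <;> simp [he]

theorem BExpr.eval_lt_eq_zero {C : ℕ → ℕ → ℕ} {R : ℕ → ℕ} {e f : BExpr} :
    (BExpr.lt e f).eval N C R = 0 ↔ ¬ e.eval N C R < f.eval N C R := by
  rw [BExpr.eval.eq_6]
  split_ifs with he <;> simp [he]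

theorem isMin_spec {C : ℕ → ℕ → ℕ} {R : ℕ → ℕ} (h : HasInput N n w C R) {x : ℕ} (h20 : x ≠ 20)
    (h21 : x ≠ 21) (h22 : x ≠ 22) :
    (BExpr.isMin x).eval N C R ≠ 0 ↔ IsLocalMin w n (C 1) (R 3) (R x) := by
  have hN := h.n_lt
  rw [BExpr.isMin, BExpr.eval_not, ne_eq, ite_eq_right_iff, Classical.not_imp, BExpr.eval,
    BExpr.eval, BExpr.eval, BExpr.eval, h.n_eq, min_eq_left (show n + 1 ≤ N by omega),
    Finset.sum_eq_zero_iff]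
  simp only [one_ne_zero, not_false_eq_true, and_true]
  refine forall_congr' fun j => ?_
  rw [Finset.mem_range, Nat.lt_succ_iff]
  refine imp_congr_right fun hj => ?_
  have h' := h.update (show 22 ≠ 1 by decide) j
  rw [BExpr.eval_and, BExpr.eval_and, BExpr.eval_le, BExpr.eval_le, BExpr.eval.eq_6,
    h'.eval_cut (j := .reg 22) (J := j) (by simp),
    h'.eval_cut (j := .reg x) (J := R x) (by simp [h20, h21, h22])]
  simp only [BExpr.eval, Function.update_self, Function.update_of_ne (show 3 ≠ 22 by decide),
    Function.update_of_ne h22]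
  split_ifs <;> simp_all

open Classical in
theorem storeBag_spec (h : HasInput N n w s.cell s.reg) {v : ℕ} (hv : v < n) :
    (BProg.storeBag.run N O s).cell 5 v =
      if v ∈ bag w n (s.cell 1) (s.reg 9 - s.reg 3) (s.reg 4 + s.reg 3) then 1 else 0 := by
  have hN := h.n_lt
  rw [BProg.storeBag, BProg.run_store_cell, BExpr.eval, h.n_eq, if_pos (by omega), BExpr.eval]
  refine if_congr ?_ rfl rfl
  have h' := h.update (show 23 ≠ 1 by decide) v
  have hsum : ∀ φ : BExpr, (BExpr.sum 24 (.reg 1) φ).eval N s.cell (Function.update s.reg 23 v) = 0 ↔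
      ∀ u < n, φ.eval N s.cell (Function.update (Function.update s.reg 23 v) 24 u) = 0 := by
    intro φ
    rw [BExpr.eval, BExpr.eval, h'.n_eq, min_eq_left (show n ≤ N by omega),
      Finset.sum_eq_zero_iff]
    simp only [Finset.mem_range]
  have hadj : ∀ u < n, (BExpr.adj (.reg 24) (.reg 23)).eval N s.cell
      (Function.update (Function.update s.reg 23 v) 24 u) = w u v ∧
      (BExpr.adj (.reg 23) (.reg 24)).eval N s.cell
      (Function.update (Function.update s.reg 23 v) 24 u) = w v u := by
    intro u hu
    have h'' := h'.update (show 24 ≠ 1 by decide) u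
    rw [h''.eval_adj (by simpa) (by simpa), h''.eval_adj (by simpa) (by simpa)]
    simp
  have e1 : (BExpr.sum 24 (.reg 1) (.and (.adj (.reg 24) (.reg 23)) (.le .left (.pos (.reg 24))))).eval
      N s.cell (Function.update s.reg 23 v) = 0 ↔
      ¬ ∃ u < n, w u v ≠ 0 ∧ s.reg 9 - s.reg 3 ≤ s.cell 1 u := by
    rw [hsum]
    push Not
    refine forall₂_congr fun u hu => ?_
    rw [BExpr.eval_and, (hadj u hu).1]
    simp [BExpr.left, Nat.lt_sub_iff_add_lt]
  have e2 : (BExpr.sum 24 (.reg 1) (.and (.adj (.reg 23) (.reg 24)) (.lt (.pos (.reg 24)) .right))).eval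
      N s.cell (Function.update s.reg 23 v) = 0 ↔
      ¬ ∃ u < n, w v u ≠ 0 ∧ s.cell 1 u < s.reg 4 + s.reg 3 := by
    rw [hsum]
    push Not
    refine forall₂_congr fun u hu => ?_
    rw [BExpr.eval_and, (hadj u hu).2]
    simp [BExpr.right]
  have e0 : BExpr.left.eval N s.cell (Function.update s.reg 23 v) = s.reg 9 - s.reg 3 := by
    simp [BExpr.left]
  have e0' : BExpr.right.eval N s.cell (Function.update s.reg 23 v) = s.reg 4 + s.reg 3 := by
    simp [BExpr.right]
  have e3 : (BExpr.pos (.reg 23)).eval N s.cell (Function.update s.reg 23 v) = s.cell 1 v := by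
    simp
  rw [BExpr.eval.eq_4, BExpr.eval.eq_4, ne_eq, Nat.add_eq_zero_iff, Nat.add_eq_zero_iff,
    BExpr.eval_and_eq_zero, BExpr.eval_and_eq_zero, BExpr.eval_and_eq_zero, ne_eq, ne_eq, ne_eq,
    ne_eq, ne_eq, ne_eq, e1, e2, BExpr.eval_le_eq_zero, BExpr.eval_le_eq_zero,
    BExpr.eval_lt_eq_zero, BExpr.eval_lt_eq_zero, e0, e0', e3, mem_bag, InBag]
  clear e0 e0' e1 e2 e3 hsum hadj h' h
  generalize (∃ u < n, w u v ≠ 0 ∧ s.reg 9 - s.reg 3 ≤ s.cell 1 u) = A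
  generalize (∃ u < n, w v u ≠ 0 ∧ s.cell 1 u < s.reg 4 + s.reg 3) = B
  simp only [hv, true_and, not_and_or, not_or, not_not]

open Classical in
/-- The bags of the lean ordering `pos`. -/
noncomputable def bags (w : ℕ → ℕ → ℕ) (n r : ℕ) (pos : ℕ → ℕ) (k : ℕ) : List (Finset ℕ) :=
  ((List.range k).filter fun k => 0 < k ∧ IsLocalMin w n pos r k).map fun k =>
    bag w n pos (prevMin w n pos r k - r) (k + r)

/-- Array `5` holds the characteristic vector of `B`. -/
def HoldsSet (n : ℕ) (B : Finset ℕ) (s : State) : Prop :=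
  (∀ v < n, v ∈ B → s.cell 5 v = 1) ∧ ∀ v < n, v ∉ B → s.cell 5 v = 0

/-- `Q L` describes the state after the bags in `L` have been processed. During the loop register
`9` holds the last local minimum before the current position, which determines the left end of the
next window. -/
theorem eachBag_spec (h : IsContext N n c w pos s) {p : BProg}
    (hreg : ∀ x ∈ [0, 1, 2, 3, 4, 9], x ∉ p.regs) (h0 : 0 ∉ p.arrays) (h1 : 1 ∉ p.arrays)
    (Q : List (Finset ℕ) → State → Prop)
    (hQ : ∀ L s' s'', s''.out = s'.out → s''.tape = s'.tape → s''.asked = s'.asked →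
      s''.reg 10 = s'.reg 10 → Q L s' → Q L s'')
    (hp : ∀ L lo hi s', IsContext N n c w pos s' → HoldsSet n (bag w n pos lo hi) s' → Q L s' →
      Q (L ++ [bag w n pos lo hi]) (p.run N O s'))
    (hs : Q [] s) : Q (bags w n (6 * c) pos (n + 1)) ((BProg.eachBag p).run N O s) := by
  classical
  have hN := h.input.n_lt
  simp only [List.mem_cons, List.not_mem_nil, or_false, forall_eq_or_imp, forall_eq] at hreg
  obtain ⟨p0, p1, p2, p3, p4, p9⟩ := hreg
  rw [BProg.eachBag, BProg.run_seq]
  set s₀ := (BProg.setReg 9 (.const 0)).run N O s with hs₀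
  have hc₀ : IsContext N n c w pos s₀ := h.run (by decide) (by decide) (by decide) (by decide)
    (by decide) (by decide)
  have h90 : s₀.reg 9 = 0 := by simp [hs₀, BProg.run_setReg_reg]
  have hQ₀ : Q [] s₀ := hQ _ s _ rfl rfl rfl (BProg.run_reg (by decide) s) hs
  refine (run_forEach (fun k (s' : State) => IsContext N n c w pos s' ∧
    s'.reg 9 = prevMin w n pos (6 * c) k ∧ Q (bags w n (6 * c) pos k) s') ?_ ?_
    (show n + 1 ≤ N by omega) ?_ ⟨hc₀, ?_, ?_⟩ ?_).2.2
  · simp [BProg.regs, BProg.storeBag, p4]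
  · simp [hc₀.input.n_eq]
  · rintro i s' v ⟨h1, h2, h3⟩
    refine ⟨⟨h1.input.update (by decide) _, ?_, ?_, ?_, h1.pos_eq⟩, ?_, hQ _ s' _ rfl rfl rfl ?_ h3⟩
    · simpa using h1.bound
    · simpa using h1.target
    · simpa using h1.radius
    · simpa using h2
    · simp
  -- At position `0` the truncated `0 - 1` makes the previous minimum `0`, the initial value of
  -- register `9`.
  · rw [h90, prevMin]
    rfl
  · simpa [bags] using hQ₀
  · rintro k hk s' h4 ⟨hc, h9, hQL⟩
    have hm := isMin_spec hc.input (x := 4) (by decide) (by decide) (by decide)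
    rw [hc.pos_eq, hc.radius, h4] at hm
    have hcond : (BExpr.and (.lt (.const 0) (.reg 4)) (.isMin 4)).eval N s'.cell s'.reg ≠ 0 ↔
        0 < k ∧ IsLocalMin w n pos (6 * c) k := by
      rw [BExpr.eval_and, ← hm]
      simp [h4]
    have hprev : prevMin w n pos (6 * c) (k + 1) =
        if 0 < k ∧ IsLocalMin w n pos (6 * c) k then k else prevMin w n pos (6 * c) k := by
      rcases Nat.eq_zero_or_pos k with rfl | hk0
      · simp [prevMin]
      · obtain ⟨k, rfl⟩ := Nat.exists_eq_succ_of_ne_zero hk0.ne'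
        simp [prevMin, Nat.findGreatest_succ]
    have hbags : bags w n (6 * c) pos (k + 1) = bags w n (6 * c) pos k ++
        if 0 < k ∧ IsLocalMin w n pos (6 * c) k then
          [bag w n pos (prevMin w n pos (6 * c) k - 6 * c) (k + 6 * c)] else [] := by
      rw [bags, bags, List.range_succ, List.filter_append, List.map_append]
      congr 1
      by_cases hP : 0 < k ∧ IsLocalMin w n pos (6 * c) k
      · rw [if_pos hP, List.filter_cons_of_pos (by simpa using hP)]
        rfl
      · rw [if_neg hP, List.filter_cons_of_neg (by simpa using hP)]
        rfl
    rw [hprev, hbags, BProg.run_cond]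
    by_cases hP : 0 < k ∧ IsLocalMin w n pos (6 * c) k
    · rw [if_pos (hcond.2 hP), if_pos hP, if_pos hP, BProg.run_seq, BProg.run_seq]
      set s₁ := BProg.storeBag.run N O s' with hs₁
      have hc₁ : IsContext N n c w pos s₁ := hc.run (by decide) (by decide) (by decide)
        (by decide) (by decide) (by decide)
      have hset : HoldsSet n (bag w n pos (prevMin w n pos (6 * c) k - 6 * c) (k + 6 * c)) s₁ := by
        refine ⟨fun v hv hB => ?_, fun v hv hB => ?_⟩ <;>
        · rw [hs₁, storeBag_spec hc.input hv, h9, hc.radius, hc.pos_eq, h4]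
          simp [hB]
      have hQ₁ := hp _ _ _ s₁ hc₁ hset (hQ _ s' _ rfl rfl rfl rfl hQL)
      refine ⟨(hc₁.run p0 p1 p2 p3 h0 h1).run (by decide) (by decide) (by decide) (by decide)
        (by decide) (by decide), ?_,
        hQ _ (p.run N O s₁) _ rfl rfl rfl (BProg.run_reg (by decide) _) hQ₁⟩
      simp only [BProg.run_setReg_reg, Function.update_self, BExpr.eval]
      rw [BProg.run_reg p4, hs₁, BProg.run_reg (by decide), h4]
    · rw [if_neg (mt hcond.1 hP), if_neg hP, if_neg hP, List.append_nil]
      exact ⟨hc, h9, hQL⟩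

theorem numBags_spec (h : IsContext N n c w pos s) :
    BExpr.numBags.eval N s.cell s.reg = (bags w n (6 * c) pos (n + 1)).length := by
  classical
  have hN := h.input.n_lt
  rw [bags, List.length_map, BExpr.numBags, BExpr.eval, BExpr.eval, BExpr.eval, BExpr.eval,
    h.input.n_eq, min_eq_left (show n + 1 ≤ N by omega)]
  have e : ∀ k, (BExpr.and (.lt (.const 0) (.reg 26)) (.isMin 26)).eval N s.cell
      (Function.update s.reg 26 k) = if 0 < k ∧ IsLocalMin w n pos (6 * c) k then 1 else 0 := by
    intro k
    have hm := isMin_spec (h.input.update (show 26 ≠ 1 by decide) k) (x := 26) (by decide)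
      (by decide) (by decide)
    rw [h.pos_eq, Function.update_of_ne (by decide), h.radius, Function.update_self] at hm
    rw [BExpr.eval_and, ← hm, BExpr.isMin, BExpr.eval_not]
    simp only [BExpr.eval.eq_6, BExpr.eval.eq_1, BExpr.eval.eq_2, Function.update_self]
    split_ifs <;> simp_all
  simp only [e]
  rw [← Finset.card_filter, ← List.toFinset_card_of_nodup (List.nodup_range.filter _)]
  congr 1
  ext k
  simp

theorem wide_spec (h : IsContext N n c w pos s) :
    BExpr.wide.eval N s.cell s.reg = 0 ↔ ∀ j ≤ n, prefixCut w n pos j ≤ 2 * c := by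
  have hN := h.input.n_lt
  rw [BExpr.wide, BExpr.eval, BExpr.eval, BExpr.eval, BExpr.eval, h.input.n_eq,
    min_eq_left (show n + 1 ≤ N by omega), Finset.sum_eq_zero_iff]
  refine forall_congr' fun j => ?_
  rw [Finset.mem_range, Nat.lt_succ_iff]
  refine imp_congr_right fun hj => ?_
  rw [BExpr.eval, (h.input.update (show 22 ≠ 1 by decide) j).eval_cut (J := j) (by simp)]
  simp [h.target, h.pos_eq]
  omega

end Specifications

/-! ## Correctness of the kernelization -/

/-- A list of at most `n` small vertex sets that determines whether the digraph on `{0, …, n-1}`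
has cutwidth at most `c`. -/
structure IsKernelList (w : ℕ → ℕ → ℕ) (n c : ℕ) (L : List (Finset ℕ)) : Prop where
  length_le : L.length ≤ n
  subset : ∀ B ∈ L, B ⊆ Finset.range n
  card_le : ∀ B ∈ L, B.card ≤ 24 * c ^ 2 + 16 * c + 1
  layout_iff : (∃ f, IsLayout w (Finset.range n) c f) ↔ ∀ B ∈ L, ∃ f, IsLayout w B c f

/-- The state `s'` has the same output, query tape and query record as `s`. -/
structure SameOutput (s s' : State) : Prop where
  out : s'.out = s.out
  tape : s'.tape = s.tape
  asked : s'.asked = s.asked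

/-! ### From the sorted vertices to a kernel list. -/

section Specifications

variable {N n c : ℕ} {w : ℕ → ℕ → ℕ} {O : Oracle} {s s' s'' : State} {pos : ℕ → ℕ}

theorem SameOutput.trans (h : SameOutput s s') (h' : SameOutput s' s'') : SameOutput s s'' :=
  ⟨h'.out.trans h.out, h'.tape.trans h.tape, h'.asked.trans h.asked⟩

/-- Layouts restrict to bags, and conversely `exists_isLayout_of_bags` combines layouts of bags. -/
theorem isKernelList_bags (hw : IsSemiComplete w (Finset.range n)) (hp : IsOrdering n pos)
    (hwidth : ∀ j ≤ n, prefixCut w n pos j ≤ 2 * c)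
    (hlean : ∀ k ≤ n, IsLeanAt w n pos (6 * c) k) :
    IsKernelList w n c (bags w n (6 * c) pos (n + 1)) := by
  classical
  have hwidth' : ∀ j, prefixCut w n pos j ≤ 2 * c := by
    intro j
    rcases le_total j n with hj | hj
    · exact hwidth j hj
    · rw [hp.prefixCut_eq_zero hj]
      exact Nat.zero_le _
  have hmem : ∀ B, B ∈ bags w n (6 * c) pos (n + 1) ↔ ∃ k ≤ n, (0 < k ∧
      IsLocalMin w n pos (6 * c) k) ∧
        bag w n pos (prevMin w n pos (6 * c) k - 6 * c) (k + 6 * c) = B := by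
    intro B
    simp [bags, and_assoc]
  refine ⟨?_, ?_, ?_, ?_, ?_⟩
  -- Each bag belongs to a local minimum in `{1, …, n}`; the one at `0` only serves as a left end.
  · rw [bags, List.length_map, ← List.toFinset_card_of_nodup (List.nodup_range.filter _)]
    calc _ ≤ (Finset.Icc 1 n).card := Finset.card_le_card fun k hk => by
            simp only [List.mem_toFinset, List.mem_filter, List.mem_range,
              decide_eq_true_eq] at hk
            rw [Finset.mem_Icc]
            omega
      _ = n := by simp
  · intro B hB
    obtain ⟨k, -, -, rfl⟩ := (hmem B).1 hB
    exact bag_subset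
  · intro B hB
    obtain ⟨k, hk, ⟨hk0, -⟩, rfl⟩ := (hmem B).1 hB
    -- The summands are `12 * c ^ 2 * 2 + 1` for the segment, `2 * (6 * c)` for the margins and `2 *
    -- (2 * c)` for the ends of arcs over the two ends of the window.
    have h1 := card_bag_le (lo := prevMin w n pos (6 * c) k - 6 * c) (hi := k + 6 * c) hp hwidth'
    have h2 := sub_prevMin_le (r := 6 * c) hwidth' hk0 hk
    have h3 : 2 * c * (6 * c) = 12 * c ^ 2 := by ring
    rw [h3] at h2
    omega
  · rintro ⟨f, hf⟩ B hB
    obtain ⟨k, -, -, rfl⟩ := (hmem B).1 hB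
    exact ⟨f, hf.mono bag_subset⟩
  · intro h
    exact exists_isLayout_of_bags hw hp hwidth' hlean fun k hk hk0 hmin =>
      h _ ((hmem _).2 ⟨k, hk, ⟨hk0, hmin⟩, rfl⟩)

theorem setup_spec (hN : s.reg 0 = N) (hn : s.cell 0 0 = n) (hc : s.cell 0 2 = c)
    (hle : n * n + 3 ≤ N) (hadj : ∀ u < n, ∀ v < n, s.cell 0 (3 + (u * n + v)) = w u v)
    (hw : IsSemiComplete w (Finset.range n)) :
    ∃ pos, IsContext N n c w pos (BProg.setup.run N O s) ∧ IsOrdering n pos ∧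
      ((∃ f, IsLayout w (Finset.range n) c f) → ∀ j, prefixCut w n pos j ≤ 2 * c) := by
  have hw1 : ∀ u < n, ∀ v < n, w u v ≤ 1 := fun u hu v hv =>
    hw.le_one u (Finset.mem_range.2 hu) v (Finset.mem_range.2 hv)
  rw [BProg.setup, BProg.run_seq, BProg.run_seq, BProg.run_seq, BProg.run_seq]
  set s₁ := BProg.run N O (.setReg 1 (.cell 0 (.const 0))) s with hs₁
  set s₂ := BProg.run N O (.setReg 2 (.cell 0 (.const 2))) s₁ with hs₂
  set s₃ := BProg.run N O (.setReg 3 (.add (.add (.add (.reg 2) (.reg 2)) (.add (.reg 2) (.reg 2)))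
    (.add (.reg 2) (.reg 2)))) s₂ with hs₃
  set s₄ := BProg.run N O BProg.degreeKeys s₃ with hs₄
  have h₁ : s₁.reg = Function.update s.reg 1 n := by
    rw [hs₁, BProg.run_setReg_reg]
    simp [hn]
  have h₂ : s₂.reg = Function.update (Function.update s.reg 1 n) 2 c := by
    rw [hs₂, BProg.run_setReg_reg, h₁]
    simp [hs₁, BProg.run, hc]
  have h₃ : s₃.reg =
      Function.update (Function.update (Function.update s.reg 1 n) 2 c) 3 (6 * c) := by
    rw [hs₃, BProg.run_setReg_reg, h₂]
    simp only [BExpr.eval, Function.update_self]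
    congr 1
    ring
  have hin₃ : HasInput N n w s₃.cell s₃.reg := ⟨by simp [h₃], hle, hadj⟩
  have hin₄ : HasInput N n w s₄.cell s₄.reg := hin₃.run (by decide) (by decide)
  have hcell : ∀ v < n, (BProg.rankVertices.run N O s₄).cell 1 v =
      rank (Finset.range n) (s₄.cell 4) v := fun v hv => rankVertices_spec hin₄ hv
  have hkey : ∀ v < n, s₄.cell 4 v = (∑ u ∈ Finset.range n, (w u v + 1 - w v u)) * n + v :=
    fun v hv => degreeKeys_spec hin₃ hw1 hv
  have hinj : ∀ u < n, ∀ v < n, s₄.cell 4 u = s₄.cell 4 v → u = v := by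
    intro u hu v hv huv
    rw [hkey u hu, hkey v hv] at huv
    have := congrArg (· % n) huv
    simpa [Nat.mod_eq_of_lt hu, Nat.mod_eq_of_lt hv] using this
  refine ⟨_, ⟨hin₄.run (by decide) (by decide), ?_, ?_, ?_, rfl⟩, ?_, ?_⟩
  · rw [BProg.run_reg (by decide), hs₄, BProg.run_reg (by decide), h₃]
    simp [hN]
  · rw [BProg.run_reg (by decide), hs₄, BProg.run_reg (by decide), h₃]
    simp
  · rw [BProg.run_reg (by decide), hs₄, BProg.run_reg (by decide), h₃]
    simp
  · have h := isOrdering_rank hinj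
    refine ⟨fun v hv => ?_, fun u hu v hv huv => h.inj u hu v hv ?_⟩
    · rw [hcell v hv]
      exact h.lt v hv
    · rwa [hcell u hu, hcell v hv] at huv
  · rintro ⟨g, hg⟩ j
    rw [prefixCut]
    refine hg.cutWeight_le_of_sorted hw (key := fun v => ∑ u ∈ Finset.range n, (w u v + 1 - w v u))
      (fun _ _ => rfl) fun u hu v hv huj hvj => ?_
    have hu' := Finset.mem_range.1 hu
    have hv' := Finset.mem_range.1 hv
    rw [Set.mem_ofPred_eq, hcell u hu'] at huj
    rw [Set.mem_ofPred_eq, hcell v hv', not_lt] at hvj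
    have hlt := (rank_lt_iff hu hv).1 (huj.trans_le hvj)
    rw [hkey u hu', hkey v hv'] at hlt
    -- A smaller rank excludes a larger degree key: the tie-breaking digit is less than `n` and
    -- cannot compensate a difference in the leading part.
    by_contra! hcon
    have := Nat.mul_le_mul_right n (Nat.succ_le_of_lt hcon)
    rw [Nat.succ_mul] at this
    omega

/-- The program gives up only if the target is negative or a cut of the sorted ordering exceeds `2 *
c`, and a layout of width `c` excludes the latter. Making the ordering lean does not increase its
width. -/
theorem kernel_spec (hN : s.reg 0 = N) (hn : s.cell 0 0 = n) (hc : s.cell 0 2 = c)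
    (hle : n * n + 3 ≤ N) (hadj : ∀ u < n, ∀ v < n, s.cell 0 (3 + (u * n + v)) = w u v)
    (hw : IsSemiComplete w (Finset.range n)) (fail start p finish : BProg) :
    (∃ s', SameOutput s s' ∧ (BProg.kernel fail start p finish).run N O s = fail.run N O s' ∧
      (s.cell 0 1 = 0 → ¬ ∃ f, IsLayout w (Finset.range n) c f)) ∨
    ∃ pos s', SameOutput s s' ∧ IsContext N n c w pos s' ∧ s.cell 0 1 = 0 ∧
      (BProg.kernel fail start p finish).run N O s =
        finish.run N O ((BProg.eachBag p).run N O (start.run N O s')) ∧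
      IsKernelList w n c (bags w n (6 * c) pos (n + 1)) := by
  have hw1 : ∀ u < n, ∀ v < n, w u v ≤ 1 := fun u hu v hv =>
    hw.le_one u (Finset.mem_range.2 hu) v (Finset.mem_range.2 hv)
  obtain ⟨pos, hctx, hpos, hwidth⟩ := setup_spec (O := O) hN hn hc hle hadj hw
  rw [BProg.kernel, BProg.run_seq, BProg.run_cond]
  set s₁ := BProg.setup.run N O s with hs₁
  have hsame : SameOutput s s₁ := by
    have := BProg.run_silent (p := BProg.setup) (N := N) (O := O) (by decide) s
    exact ⟨this.1, this.2.1, this.2.2⟩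
  have hsign : s₁.cell 0 1 = s.cell 0 1 := by
    rw [hs₁, BProg.run_cell (by decide)]
  have hwide := wide_spec hctx
  by_cases h : s.cell 0 1 = 0 ∧ ∀ j ≤ n, prefixCut w n pos j ≤ 2 * c
  · have hcond : (BExpr.add (.cell 0 (.const 1)) .wide).eval N s₁.cell s₁.reg = 0 := by
      rw [BExpr.eval, hwide.2 h.2]
      simp [hsign, h.1]
    rw [if_neg (not_not.2 hcond), BProg.run_seq, BProg.run_seq, BProg.run_seq]
    have hord : HasOrdering N n (2 * c) (6 * c) w s₁ := by
      refine ⟨hctx.input, hctx.bound, hctx.radius, hctx.pos_eq ▸ hpos, fun v hv => ?_⟩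
      rw [cutWeight_le_prefixCut, hctx.pos_eq]
      exact h.2 _ (hpos.lt v hv)
    obtain ⟨hord', hlean⟩ := makeLean_spec (O := O) hw1 hord
    set s₂ := BProg.makeLean.run N O s₁ with hs₂
    refine .inr ⟨s₂.cell 1, s₂, hsame.trans ?_, ⟨hord'.input, hord'.bound, ?_, hord'.radius, rfl⟩,
      h.1, rfl, isKernelList_bags hw hord'.ordering ?_ hlean⟩
    · have := BProg.run_silent (p := BProg.makeLean) (N := N) (O := O) (by decide) s₁
      exact ⟨this.1, this.2.1, this.2.2⟩
    · rw [hs₂, BProg.run_reg (by decide), hctx.target]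
    · intro j hj
      exact prefixCut_le hord'.width j
  · have hcond : (BExpr.add (.cell 0 (.const 1)) .wide).eval N s₁.cell s₁.reg ≠ 0 := by
      rw [BExpr.eval, ne_eq, Nat.add_eq_zero_iff, hwide]
      simpa [hsign] using h
    rw [if_pos hcond]
    refine .inl ⟨s₁, hsame, rfl, fun h0 hex => h ⟨h0, fun j _ => hwidth hex j⟩⟩

end Specifications

/-! ## Encodings -/

open Classical in
/-- The adjacency matrix of a digraph on `{0, …, n-1}`, padded with zeros. -/
noncomputable def weight {n : ℕ} (D : Digraph (Fin n)) (u v : ℕ) : ℕ :=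
  if ∃ (hu : u < n) (hv : v < n), D.Adj ⟨u, hu⟩ ⟨v, hv⟩ then 1 else 0

/-! ### Digraphs as weights on the natural numbers. -/

section Weight

variable {n : ℕ} {D : Digraph (Fin n)}

theorem weight_eq_one {u v : Fin n} (h : D.Adj u v) : weight D u v = 1 :=
  if_pos ⟨u.2, v.2, h⟩

theorem weight_eq_zero {u v : Fin n} (h : ¬ D.Adj u v) : weight D u v = 0 :=
  if_neg fun ⟨_, _, h'⟩ => h h'

theorem weight_le_one (u v : ℕ) : weight D u v ≤ 1 := by
  unfold weight
  split_ifs <;> simp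

theorem SemiComplete.isSemiComplete_weight (h : SemiComplete D) :
    IsSemiComplete (weight D) (Finset.range n) where
  le_one u _ v _ := weight_le_one u v
  irrefl u hu := by
    lift u to Fin n using Finset.mem_range.1 hu
    exact weight_eq_zero (h.1 u)
  total u hu v hv huv := by
    lift u to Fin n using Finset.mem_range.1 hu
    lift v to Fin n using Finset.mem_range.1 hv
    rcases h.2 u v (fun h => huv (congrArg _ h)) with h | h
    · rw [weight_eq_one h]
      omega
    · rw [weight_eq_one h]
      omega

theorem ctw_le_iff_exists_isLayout_weight {c : ℕ} :
    ctw D ≤ c ↔ ∃ f, IsLayout (weight D) (Finset.range n) c f :=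
  ctw_le_iff_exists_isLayout (ι := Fin.val) Fin.val_injective
    (fun x => ⟨fun h => ⟨⟨x, Finset.mem_range.1 h⟩, rfl⟩, fun ⟨a, ha⟩ => by simp [← ha]⟩)
    (fun _ _ => weight_eq_one) fun _ _ => weight_eq_zero

/-- The elements of `B` as elements of `{0, …, n-1}`. -/
def toFin (n : ℕ) (B : Finset ℕ) : Finset (Fin n) := Finset.univ.filter fun v => (v : ℕ) ∈ B

theorem mem_toFin {B : Finset ℕ} {v : Fin n} : v ∈ toFin n B ↔ (v : ℕ) ∈ B := by simp [toFin]

theorem card_toFin_le (B : Finset ℕ) : (toFin n B).card ≤ B.card :=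
  Finset.card_le_card_of_injOn Fin.val (fun _ hv => mem_toFin.1 hv) Fin.val_injective.injOn

theorem ctw_induced_toFin_le_iff {c : ℕ} {B : Finset ℕ} (hB : B ⊆ Finset.range n) :
    ctw (induced D (toFin n B)) ≤ c ↔ ∃ f, IsLayout (weight D) B c f :=
  ctw_le_iff_exists_isLayout (ι := fun a => (a.1 : ℕ))
    (fun _ _ h => Subtype.ext (Fin.ext h))
    (fun x => ⟨fun h => ⟨⟨⟨x, Finset.mem_range.1 (hB h)⟩, mem_toFin.2 h⟩, rfl⟩,
      fun ⟨a, ha⟩ => ha ▸ mem_toFin.1 a.2⟩)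
    (fun _ _ => weight_eq_one) fun _ _ => weight_eq_zero

theorem encodeSet_toFin (B : Finset ℕ) :
    encodeSet (toFin n B) = (List.range n).map fun v => if v ∈ B then 1 else 0 := by
  refine List.ext_getElem (by simp [encodeSet]) fun i h₁ h₂ => ?_
  simp [encodeSet, mem_toFin]

theorem length_encodeInput (D : Digraph (Fin n)) (c : ℤ) :
    (encodeInput D c).length = n * n + 3 := by
  simp [encodeInput, adjBits]

/-- The offset `3` skips the number of vertices, the sign and the absolute value of the target. -/
theorem getD_encodeInput {c : ℤ} {u v : ℕ} (hu : u < n) (hv : v < n) :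
    (encodeInput D c).getD (3 + (u * n + v)) 0 = weight D u v := by
  have hlt : u * n + v < n * n := by nlinarith
  rw [encodeInput, add_comm 3]
  change (adjBits D).getD (u * n + v) 0 = _
  rw [adjBits, List.getD_eq_getElem _ _ (by simpa using hlt), List.getElem_ofFn, weight]
  have hn : 0 < n := by omega
  have h₁ : Fin.divNat (⟨u * n + v, hlt⟩ : Fin (n * n)) = ⟨u, hu⟩ := by
    ext
    simp [Fin.divNat, Nat.mul_add_div hn, mul_comm u, Nat.div_eq_of_lt hv]
  have h₂ : Fin.modNat (⟨u * n + v, hlt⟩ : Fin (n * n)) = ⟨v, hv⟩ := by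
    ext
    simp [Fin.modNat, Nat.mod_eq_of_lt hv]
  rw [h₁, h₂]
  by_cases h : D.Adj ⟨u, hu⟩ ⟨v, hv⟩
  · exact (if_pos h).trans (if_pos ⟨hu, hv, h⟩).symm
  · exact (if_neg h).trans (if_neg fun ⟨_, _, h'⟩ => h h').symm

end Weight

/-- The digraph on the positions of `l` with the arcs that have nonzero weight. -/
def listDigraph (w : ℕ → ℕ → ℕ) (l : List ℕ) : Digraph (Fin l.length) where
  Adj i j := w l[i] l[j] ≠ 0

theorem semiComplete_listDigraph {w : ℕ → ℕ → ℕ} {l : List ℕ}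
    (hw : IsSemiComplete w l.toFinset) (hl : l.Nodup) : SemiComplete (listDigraph w l) := by
  have hmem : ∀ i : Fin l.length, l[i] ∈ l.toFinset := fun i => by simp
  refine ⟨fun i h => h (hw.irrefl _ (hmem i)), fun i j hij => ?_⟩
  have := hw.total _ (hmem i) _ (hmem j) fun h => hij (List.nodup_iff_injective_get.1 hl h)
  show w l[i] l[j] ≠ 0 ∨ w l[j] l[i] ≠ 0
  omega

/-- This form of the adjacency matrix matches the two nested loops of `BProg.emitMatrix`. -/
theorem adjBits_listDigraph {w : ℕ → ℕ → ℕ} {l : List ℕ} (hw : ∀ u ∈ l, ∀ v ∈ l, w u v ≤ 1) :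
    adjBits (listDigraph w l) = l.flatMap fun u => l.map (w u) := by
  have hlist : ∀ f : ℕ → List ℕ,
      l.flatMap f = (List.ofFn fun i : Fin l.length => f l[i]).flatten := by
    intro f
    rw [List.flatMap_def]
    congr 1
    exact List.ext_getElem (by simp) fun i h₁ h₂ => by simp
  rw [adjBits, List.ofFn_mul, hlist]
  congr 2
  ext i : 1
  refine List.ext_getElem (by simp) fun j h₁ h₂ => ?_
  have hj : j < l.length := by simpa using h₁
  have hpos : 0 < l.length := by omega
  rw [List.getElem_ofFn, List.getElem_map]
  have e₁ : Fin.divNat (⟨i * l.length + j, by nlinarith [i.2]⟩ : Fin (l.length * l.length)) = i := by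
    ext
    simp [Fin.divNat, Nat.mul_add_div hpos, mul_comm (i : ℕ), Nat.div_eq_of_lt hj]
  have e₂ : Fin.modNat (⟨i * l.length + j, by nlinarith [i.2]⟩ : Fin (l.length * l.length)) =
      ⟨j, hj⟩ := by
    ext
    simp [Fin.modNat, Nat.mod_eq_of_lt hj]
  have hadj : (listDigraph w l).Adj
      (Fin.divNat (⟨i * l.length + j, by nlinarith [i.2]⟩ : Fin (l.length * l.length)))
      (Fin.modNat (⟨i * l.length + j, by nlinarith [i.2]⟩ : Fin (l.length * l.length))) ↔
      w l[i] l[j] ≠ 0 := by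
    rw [e₁, e₂]
    rfl
  have := hw l[i] (by simp) l[j] (by simp)
  by_cases h : w l[i] l[j] ≠ 0
  · refine (if_pos (hadj.2 h)).trans ?_
    change _ = w l[i] l[j]
    omega
  · refine (if_neg (mt hadj.1 h)).trans ?_
    exact (not_not.1 h).symm

theorem ctw_listDigraph_le_iff {w : ℕ → ℕ → ℕ} {l : List ℕ} {c : ℕ}
    (hw : ∀ u ∈ l, ∀ v ∈ l, w u v ≤ 1) (hl : l.Nodup) :
    ctw (listDigraph w l) ≤ c ↔ ∃ f, IsLayout w l.toFinset c f := by
  refine ctw_le_iff_exists_isLayout (ι := l.get) (List.nodup_iff_injective_get.1 hl)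
    (fun x => by rw [List.mem_toFinset, List.mem_iff_get]) (fun a b h => ?_) fun a b h => not_not.1 h
  have := hw l[a] (by simp) l[b] (by simp)
  have h' : w l[a] l[b] ≠ 0 := h
  exact le_antisymm this (Nat.one_le_iff_ne_zero.2 h')

/-- The elements of `B` below `n`, in increasing order. -/
def sortedList (n : ℕ) (B : Finset ℕ) : List ℕ := (List.range n).filter (· ∈ B)

section SortedList

variable {n : ℕ} {B : Finset ℕ}

theorem nodup_sortedList : (sortedList n B).Nodup := List.nodup_range.filter _

theorem toFinset_sortedList (hB : B ⊆ Finset.range n) : (sortedList n B).toFinset = B := by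
  ext v
  simpa [sortedList] using fun h => Finset.mem_range.1 (hB h)

theorem length_sortedList (hB : B ⊆ Finset.range n) : (sortedList n B).length = B.card := by
  rw [← List.toFinset_card_of_nodup nodup_sortedList, toFinset_sortedList hB]

end SortedList

/-- The instance of Cutwidth induced by the vertices in `B`. -/
noncomputable def subInst {w : ℕ → ℕ → ℕ} {n : ℕ} (hw : IsSemiComplete w (Finset.range n)) (c : ℕ)
    (B : Finset ℕ) : cutwidthProblem.Inst :=
  CutwidthInst.mk (sortedList n B).length (listDigraph w (sortedList n B))
    (semiComplete_listDigraph
      (hw.mono fun v hv => by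
        simpa [sortedList] using (List.mem_filter.1 (List.mem_toFinset.1 hv)).1)
      nodup_sortedList) c

/-! ### Bags as instances of Cutwidth. -/

section SubInst

variable {w : ℕ → ℕ → ℕ} {n : ℕ} {c : ℕ} {B : Finset ℕ}

theorem IsSemiComplete.le_one_of_mem_sortedList (hw : IsSemiComplete w (Finset.range n)) :
    ∀ u ∈ sortedList n B, ∀ v ∈ sortedList n B, w u v ≤ 1 := by
  have h : ∀ u ∈ sortedList n B, u ∈ Finset.range n := fun u hu => by
    simpa using (List.mem_filter.1 hu).1
  exact fun u hu v hv => hw.le_one u (h u hu) v (h v hv)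

theorem encode_subInst (hw : IsSemiComplete w (Finset.range n)) :
    cutwidthProblem.encode (subInst hw c B) =
      (sortedList n B).length :: 0 :: c ::
        (sortedList n B).flatMap fun u => (sortedList n B).map (w u) := by
  rw [← adjBits_listDigraph hw.le_one_of_mem_sortedList]
  simp [cutwidthProblem, subInst, encodeInput]

theorem size_subInst (hw : IsSemiComplete w (Finset.range n)) (hB : B ⊆ Finset.range n) :
    cutwidthProblem.size (subInst hw c B) = B.card :=
  length_sortedList hB

theorem yes_subInst (hw : IsSemiComplete w (Finset.range n)) (hB : B ⊆ Finset.range n) :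
    cutwidthProblem.Yes (subInst hw c B) ↔ ∃ f, IsLayout w B c f := by
  refine (ctw_listDigraph_le_iff hw.le_one_of_mem_sortedList nodup_sortedList).trans ?_
  rw [toFinset_sortedList hB]
  rfl

end SubInst

/-! ## Writing vertex sets and instances -/

namespace BExpr

/-- The size of the set in array `5`. -/
def size : BExpr := .sum 24 (.reg 1) (.cell 5 (.reg 24))

end BExpr

namespace BProg

/-- Appends a number to the output or to the query tape. -/
def emit (toOut : Bool) (e : BExpr) : BProg := if toOut then .write e else .push e

/-- Appends the characteristic vector in array `5` to the output. -/
def emitSet : BProg := .forEach 12 (.reg 1) (.emit true (.cell 5 (.reg 12)))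

/-- Appends the adjacency matrix of the subdigraph induced by the set in array `5`. -/
def emitMatrix (toOut : Bool) : BProg :=
  .forEach 12 (.reg 1) (.cond (.cell 5 (.reg 12))
    (.forEach 13 (.reg 1) (.cond (.cell 5 (.reg 13))
      (.emit toOut (.adj (.reg 12) (.reg 13))) .skip)) .skip)

/-- Appends the instance induced by the set in array `5`. -/
def emitInst (toOut : Bool) : BProg :=
  .seq (.emit toOut .size) (.seq (.emit toOut (.const 0))
    (.seq (.emit toOut (.reg 2)) (.emitMatrix toOut)))

end BProg

/-- The output or the query tape. -/
def State.channel (s : State) : Bool → List ℕ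
  | true => s.out
  | false => s.tape

/-- The step from `s` to `s'` appends `l` to the output or to the query tape. -/
structure Emits (toOut : Bool) (l : List ℕ) (s s' : State) : Prop where
  channel : s'.channel toOut = s.channel toOut ++ l
  other : s'.channel (!toOut) = s.channel (!toOut)
  asked : s'.asked = s.asked

/-! ### Correctness of the writing programs. -/

section Emits

variable {N n c B : ℕ} {w : ℕ → ℕ → ℕ} {O : Oracle} {s s' s'' : State} {pos : ℕ → ℕ} {toOut : Bool}
  {l l' : List ℕ}

theorem Emits.refl : Emits toOut [] s s := ⟨by simp, rfl, rfl⟩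

theorem Emits.trans (h : Emits toOut l s s') (h' : Emits toOut l' s' s'') :
    Emits toOut (l ++ l') s s'' :=
  ⟨by rw [h'.channel, h.channel, List.append_assoc], h'.other.trans h.other,
    h'.asked.trans h.asked⟩

theorem emits_emit (e : BExpr) :
    Emits toOut [e.eval N s.cell s.reg] s ((BProg.emit toOut e).run N O s) := by
  cases toOut <;> exact ⟨rfl, rfl, rfl⟩

/-- The body writes to no array, so all rounds read the same set and the same matrix. -/
theorem emits_forEach {x : ℕ} {b : BExpr} {p : BProg} {f : ℕ → List ℕ} (hx : x ∉ p.regs)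
    (hb : b.eval N s.cell (Function.update s.reg x 0) = B) (hB : B ≤ N) (hp : p.arrays = [])
    (hs : ∀ i < B, ∀ s', s'.reg x = i → s'.cell = s.cell →
      (∀ y, y ≠ x → y ∉ p.regs → s'.reg y = s.reg y) → Emits toOut (f i) s' (p.run N O s')) :
    Emits toOut ((List.range B).flatMap f) s ((BProg.forEach x b p).run N O s) := by
  refine (run_forEach (fun i s' => (s'.cell = s.cell ∧ ∀ y, y ≠ x → y ∉ p.regs →
    s'.reg y = s.reg y) ∧ Emits toOut ((List.range i).flatMap f) s s') hx hb hB ?_ ?_ ?_).2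
  · rintro i s' v ⟨⟨h1, h2⟩, h3, h4, h5⟩
    refine ⟨⟨h1, fun y hy hy' => ?_⟩, ?_, ?_, h5⟩
    · rw [← h2 y hy hy']
      exact Function.update_of_ne hy ..
    · rw [← h3]
      cases toOut <;> rfl
    · rw [← h4]
      cases toOut <;> rfl
  · exact ⟨⟨rfl, fun _ _ _ => rfl⟩, .refl⟩
  · rintro i hi s' hi' ⟨⟨h1, h2⟩, h3⟩
    refine ⟨⟨?_, fun y hy hy' => (BProg.run_reg hy' s').trans (h2 y hy hy')⟩, ?_⟩
    · rw [← h1]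
      ext a : 1
      exact BProg.run_cell (by simp [hp]) s'
    · rw [List.range_succ, List.flatMap_append]
      simpa using h3.trans (hs i hi s' hi' h1 h2)

theorem flatMap_filter {α β : Type*} (l : List α) (p : α → Bool) (f : α → List β) :
    (l.filter p).flatMap f = l.flatMap fun a => if p a then f a else [] := by
  induction l with
  | nil => rfl
  | cons a l ih => cases h : p a <;> simp [h, ih]

variable {A : Finset ℕ}

theorem HoldsSet.cell_eq (h : HoldsSet n A s) {v : ℕ} (hv : v < n) :
    s.cell 5 v = if v ∈ A then 1 else 0 := by
  split_ifs with hA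
  exacts [h.1 v hv hA, h.2 v hv hA]

theorem eval_size (h : HasInput N n w s.cell s.reg) (hA : HoldsSet n A s)
    (hn : A ⊆ Finset.range n) {r : ℕ → ℕ} (hr : r 1 = s.reg 1) :
    BExpr.size.eval N s.cell r = A.card := by
  have hN := h.n_lt
  rw [BExpr.size, BExpr.eval, BExpr.eval, hr, h.n_eq, min_eq_left (show n ≤ N by omega)]
  calc _ = ∑ v ∈ Finset.range n, if v ∈ A then 1 else 0 :=
        Finset.sum_congr rfl fun v hv => by
          simpa using hA.cell_eq (Finset.mem_range.1 hv)
    _ = _ := by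
        rw [← Finset.card_filter, Finset.filter_mem_eq_inter, Finset.inter_eq_right.2 hn]

theorem emits_emitSet (h : HasInput N n w s.cell s.reg) (hA : HoldsSet n A s) :
    Emits true ((List.range n).map fun v => if v ∈ A then 1 else 0) s
      (BProg.emitSet.run N O s) := by
  have hN := h.n_lt
  rw [List.map_eq_flatMap]
  refine emits_forEach (by decide) (by simp [h.n_eq]) (show n ≤ N by omega) rfl
    fun i hi s' hi' hc _ => ?_
  convert emits_emit (N := N) (O := O) (s := s') (BExpr.cell 5 (.reg 12)) using 2
  simp [hi', hc, hA.cell_eq hi]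

theorem emits_emitMatrix (h : HasInput N n w s.cell s.reg) (hA : HoldsSet n A s) :
    Emits toOut ((sortedList n A).flatMap fun u => (sortedList n A).map (w u)) s
      ((BProg.emitMatrix toOut).run N O s) := by
  have hN := h.n_lt
  rw [sortedList, flatMap_filter]
  simp only [List.map_eq_flatMap, flatMap_filter]
  refine emits_forEach (by cases toOut <;> decide) (by simp [h.n_eq]) (show n ≤ N by omega)
    (by cases toOut <;> rfl) fun u hu s₁ hu' hc₁ hr₁ => ?_
  have h₁ : s₁.reg 1 = n := by rw [hr₁ 1 (by decide) (by cases toOut <;> decide), h.n_eq]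
  have e₁ : (BExpr.cell 5 (.reg 12)).eval N s₁.cell s₁.reg = if u ∈ A then 1 else 0 := by
    simp [hu', hc₁, hA.cell_eq hu]
  rw [BProg.run_cond, e₁]
  by_cases huA : u ∈ A
  · rw [if_pos (by simpa using huA), if_pos (by simpa using huA)]
    refine emits_forEach (by cases toOut <;> decide) (by simp [h₁]) (show n ≤ N by omega)
      (by cases toOut <;> rfl) fun v hv s₂ hv' hc₂ hr₂ => ?_
    have h₂ : HasInput N n w s₂.cell s₂.reg := by
      refine ⟨?_, h.le, by rw [hc₂, hc₁]; exact h.adj⟩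
      rw [hr₂ 1 (by decide) (by cases toOut <;> decide), h₁]
    have e₂ : (BExpr.cell 5 (.reg 13)).eval N s₂.cell s₂.reg = if v ∈ A then 1 else 0 := by
      simp [hv', hc₂, hc₁, hA.cell_eq hv]
    have hu₂ : s₂.reg 12 = u := by rw [hr₂ 12 (by decide) (by cases toOut <;> decide), hu']
    rw [BProg.run_cond, e₂]
    by_cases hvA : v ∈ A
    · rw [if_pos (by simpa using hvA), if_pos (by simpa using hvA)]
      convert emits_emit (N := N) (O := O) (s := s₂) (BExpr.adj (.reg 12) (.reg 13)) using 2
      rw [h₂.eval_adj (by simpa [hu₂] using hu) (by simpa [hv'] using hv)]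
      simp [hu₂, hv']
    · rw [if_neg (by simpa using hvA), if_neg (by simpa using hvA)]
      exact .refl
  · rw [if_neg (by simpa using huA), if_neg (by simpa using huA)]
    exact .refl

theorem emits_emitInst (hw : IsSemiComplete w (Finset.range n)) (h : IsContext N n c w pos s)
    (hA : HoldsSet n A s) (hn : A ⊆ Finset.range n) :
    Emits toOut (cutwidthProblem.encode (subInst hw c A)) s ((BProg.emitInst toOut).run N O s) := by
  have hrun : ∀ (e : BExpr) (s : State), IsContext N n c w pos s → HoldsSet n A s →
      IsContext N n c w pos ((BProg.emit toOut e).run N O s) ∧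
      HoldsSet n A ((BProg.emit toOut e).run N O s) := by
    intro e s h hA
    cases toOut <;> exact ⟨⟨⟨h.input.n_eq, h.input.le, h.input.adj⟩, h.bound, h.target, h.radius,
      h.pos_eq⟩, hA⟩
  rw [encode_subInst, BProg.emitInst, BProg.run_seq, BProg.run_seq, BProg.run_seq]
  have h₁ := hrun .size s h hA
  have h₂ := hrun (.const 0) _ h₁.1 h₁.2
  have h₃ := hrun (.reg 2) _ h₂.1 h₂.2
  have e := ((emits_emit (N := N) (O := O) (toOut := toOut) (s := s) .size).trans
    (emits_emit (N := N) (O := O) (.const 0))).trans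
    ((emits_emit (N := N) (O := O) (.reg 2)).trans (emits_emitMatrix (O := O) h₃.1.input h₃.2))
  rw [eval_size h.input hA hn rfl, ← length_sortedList hn, BExpr.eval, BExpr.eval, h₂.1.target] at e
  exact e

end Emits

/-! ## The kernelization programs -/

/-- A program without oracle calls behaves alike for all oracles, so its output may be computed with
any one of them. -/
theorem outputs_toProg {p : BProg} (h : p.noAsk = true) {x y : List ℕ} {O : Oracle}
    (hy : (p.run x.length O (initState x)).out = y) :
    Outputs p.toProg x ((p.time + 3).eval (bitLength x)) y := by
  intro O'
  obtain ⟨t, ht, hr⟩ := p.runs_toProg O' x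
  obtain ⟨h₁, h₂⟩ := BProg.run_noAsk (N := x.length) h O' O (initState x)
  rw [h₂, h₁, hy] at hr
  exact ⟨t, ht, hr⟩

theorem kernel_spec_encodeInput {n : ℕ} {D : Digraph (Fin n)} (hD : SemiComplete D) (c : ℤ)
    (O : Oracle) (fail start p finish : BProg) :
    (∃ s', SameOutput (initState (encodeInput D c)) s' ∧
      (BProg.kernel fail start p finish).run (encodeInput D c).length O
        (initState (encodeInput D c)) = fail.run (encodeInput D c).length O s' ∧ c < ctw D) ∨
    ∃ k : ℕ, c = k ∧ ∃ pos s', SameOutput (initState (encodeInput D c)) s' ∧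
      IsContext (encodeInput D c).length n k (weight D) pos s' ∧
      (BProg.kernel fail start p finish).run (encodeInput D c).length O
        (initState (encodeInput D c)) =
        finish.run (encodeInput D c).length O ((BProg.eachBag p).run (encodeInput D c).length O
          (start.run (encodeInput D c).length O s')) ∧
      IsKernelList (weight D) n k (bags (weight D) n (6 * k) pos (n + 1)) := by
  have hcell : ∀ i, (initState (encodeInput D c)).cell 0 i = (encodeInput D c).getD i 0 := by
    simp [initState]
  have hsign : (initState (encodeInput D c)).cell 0 1 = if c < 0 then 1 else 0 := by
    rw [hcell]
    rfl
  rcases kernel_spec (N := (encodeInput D c).length) (s := initState (encodeInput D c)) (n := n)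
    (c := c.natAbs) (w := weight D) (O := O) (by simp [initState]) (by rw [hcell]; rfl)
    (by rw [hcell]; rfl) (length_encodeInput D c).ge
    (fun u hu v hv => by rw [hcell, getD_encodeInput hu hv]) hD.isSemiComplete_weight
    fail start p finish with ⟨s', h₁, h₂, h₃⟩ | ⟨pos, s', h₁, h₂, h₃, h₄⟩
  · refine .inl ⟨s', h₁, h₂, ?_⟩
    rcases lt_or_ge c 0 with hc | hc
    · exact hc.trans_le (Int.natCast_nonneg _)
    · have := h₃ (by rw [hsign, if_neg hc.not_gt])
      rw [← ctw_le_iff_exists_isLayout_weight] at this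
      omega
  · refine .inr ⟨c.natAbs, ?_, pos, s', h₁, h₂, h₄⟩
    rw [hsign] at h₃
    split_ifs at h₃
    omega

/-- The program that computes induced subdigraphs. -/
def subdigraphs : BProg :=
  .kernel (.write (.const 0)) (.seq (.write (.const 1)) (.write .numBags)) .emitSet .skip

theorem subdigraphs_spec {n : ℕ} {D : Digraph (Fin n)} (hD : SemiComplete D) (c : ℤ) :
    ∃ r : Option (List (Finset (Fin n))),
      Outputs subdigraphs.toProg (encodeInput D c)
        ((subdigraphs.time + 3).eval (bitLength (encodeInput D c))) (encodeOutput r) ∧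
      (r = none → c < (ctw D : ℤ)) ∧
      (∀ L : List (Finset (Fin n)), r = some L →
        L.length ≤ n ∧
        (∀ X ∈ L, (X.card : ℤ) ≤ 24 * c ^ 2 + 40 * c + 1) ∧
        ((ctw D : ℤ) ≤ c ↔ ∀ X ∈ L, (ctw (induced D X) : ℤ) ≤ c)) := by
  rcases kernel_spec_encodeInput hD c (fun _ => false) (.write (.const 0))
    (.seq (.write (.const 1)) (.write .numBags)) .emitSet .skip with
    ⟨s, hs, hrun, hc⟩ | ⟨k, rfl, pos, s, hs, hctx, hrun, hL⟩
  · refine ⟨none, outputs_toProg (by decide) ((congrArg State.out hrun).trans ?_), fun _ => hc,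
      by simp⟩
    simp [BProg.run, hs.out, encodeOutput, BExpr.val, initState]
  · set L := bags (weight D) n (6 * k) pos (n + 1) with hLdef
    refine ⟨some (L.map (toFin n)), outputs_toProg (by decide)
      ((congrArg State.out hrun).trans ?_), by simp, ?_⟩
    · rw [BProg.run_seq]
      set s₁ := (BProg.write (.const 1)).run (encodeInput D k).length (fun _ => false) s with hs₁
      have hctx₁ : IsContext _ n k (weight D) pos s₁ :=
        hctx.run (by decide) (by decide) (by decide) (by decide) (by decide) (by decide)
      set s₂ := (BProg.write .numBags).run (encodeInput D k).length (fun _ => false) s₁ with hs₂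
      have hctx₂ : IsContext _ n k (weight D) pos s₂ :=
        hctx₁.run (by decide) (by decide) (by decide) (by decide) (by decide) (by decide)
      have hout₂ : s₂.out = [1, L.length] := by
        have : s₂.out = s.out ++ [1] ++ [BExpr.numBags.eval _ s₁.cell s₁.reg] := rfl
        rw [this, numBags_spec hctx₁, hs.out]
        rfl
      refine (eachBag_spec hctx₂ (p := .emitSet) (by decide) (by decide) (by decide)
        (fun L s => s.out = 1 :: (bags (weight D) n (6 * k) pos (n + 1)).length ::
          L.flatMap fun B => encodeSet (toFin n B)) ?_ ?_ ?_).trans ?_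
      · intro L s' s'' h _ _ _ h'
        rw [h, h']
      · intro L lo hi s' h hset hout
        have := (emits_emitSet (O := fun _ => false) h.input hset).channel
        simp only [State.channel] at this
        rw [this, hout, List.flatMap_append]
        simp [encodeSet_toFin]
      · rw [hout₂]
        simp [hLdef]
      · simp [encodeOutput, List.flatMap_map, hLdef]
    · rintro _ ⟨rfl⟩
      refine ⟨by simpa using hL.length_le, ?_, ?_⟩
      · intro X hX
        obtain ⟨B, hB, rfl⟩ := List.mem_map.1 hX
        have := (card_toFin_le (n := n) B).trans (hL.card_le B hB)
        zify at this
        omega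
      · rw [List.forall_mem_map, Nat.cast_le, ctw_le_iff_exists_isLayout_weight, hL.layout_iff]
        refine forall₂_congr fun B hB => ?_
        rw [Nat.cast_le, ctw_induced_toFin_le_iff (hL.subset B hB)]

/-- The bound on the size of the kernels. -/
noncomputable def kernelSize : Polynomial ℕ :=
  -- The constant `2`, instead of `1`, makes room for the two vertices of `noInst` when the
  -- parameter is `0`.
  Polynomial.C 24 * Polynomial.X ^ 2 + Polynomial.C 40 * Polynomial.X + Polynomial.C 2

theorem natDegree_kernelSize : kernelSize.natDegree ≤ 2 := Polynomial.natDegree_quadratic_le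

theorem eval_kernelSize (c : ℕ) : kernelSize.eval c = 24 * c ^ 2 + 40 * c + 2 := by
  simp [kernelSize]

theorem small_subInst {w : ℕ → ℕ → ℕ} {n c : ℕ} {B : Finset ℕ}
    (hw : IsSemiComplete w (Finset.range n)) (hB : B ⊆ Finset.range n)
    (hcard : B.card ≤ 24 * c ^ 2 + 16 * c + 1) :
    cutwidthProblem.Small (kernelSize.eval c) (subInst hw c B) := by
  refine ⟨?_, ?_⟩
  · rw [size_subInst hw hB, eval_kernelSize]
    omega
  · rw [eval_kernelSize]
    change c ≤ _
    omega

theorem yes_iff_forall_yes_subInst {I : CutwidthInst} {L : List (Finset ℕ)}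
    (hL : IsKernelList (weight I.D) I.n I.c L) :
    cutwidthProblem.Yes I ↔
      ∀ B ∈ L, cutwidthProblem.Yes (subInst I.semiComplete.isSemiComplete_weight I.c B) := by
  refine (ctw_le_iff_exists_isLayout_weight.trans hL.layout_iff).trans
    (forall₂_congr fun B hB => ?_)
  rw [yes_subInst _ (hL.subset B hB)]

/-- The adjacency matrix of complete digraphs. -/
def completeWeight (u v : ℕ) : ℕ := if u = v then 0 else 1

theorem isSemiComplete_completeWeight (S : Finset ℕ) : IsSemiComplete completeWeight S where
  le_one u _ v _ := by
    unfold completeWeight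
    split_ifs <;> simp
  irrefl u _ := if_pos rfl
  total u _ v _ h := by simp [completeWeight, h]

/-- The instance that asks whether the complete digraph on two vertices has cutwidth `0`. -/
noncomputable def noInst : cutwidthProblem.Inst :=
  subInst (isSemiComplete_completeWeight (Finset.range 2)) 0 (Finset.range 2)

theorem encode_noInst : cutwidthProblem.encode noInst = [2, 0, 0, 0, 1, 1, 0] :=
  (encode_subInst (isSemiComplete_completeWeight (Finset.range 2))).trans rfl

/-- Whichever vertex comes first, the arc from the other one to it crosses the cut between them. -/
theorem not_yes_noInst : ¬ cutwidthProblem.Yes noInst := by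
  rw [noInst, yes_subInst _ subset_rfl]
  rintro ⟨f, hf⟩
  have key : ∀ u ∈ Finset.range 2, ∀ v ∈ Finset.range 2, u ≠ v → ¬ f u < f v := by
    intro u hu v hv huv hlt
    have := (le_cutWeight (w := completeWeight) hv hu (X := {x | f x < f v}) (by simp)
      (by simpa using hlt)).trans (hf.cut_le (f v))
    simp [completeWeight, huv.symm] at this
  have h₁ := key 0 (by simp) 1 (by simp) (by simp)
  have h₂ := key 1 (by simp) 0 (by simp) (by simp)
  exact zero_ne_one (hf.injOn (show 0 ∈ (Finset.range 2 : Set ℕ) by simp)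
    (show 1 ∈ (Finset.range 2 : Set ℕ) by simp) (by omega))

/-- The program of the AND-Turing kernel. -/
def andKernel : BProg :=
  -- On failure the output is the list that consists of `noInst` alone: its length `1`, then the
  -- length `7` of the code, then the code.
  .kernel (.seq (.write (.const 1)) <| .seq (.write (.const 7)) <| .seq (.write (.const 2)) <|
      .seq (.write (.const 0)) <| .seq (.write (.const 0)) <| .seq (.write (.const 0)) <|
      .seq (.write (.const 1)) <| .seq (.write (.const 1)) (.write (.const 0)))
    (.write .numBags)
    -- The length of the code precedes it: the square of the size, computed as an iterated sum, and
    -- three header entries.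
    (.seq (.write (.add (.sum 25 .size .size) (.const 3))) (.emitInst true)) .skip

theorem length_encode_subInst {w : ℕ → ℕ → ℕ} {n c : ℕ} {B : Finset ℕ}
    (hw : IsSemiComplete w (Finset.range n)) (hB : B ⊆ Finset.range n) :
    (cutwidthProblem.encode (subInst hw c B)).length = B.card * B.card + 3 := by
  rw [← length_sortedList hB]
  exact length_encodeInput _ _

theorem hasAndTuringKernel :
    HasAndTuringKernel cutwidthProblem (fun c => kernelSize.eval c) CutwidthInst.n := by
  refine ⟨andKernel.toProg, andKernel.time + 3, fun (I : CutwidthInst) => ?_⟩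
  have hw := I.semiComplete.isSemiComplete_weight
  rcases kernel_spec_encodeInput I.semiComplete I.c (fun _ => false) _ _ _ _ with
    ⟨s, hs, hrun, hc⟩ | ⟨k, hk, pos, s, hs, hctx, hrun, hL⟩
  · have hno : ¬ cutwidthProblem.Yes I := by
      change ¬ ctw I.D ≤ I.c
      omega
    refine ⟨[noInst], outputs_toProg (by decide) ((congrArg State.out hrun).trans ?_), ?_, ?_, ?_⟩
    · simp [BProg.run, hs.out, ParamProblem.encodeList, encode_noInst, BExpr.val, initState]
    -- A digraph without vertices has a layout of every width, so a negative answer implies `1 ≤ n`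
    -- and one output instance is allowed.
    · rw [List.length_singleton, Nat.one_le_iff_ne_zero]
      intro h0
      refine hno (ctw_le_iff_exists_isLayout_weight.2 ⟨fun _ => 0, ?_, ?_⟩) <;>
      simp [h0, cutWeight]
    · rw [List.forall_mem_singleton]
      refine ⟨?_, Nat.zero_le _⟩
      change _ ≤ kernelSize.eval I.c
      rw [noInst, size_subInst _ subset_rfl, eval_kernelSize]
      simp
    · simp [hno, not_yes_noInst]
  · obtain rfl : I.c = k := by exact_mod_cast hk
    set L := bags (weight I.D) I.n (6 * I.c) pos (I.n + 1) with hLdef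
    refine ⟨L.map (subInst hw I.c), outputs_toProg (by decide)
      ((congrArg State.out hrun).trans ?_), by simpa using hL.length_le, ?_, ?_⟩
    · set N := (encodeInput I.D I.c).length
      set s₁ := (BProg.write .numBags).run N (fun _ => false) s with hs₁
      have hctx₁ : IsContext N I.n I.c (weight I.D) pos s₁ :=
        hctx.run (by decide) (by decide) (by decide) (by decide) (by decide) (by decide)
      have hout₁ : s₁.out = [L.length] := by
        have : s₁.out = s.out ++ [BExpr.numBags.eval _ s.cell s.reg] := rfl
        rw [this, numBags_spec hctx, hs.out]
        rfl
      refine (eachBag_spec hctx₁ (by decide) (by decide) (by decide)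
        (fun L s => s.out = (bags (weight I.D) I.n (6 * I.c) pos (I.n + 1)).length ::
          L.flatMap fun B => (cutwidthProblem.encode (subInst hw I.c B)).length ::
            cutwidthProblem.encode (subInst hw I.c B)) ?_ ?_ ?_).trans ?_
      · intro L s' s'' h _ _ _ h'
        rw [h, h']
      · intro L lo hi s' h hset hout
        have hN := h.input.n_lt
        have hcard : (bag (weight I.D) I.n pos lo hi).card ≤ I.n := by
          simpa using Finset.card_le_card (bag_subset (w := weight I.D) (n := I.n) (pos := pos))
        rw [BProg.run_seq]
        set s'' := (BProg.write (.add (.sum 25 .size .size) (.const 3))).run N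
          (fun _ => false) s' with hs''
        have h'' : IsContext N I.n I.c (weight I.D) pos s'' :=
          h.run (by decide) (by decide) (by decide) (by decide) (by decide) (by decide)
        have hout'' : s''.out = s'.out ++
            [(cutwidthProblem.encode (subInst hw I.c (bag (weight I.D) I.n pos lo hi))).length] := by
          have : s''.out = s'.out ++
            [(BExpr.add (.sum 25 .size .size) (.const 3)).eval N s'.cell s'.reg] := rfl
          rw [this, length_encode_subInst hw bag_subset, BExpr.eval, BExpr.eval,
            BExpr.eval, eval_size h.input hset bag_subset rfl, min_eq_left (by omega),
            Finset.sum_congr rfl fun i _ => eval_size h.input hset bag_subset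
              (Function.update_of_ne (by decide) ..)]
          simp
        have := (emits_emitInst (toOut := true) (O := fun _ => false) hw h'' hset
          bag_subset).channel
        simp only [State.channel] at this
        rw [this, hout'', hout, List.flatMap_append]
        simp
      · rw [hout₁]
        simp [hLdef]
      · simp [ParamProblem.encodeList, List.flatMap_map, hLdef]
    · rw [List.forall_mem_map]
      exact fun B hB => small_subInst hw (hL.subset B hB) (hL.card_le B hB)
    · rw [List.forall_mem_map]
      exact yes_iff_forall_yes_subInst hL

/-- The program of the Turing kernel. -/
def turingKernel : BProg :=
  .kernel (.write (.const 0)) (.setReg 10 (.const 1))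
    (.seq (.emitInst false) (.seq (.ask 11) (.cond (.reg 11) .skip (.setReg 10 (.const 0)))))
    (.write (.reg 10))

theorem hasTuringKernel :
    HasTuringKernel cutwidthProblem (fun c => kernelSize.eval c) CutwidthInst.n := by
  classical
  refine ⟨turingKernel.toProg, turingKernel.time + 3, fun (I : CutwidthInst) O hO => ?_⟩
  have hw := I.semiComplete.isSemiComplete_weight
  obtain ⟨t, ht, hr⟩ := turingKernel.runs_toProg O (cutwidthProblem.encode I)
  refine ⟨t, ht, ?_⟩
  rcases kernel_spec_encodeInput I.semiComplete I.c O (.write (.const 0)) (.setReg 10 (.const 1))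
    (.seq (.emitInst false) (.seq (.ask 11) (.cond (.reg 11) .skip (.setReg 10 (.const 0)))))
    (.write (.reg 10)) with
    ⟨s, hs, hrun, hc⟩ | ⟨k, hk, pos, s, hs, hctx, hrun, hL⟩
  · have hno : ¬ cutwidthProblem.Yes I := by
      change ¬ ctw I.D ≤ I.c
      omega
    refine ⟨[], ?_, by simp, by simp⟩
    convert hr using 1
    · exact ((congrArg State.asked hrun).trans hs.asked).symm
    · refine Eq.symm ((congrArg State.out hrun).trans ?_)
      simp [BProg.run, hs.out, hno, BExpr.val, initState]
  · obtain rfl : I.c = k := by exact_mod_cast hk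
    set L := bags (weight I.D) I.n (6 * I.c) pos (I.n + 1) with hLdef
    set N := (encodeInput I.D I.c).length
    set s₁ := (BProg.setReg 10 (.const 1)).run N O s with hs₁
    have hctx₁ : IsContext N I.n I.c (weight I.D) pos s₁ :=
      hctx.run (by decide) (by decide) (by decide) (by decide) (by decide) (by decide)
    have hmain := eachBag_spec (O := O) hctx₁
      (p := .seq (.emitInst false) (.seq (.ask 11) (.cond (.reg 11) .skip (.setReg 10 (.const 0)))))
      (by decide) (by decide) (by decide)
      -- Every bag is queried, even after a negative answer; register `10` holds the conjunction of
      -- the answers so far.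
      (fun L s => s.out = [] ∧ s.tape = [] ∧
        s.asked = L.map (fun B => cutwidthProblem.encode (subInst hw I.c B)) ∧
        s.reg 10 = if ∀ B ∈ L, O (cutwidthProblem.encode (subInst hw I.c B)) = true then 1 else 0)
      ?_ ?_ ?_
    · obtain ⟨h₁, -, h₂, h₃⟩ := hmain
      refine ⟨L.map fun B => cutwidthProblem.encode (subInst hw I.c B), ?_,
        by simpa using hL.length_le, ?_⟩
      · convert hr using 1
        · exact ((congrArg State.asked hrun).trans h₂).symm
        · refine Eq.symm ((congrArg State.out hrun).trans ?_)
          change _ ++ [State.reg _ 10] = _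
          rw [h₁, h₃]
          refine congrArg (fun x => [x]) (if_congr ?_ rfl rfl)
          rw [yes_iff_forall_yes_subInst hL]
          -- Only here is the correctness of the oracle used; it applies because the instances of
          -- all bags are small.
          exact forall₂_congr fun B hB =>
            hO _ (small_subInst hw (hL.subset B hB) (hL.card_le B hB))
      · rw [List.forall_mem_map]
        exact fun B hB => ⟨_, small_subInst hw (hL.subset B hB) (hL.card_le B hB), rfl⟩
    · rintro L s' s'' h₁ h₂ h₃ h₄ ⟨h₅, h₆, h₇, h₈⟩
      exact ⟨h₁.trans h₅, h₂.trans h₆, h₃.trans h₇, h₄.trans h₈⟩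
    · rintro L lo hi s' h hset ⟨hout, htape, hasked, hreg⟩
      have hem := emits_emitInst (toOut := false) (O := O) hw h hset bag_subset
      rw [BProg.run_seq, BProg.run_seq]
      set B := bag (weight I.D) I.n pos lo hi
      set s₂ := (BProg.emitInst false).run N O s' with hs₂
      have htape₂ : s₂.tape = cutwidthProblem.encode (subInst hw I.c B) := by
        have := hem.channel
        simp only [State.channel] at this
        rw [this, htape, List.nil_append]
      have hout₂ : s₂.out = [] := hem.other.trans hout
      have hreg₂ : s₂.reg 10 = s'.reg 10 := BProg.run_reg (by decide) s'
      set s₃ := (BProg.ask 11).run N O s₂ with hs₃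
      have hasked₃ : s₃.asked = (L ++ [B]).map
          fun B => cutwidthProblem.encode (subInst hw I.c B) := by
        have : s₃.asked = s₂.asked ++ [s₂.tape] := rfl
        rw [this, hem.asked, hasked, htape₂]
        simp
      have hreg₃ : s₃.reg = Function.update s₂.reg 11 (if O s₂.tape = true then 1 else 0) := rfl
      have h11 : s₃.reg 11 = if O s₂.tape = true then 1 else 0 := by
        rw [hreg₃, Function.update_self]
      have h10 : s₃.reg 10 = s₂.reg 10 := BProg.run_reg (by decide) s₂
      rw [htape₂] at h11
      rw [BProg.run_cond, BExpr.eval, h11]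
      by_cases hB : O (cutwidthProblem.encode (subInst hw I.c B)) = true
      · rw [if_pos (by simp [hB])]
        refine ⟨hout₂, rfl, hasked₃, ?_⟩
        rw [BProg.run, h10, hreg₂, hreg]
        refine if_congr ?_ rfl rfl
        rw [List.forall_mem_append, List.forall_mem_singleton]
        exact (and_iff_left hB).symm
      · rw [if_neg (by simp [hB])]
        refine ⟨hout₂, rfl, hasked₃, ?_⟩
        rw [BProg.run_setReg_reg, Function.update_self, if_neg]
        · rfl
        · exact fun hall => hB (hall B (by simp))
    · refine ⟨hs.out, hs.tape, hs.asked, ?_⟩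
      rw [hs₁, BProg.run_setReg_reg]
      simp

end CutKernel

theorem mainTheorem2 :
    (∃ (P : CutKernel.Prog) (p : Polynomial ℕ),
      ∀ (n : ℕ) (D : Digraph (Fin n)) (c : ℤ), CutKernel.SemiComplete D →
        ∃ r : Option (List (Finset (Fin n))),
          CutKernel.Outputs P (CutKernel.encodeInput D c)
            (p.eval (CutKernel.bitLength (CutKernel.encodeInput D c)))
            (CutKernel.encodeOutput r) ∧
          (r = none → c < (CutKernel.ctw D : ℤ)) ∧
          (∀ L : List (Finset (Fin n)), r = some L →
            L.length ≤ n ∧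
            (∀ X ∈ L, (X.card : ℤ) ≤ 24 * c ^ 2 + 40 * c + 1) ∧
            ((CutKernel.ctw D : ℤ) ≤ c ↔
              ∀ X ∈ L, (CutKernel.ctw (CutKernel.induced D X) : ℤ) ≤ c))) ∧
    (∃ q : Polynomial ℕ, q.natDegree ≤ 2 ∧
      CutKernel.HasAndTuringKernel CutKernel.cutwidthProblem (fun c => q.eval c)
        (fun I => CutKernel.CutwidthInst.n I)) ∧
    (∃ q : Polynomial ℕ, q.natDegree ≤ 2 ∧
      CutKernel.HasTuringKernel CutKernel.cutwidthProblem (fun c => q.eval c)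
        (fun I => CutKernel.CutwidthInst.n I)) :=
  ⟨⟨_, _, fun _ _ c hD => CutKernel.subdigraphs_spec hD c⟩,
    ⟨_, CutKernel.natDegree_kernelSize, CutKernel.hasAndTuringKernel⟩,
    ⟨_, CutKernel.natDegree_kernelSize, CutKernel.hasTuringKernel⟩⟩
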